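/- **Setting.** Let $\alpha,\beta,h\ge 0$ and let $J$ be a real random variable with symmetric law and $\mathbb E|J|<\infty$. $P_\zeta$ denotes a Poisson variable of mean $\zeta$; $J_\nu,\hat J_\nu,\tilde J_\nu$ are independent copies of $J$; $i_\nu,l_\nu$ are uniform on $\{1,\dots,N\}$ and $j_\nu,k_\nu$ uniform on $\{1,\dots,M\}$. All these variables are independent, and $\mathbb E$ is the expectation over all of them and over the random weights below. For $\sigma\in\{\pm1\}^M$, $\tau\in\{\pm1\}^N$ ($N,M\ge1$) put $$H_M(\sigma,\alpha)=-\sum_{\nu=1}^{P_{\alpha M}}J_\nu\sigma_{j_\nu}\sigma_{k_\nu},\quad \kappa(\tau,\alpha)=-\sum_{\nu=1}^{P_{\alpha M}}\hat J_\nu\tau_{i_\nu}\tau_{l_\nu},\quad \eta(\tau,\sigma,\alpha)=-\sum_{\nu=1}^{P_{2\alpha M}}\tilde J_\nu\tau_{i_\nu}\sigma_{j_\nu},\quad H^{ext}_M(\sigma)=-h\sum_{j=1}^M\sigma_j ,$$ with independent disorder, and $$-\beta f_M=\frac1M\,\mathbb E\ln\sum_\sigma e^{-\beta(H_M(\sigma,\alpha)+H^{ext}_M(\sigma))}.$$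 A system of weights $\xi$ on a countable set $\Sigma$ is a random family $(\xi_\gamma)_{\gamma\in\Sigma}$, independent of all other variables, with $\xi_\gamma\ge0$ and $0<\sum_\gamma\xi_\gamma<\infty$ almost surely. For a system of weights $\xi$ on $\{\pm1\}^N$ and $t\in[0,1]$ let $H(t)=H_M(t\alpha)+\kappa(t\alpha)+\eta((1-t)\alpha)+H^{ext}_M$ and $$R_M(t)=\frac1M\mathbb E\ln\frac{\sum_{\tau,\sigma}\xi_\tau e^{-\beta H(t)}}{\sum_\tau\xi_\tau e^{-\beta\kappa(\tau,\alpha)}},\qquad G_M(\xi)=\frac1M\mathbb E\ln\frac{\sum_{\tau,\sigma}\xi_\tau e^{-\beta(\eta(\tau,\sigma,\alpha)+H^{ext}_M(\sigma))}}{\sum_\tau\xi_\tau e^{-\beta\kappa(\tau,\alpha)}} .$$ For $n$ replicas put $q_n=\frac1N\sum_i\tau^{(1)}_i\cdots\tau^{(n)}_i$ and $\tilde q_n=\frac1M\sum_j\sigma^{(1)}_j\cdots\sigma^{(n)}_j$; $\langle\cdot\rangle_t$ is the $\mathbb E$-average of the average over independent replicas $(\tau^{(a)},\sigma^{(a)})$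 drawn with probability proportional to $\xi_\tau e^{-\beta H(t)}$. **Theorem (Generalized Bound).** 1. For all $N,M\ge1$ and every system of weights $\xi$ on $\{\pm1\}^N$ the variables whose expectations define $f_M$, $R_M(t)$ and $G_M(\xi)$ are integrable, $R_M(0)=G_M(\xi)$, $R_M(1)=-\beta f_M$, and for every $t\in[0,1]$ (one-sided derivative at the end points) $$\frac{d}{dt}R_M(t)=-\alpha\sum_{n=1}^\infty\frac1{2n}\,\mathbb E[\tanh^{2n}(\beta J)]\,\big\langle(q_{2n}-\tilde q_{2n})^2\big\rangle_t\le 0,$$ the series being convergent. 2. Hence $-\beta f_M\le G_M(\xi)$ for all $N,M\ge 1$ and all $\xi$, and so $-\beta f_M\le\inf_\xi G_M(\xi)$, both for the infimum over the weights on $\{\pm1\}^N$ with $N$ given and for the infimum over all $N\ge1$ and all weights on $\{\pm1\}^N$. 3. The limits $-\beta f:=\lim_M(-\beta f_M)$ and $\lim_M\inf_\xi G_M(\xi)$ (infimum over all $N$ and all weights on $\{\pm1\}^N$) exist in $\mathbb R$, and $$-\beta f\le\lim_{M\to\infty}\inf_\xi G_M(\xi).$$ Moreover, for any choice of cavity sizes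 $N_M\ge1$, $-\beta f\le\liminf_M\inf_{\xi}G_M(\xi)$ with the infimum over the weights on $\{\pm1\}^{N_M}$. 4. A Random Multi-Overlap Structure $\mathcal R=(\Sigma,\{q_n\},\xi)$ consists of a countable discrete space $\Sigma$, kernels $q_n:\Sigma^n\to[-1,1]$ such that each $q_{2k}$ ($k\ge1$) is positive semidefinite as a kernel on $\Sigma^k\times\Sigma^k$, $q_{2k}(\gamma,\dots,\gamma)=1$, and $q_2(\gamma,\gamma')=1$ only if $\gamma=\gamma'$, and a system of weights $\xi$ on $\Sigma$. Auxiliary random fields compatible with $\mathcal R$ are two random fields $X,Y:\Sigma\to\{\pm1\}$ with $\mathbb E\prod_{a=1}^{2k}X(\gamma_a)=q_{2k}(\gamma_1,\dots,\gamma_{2k})^2$ and $\mathbb E\prod_{a=1}^{2k}Y(\gamma_a)=q_{2k}(\gamma_1,\dots,\gamma_{2k})$ for all $k\ge1$. With i.i.d. copies $X_\nu$, $Y_\nu$ of them, put $\kappa(\gamma)=-\sum_{\nu=1}^{P_{\alpha M}}\hat J_\nu X_\nu(\gamma)$ and $\eta(\gamma,\sigma)=-\sum_{\nu=1}^{P_{2\alpha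 M}}\tilde J_\nu Y_\nu(\gamma)\sigma_{j_\nu}$, and $$G_M(\mathcal R,\eta,\kappa)=\frac1M\mathbb E\ln\frac{\sum_{\gamma,\sigma}\xi_\gamma e^{-\beta(\eta(\gamma,\sigma)+H^{ext}_M(\sigma))}}{\sum_\gamma\xi_\gamma e^{-\beta\kappa(\gamma)}} .$$ Then for every $M\ge1$ the variable under $\mathbb E$ is integrable, $-\beta f_M\le G_M(\mathcal R,\eta,\kappa)$ for every Random Multi-Overlap Structure and all compatible auxiliary fields, and so $-\beta f_M\le\inf_{\mathcal R}G_M$, the infimum being over all Random Multi-Overlap Structures with compatible auxiliary fields. -/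

import Mathlib

open MeasureTheory ProbabilityTheory Filter Topology

noncomputable section

namespace VianaBray

/-! ### Spins, samples of random bonds, Hamiltonians -/

/-- Configurations of `K` Ising spins. -/
abbrev Conf (K : ℕ) : Type := Fin K → ℤˣ

/-- An Ising spin as a real number `1` or `-1`. -/
def spin (s : ℤˣ) : ℝ := ((s : ℤ) : ℝ)

/-- A realization of the disorder of one diluted Hamiltonian: the number of terms, the sequence
of couplings, and the sequence of marks (for example the end points of the bonds). -/
abbrev Sample (B : Type) : Type := ℕ × (ℕ → ℝ × B)

/-- The law of a sample: the number of terms is Poisson of mean `ζ`, the couplings are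
independent with law `μ`, the marks are independent with law `ν`, and all of these are
independent of one another. -/
def sampleLaw {B : Type} [MeasurableSpace B] (ζ : ℝ) (μ : Measure ℝ) (ν : Measure B) :
    Measure (Sample B) :=
  (poissonMeasure ζ.toNNReal).prod (Measure.infinitePi fun _ : ℕ => μ.prod ν)

/-- The law of a pair of independent uniformly distributed sites. -/
def sitesLaw (K L : ℕ) : Measure (Fin K × Fin L) :=
  (uniformOn (Set.univ : Set (Fin K))).prod (uniformOn (Set.univ : Set (Fin L)))

/-- `- ∑_ν J_ν b_ν(s)`, the sum being over the terms of the sample. -/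
def energy {B S : Type} (b : B → S → ℝ) (D : Sample B) (s : S) : ℝ :=
  -∑ ν ∈ Finset.range D.1, (D.2 ν).1 * b (D.2 ν).2 s

/-- `- ∑_ν J_ν σ_{j_ν} σ_{k_ν}`: this is `H_M` on the added spins, and `κ` on the cavity. -/
def pairEnergy {K : ℕ} (D : Sample (Fin K × Fin K)) (σ : Conf K) : ℝ :=
  energy (fun (p : Fin K × Fin K) (s : Conf K) => spin (s p.1) * spin (s p.2)) D σ

/-- `η(τ, σ) = - ∑_ν J_ν τ_{i_ν} σ_{j_ν}`. -/
def etaEnergy {N M : ℕ} (D : Sample (Fin N × Fin M)) (τ : Conf N) (σ : Conf M) : ℝ :=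
  energy (fun (p : Fin N × Fin M) (s : Conf N × Conf M) => spin (s.1 p.1) * spin (s.2 p.2))
    D (τ, σ)

/-- The external field term `- h ∑_j σ_j`. -/
def extEnergy {K : ℕ} (h : ℝ) (σ : Conf K) : ℝ := -h * ∑ j, spin (σ j)

/-! ### The free energy of the Viana–Bray model -/

/-- The partition function. -/
def partitionFunction {M : ℕ} (β h : ℝ) (D : Sample (Fin M × Fin M)) : ℝ :=
  ∑ σ : Conf M, Real.exp (-β * (pairEnergy D σ + extEnergy h σ))

/-- The law of the disorder of `H_M(α)`. -/
def hamLaw (μ : Measure ℝ) (α : ℝ) (M : ℕ) : Measure (Sample (Fin M × Fin M)) :=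
  sampleLaw (α * M) μ (sitesLaw M M)

/-- `- β f_M = (1/M) 𝔼 ln Z_M`. -/
def negBetaF (μ : Measure ℝ) (α β h : ℝ) (M : ℕ) : ℝ :=
  (1 / (M : ℝ)) * ∫ D, Real.log (partitionFunction β h D) ∂(hamLaw μ α M)

/-! ### Random weights -/

/-- A system of random weights on `S`, given by its joint law: almost surely the weights are
non-negative and their sum is finite and not zero. -/
structure RandomWeights (S : Type) where
  law : Measure (S → ℝ)
  isProbabilityMeasure : IsProbabilityMeasure law
  nonneg : ∀ᵐ ξ ∂law, ∀ s, 0 ≤ ξ s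
  summable : ∀ᵐ ξ ∂law, Summable ξ
  sum_pos : ∀ᵐ ξ ∂law, 0 < ∑' s, ξ s

/-! ### The interpolation on the cavity lattice -/

/-- Quenched variables of the interpolation: the weights, the samples of `H_M`, `κ`, `η` in the
numerator, and the sample of `κ` in the denominator. -/
abbrev Disorder (N M : ℕ) : Type :=
  ((Conf N → ℝ) × Sample (Fin M × Fin M) × Sample (Fin N × Fin N) × Sample (Fin N × Fin M)) ×
    Sample (Fin N × Fin N)

/-- The joint law of the quenched variables at time `t`: they are independent, and the numbers of
terms have the means `tαM` for `H_M`, `tαM` for `κ`, `2(1-t)αM` for `η`, and `αM` for the `κ` of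
the denominator. -/
def disorderLaw (μ : Measure ℝ) (α : ℝ) (N M : ℕ) (ξ : RandomWeights (Conf N)) (t : ℝ) :
    Measure (Disorder N M) :=
  (ξ.law.prod ((hamLaw μ (t * α) M).prod
    ((sampleLaw (t * α * M) μ (sitesLaw N N)).prod
      (sampleLaw (2 * ((1 - t) * α) * M) μ (sitesLaw N M))))).prod
    (sampleLaw (α * M) μ (sitesLaw N N))

/-- `ξ_τ exp(-β H(t))` with `H(t) = H_M(tα) + κ(tα) + η((1-t)α) + H^{ext}_M`. The dependence on
`t` sits in the law of the disorder. -/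
def interpWeight {N M : ℕ} (β h : ℝ) (D : Disorder N M) (x : Conf N × Conf M) : ℝ :=
  D.1.1 x.1 * Real.exp (-β * (pairEnergy D.1.2.1 x.2 + pairEnergy D.1.2.2.1 x.1 +
    etaEnergy D.1.2.2.2 x.1 x.2 + extEnergy h x.2))

/-- The logarithm of the ratio whose expectation is `M R_M(t)`. -/
def interpLog {N M : ℕ} (β h : ℝ) (D : Disorder N M) : ℝ :=
  Real.log ((∑ x : Conf N × Conf M, interpWeight β h D x) /
    ∑ τ : Conf N, D.1.1 τ * Real.exp (-β * pairEnergy D.2 τ))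

/-- The interpolating function `R_M(t)`. -/
def interpR (μ : Measure ℝ) (α β h : ℝ) (N M : ℕ) (ξ : RandomWeights (Conf N)) (t : ℝ) : ℝ :=
  (1 / (M : ℝ)) * ∫ D, interpLog β h D ∂(disorderLaw μ α N M ξ t)

/-- The law of the weights, of the sample of `η(α)` and of the sample of `κ(α)`. -/
def trialLaw (μ : Measure ℝ) (α : ℝ) (N M : ℕ) (ξ : RandomWeights (Conf N)) :
    Measure ((Conf N → ℝ) × Sample (Fin N × Fin M) × Sample (Fin N × Fin N)) :=
  ξ.law.prod ((sampleLaw (2 * α * M) μ (sitesLaw N M)).prod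
    (sampleLaw (α * M) μ (sitesLaw N N)))

/-- The logarithm of the ratio whose expectation is `M G_M(ξ)`. -/
def trialLog {N M : ℕ} (β h : ℝ)
    (D : (Conf N → ℝ) × Sample (Fin N × Fin M) × Sample (Fin N × Fin N)) : ℝ :=
  Real.log
    ((∑ τ : Conf N, ∑ σ : Conf M,
        D.1 τ * Real.exp (-β * (etaEnergy D.2.1 τ σ + extEnergy h σ))) /
      ∑ τ : Conf N, D.1 τ * Real.exp (-β * pairEnergy D.2.2 τ))

/-- The trial function `G_M(ξ)`. -/
def trialG (μ : Measure ℝ) (α β h : ℝ) (N M : ℕ) (ξ : RandomWeights (Conf N)) : ℝ :=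
  (1 / (M : ℝ)) * ∫ D, trialLog β h D ∂(trialLaw μ α N M ξ)

/-! ### Replicas and multi-overlaps -/

/-- The multi-overlap `(1/K) ∑_i s_i^{(1)} ⋯ s_i^{(n)}` of `n` configurations. -/
def multiOverlap {K n : ℕ} (s : Fin n → Conf K) : ℝ :=
  (1 / (K : ℝ)) * ∑ i : Fin K, ∏ a : Fin n, spin (s a i)

/-- The average of `O` over `n` independent replicas of the probability on `A` with the (not
normalized) weights `w`. -/
def replicaAvg {A : Type} [Fintype A] (n : ℕ) (w : A → ℝ) (O : (Fin n → A) → ℝ) : ℝ :=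
  (∑ x : Fin n → A, (∏ a, w (x a)) * O x) / (∑ a, w a) ^ n

/-- `⟨(q_n - q̃_n)²⟩_t`. -/
def overlapGap (μ : Measure ℝ) (α β h : ℝ) (N M : ℕ) (ξ : RandomWeights (Conf N)) (t : ℝ)
    (n : ℕ) : ℝ :=
  ∫ D, replicaAvg n (interpWeight β h D)
    (fun x => (multiOverlap (fun a => (x a).1) - multiOverlap (fun a => (x a).2)) ^ 2)
    ∂(disorderLaw μ α N M ξ t)

/-- `(1/2n) 𝔼[tanh^{2n}(βJ)] ⟨(q_{2n} - q̃_{2n})²⟩_t`. -/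
def gapTerm (μ : Measure ℝ) (α β h : ℝ) (N M : ℕ) (ξ : RandomWeights (Conf N)) (t : ℝ)
    (n : ℕ) : ℝ :=
  (1 / (2 * (n : ℝ))) * (∫ J, Real.tanh (β * J) ^ (2 * n) ∂μ) *
    overlapGap μ α β h N M ξ t (2 * n)

/-! ### Random Multi-Overlap Structures -/

/-- A Random Multi-Overlap Structure: a countable discrete space, a positive definite
multi-overlap kernel, normalized on the diagonal and separating points, and random weights. -/
structure RaMOSt where
  Space : Type
  countable : Countable Space
  /-- the kernels `q_n : Σⁿ → ℝ` -/
  q : (n : ℕ) → (Fin n → Space) → ℝ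
  abs_q_le_one : ∀ n γ, |q n γ| ≤ 1
  /-- each `q_{2k}`, seen as a kernel on `Σᵏ × Σᵏ`, is positive semidefinite -/
  posDef : ∀ k, 1 ≤ k → ∀ (m : ℕ) (x : Fin m → Fin k → Space) (c : Fin m → ℝ),
    0 ≤ ∑ i, ∑ j, c i * c j * q (k + k) (Fin.append (x i) (x j))
  q_diag : ∀ k, 1 ≤ k → ∀ γ : Space, q (2 * k) (fun _ => γ) = 1
  eq_of_q_eq_one : ∀ γ γ' : Space, q 2 ![γ, γ'] = 1 → γ = γ'
  weights : RandomWeights Space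

/-- Auxiliary random fields compatible with the multi-overlap kernel: random fields `X` (for `κ`)
and `Y` (for `η`) of signs on `Σ`, given by their laws, such that
`𝔼 X(γ₁) ⋯ X(γ_{2k}) = q_{2k}(γ₁, …, γ_{2k})²` and
`𝔼 Y(γ₁) ⋯ Y(γ_{2k}) = q_{2k}(γ₁, …, γ_{2k})`. -/
structure RaMOSt.Fields (R : RaMOSt) where
  kappaLaw : Measure (R.Space → ℤˣ)
  etaLaw : Measure (R.Space → ℤˣ)
  isProbabilityMeasure_kappa : IsProbabilityMeasure kappaLaw
  isProbabilityMeasure_eta : IsProbabilityMeasure etaLaw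
  kappa_moment : ∀ k, 1 ≤ k → ∀ γ : Fin (2 * k) → R.Space,
    ∫ X, ∏ a, spin (X (γ a)) ∂kappaLaw = R.q (2 * k) γ ^ 2
  eta_moment : ∀ k, 1 ≤ k → ∀ γ : Fin (2 * k) → R.Space,
    ∫ Y, ∏ a, spin (Y (γ a)) ∂etaLaw = R.q (2 * k) γ

/-- `κ(γ) = - ∑_ν J_ν X_ν(γ)`. -/
def ramostKappa {S : Type} (D : Sample (S → ℤˣ)) (γ : S) : ℝ :=
  energy (fun (X : S → ℤˣ) (s : S) => spin (X s)) D γ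

/-- `η(γ, σ) = - ∑_ν J_ν Y_ν(γ) σ_{j_ν}`. -/
def ramostEta {S : Type} {M : ℕ} (D : Sample ((S → ℤˣ) × Fin M)) (γ : S) (σ : Conf M) : ℝ :=
  energy (fun (p : (S → ℤˣ) × Fin M) (s : S × Conf M) => spin (p.1 s.1) * spin (s.2 p.2))
    D (γ, σ)

/-- The law of the weights, of the sample of `η(α)` and of the sample of `κ(α)`. -/
def ramostLaw (μ : Measure ℝ) (α : ℝ) (M : ℕ) (R : RaMOSt) (F : R.Fields) :
    Measure ((R.Space → ℝ) × Sample ((R.Space → ℤˣ) × Fin M) × Sample (R.Space → ℤˣ)) :=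
  R.weights.law.prod
    ((sampleLaw (2 * α * M) μ (F.etaLaw.prod (uniformOn (Set.univ : Set (Fin M))))).prod
      (sampleLaw (α * M) μ F.kappaLaw))

/-- The logarithm of the ratio whose expectation is `M G_M(R, η, κ)`. -/
def ramostLog {S : Type} {M : ℕ} (β h : ℝ)
    (D : (S → ℝ) × Sample ((S → ℤˣ) × Fin M) × Sample (S → ℤˣ)) : ℝ :=
  Real.log
    ((∑' γ : S, ∑ σ : Conf M,
        D.1 γ * Real.exp (-β * (ramostEta D.2.1 γ σ + extEnergy h σ))) /
      ∑' γ : S, D.1 γ * Real.exp (-β * ramostKappa D.2.2 γ))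

/-- The trial function `G_M(R, η, κ)`. -/
def ramostG (μ : Measure ℝ) (α β h : ℝ) (M : ℕ) (R : RaMOSt) (F : R.Fields) : ℝ :=
  (1 / (M : ℝ)) * ∫ D, ramostLog β h D ∂(ramostLaw μ α M R F)

end VianaBray

end

open VianaBray

/-! All inequalities and all limits come from one principle, the exchange of diluted Hamiltonians.
Take three independent Poisson families of bonds with intensities `t * a₁`, `t * a₂` and `(1 - t) *
(a₁ + a₂)`. Differentiating a Poisson average in its mean compares the system with one extra bond to
the system without it. The total intensity does not depend on `t`, so only the three terms with an
extra bond survive, with coefficients `a₁`, `a₂` and `-(a₁ + a₂)`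
(`hasDerivWithinAt_integral_tripleLaw`).

An extra bond with coupling `J` and field `b = ±1` adds `log (cosh (βJ) + m sinh (βJ))` to the
log-partition function, where `m` is the Gibbs average of `b` (`IsWeight.logAvg_sub_bond`).
Averaging over a symmetric `J` kills the odd powers of `m` and leaves `𝔼 log cosh (βJ) - ∑
𝔼[tanh^{2n}(βJ)] m^{2n} / 2n` (`hasSum_tanhCoef`). The coefficients of the exchange sum to zero, so
the `log cosh` terms cancel. The powers `m^{2n}` are averages over `2n` replicas, and averaging over
`b` turns them into products of overlaps. The derivative is therefore minus a series with
non-negative coefficients, and its sign is decided replica by replica (`hasDerivWithinAt_tripleLog`,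
`integral_logAvg_exchange_le`).

For `H_M` and `κ` against `η` with `a₁ = a₂ = αM`, the replica balance is `αM (q̃² + q² - 2 q q̃) =
αM (q - q̃)²` (`interp_balance`). This needs only that the even moments of the `κ` bonds are squares
of those of the `η` cavity fields, so the cavity lattice and the Random Multi-Overlap Structures are
treated together (`hamMean_add_kappaMean_le`). When `η` is absent the cavity decouples from the
system, and the `κ` of the denominator cancels that of the numerator in expectation, leaving the
free energy.

Both thermodynamic limits follow from Fekete's lemma. Exchanging the bonds inside two blocks against
the bonds of the joint system gives superadditivity of the pressure, by convexity of the square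
(`hamMean_superadditive`). For the trial function, the splitting of `M₁ + M₂` spins has zero
balance. The trial value at `ξ` then decomposes exactly into two trial values at tilted weights on
the same cavity (`exists_trialMean_add`), and `M` times the infimum is superadditive. -/

noncomputable section

set_option linter.unusedSectionVars false

namespace VianaBray

/-! ### Rearranging product measures -/

section Rearrange

variable {α β γ δ : Type*} [MeasurableSpace α] [MeasurableSpace β] [MeasurableSpace γ]
  [MeasurableSpace δ]

theorem integral_comp_of_measurePreserving {μ : Measure α} {ν : Measure β} {f : α → β}
    (hf : MeasurePreserving f μ ν) {g : β → ℝ} (hg : AEStronglyMeasurable g ν) :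
    ∫ x, g (f x) ∂μ = ∫ y, g y ∂ν := by
  rw [← hf.map_eq] at hg ⊢
  rw [integral_map hf.measurable.aemeasurable hg]

variable (a : Measure α) (b : Measure β) (c : Measure γ) (d : Measure δ)
  [SFinite a] [SFinite b] [SFinite c] [SFinite d]

theorem measurePreserving_prodAssoc_fun :
    MeasurePreserving (fun x : (α × β) × γ => (x.1.1, x.1.2, x.2))
      ((a.prod b).prod c) (a.prod (b.prod c)) :=
  measurePreserving_prodAssoc a b c

theorem measurePreserving_prodAssoc_symm_fun :
    MeasurePreserving (fun x : α × β × γ => ((x.1, x.2.1), x.2.2))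
      (a.prod (b.prod c)) ((a.prod b).prod c) :=
  (measurePreserving_prodAssoc a b c).symm

theorem measurePreserving_leftComm :
    MeasurePreserving (fun x : α × β × γ => (x.2.1, x.1, x.2.2))
      (a.prod (b.prod c)) (b.prod (a.prod c)) :=
  (measurePreserving_prodAssoc_fun b a c).comp
    (((Measure.measurePreserving_swap (μ := a) (ν := b)).prod (MeasurePreserving.id c)).comp
      (measurePreserving_prodAssoc_symm_fun a b c))

theorem measurePreserving_rightComm :
    MeasurePreserving (fun x : (α × β) × γ => ((x.1.1, x.2), x.1.2))
      ((a.prod b).prod c) ((a.prod c).prod b) :=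
  (measurePreserving_prodAssoc_symm_fun a c b).comp
    (((MeasurePreserving.id a).prod (Measure.measurePreserving_swap (μ := b) (ν := c))).comp
      (measurePreserving_prodAssoc_fun a b c))

theorem measurePreserving_prodProdComm :
    MeasurePreserving (fun x : (α × β) × γ × δ => ((x.1.1, x.2.1), x.1.2, x.2.2))
      ((a.prod b).prod (c.prod d)) ((a.prod c).prod (b.prod d)) :=
  (measurePreserving_prodAssoc_symm_fun a c (b.prod d)).comp
    (((MeasurePreserving.id a).prod (measurePreserving_leftComm b c d)).comp
      (measurePreserving_prodAssoc_fun a b (c.prod d)))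

end Rearrange

/-! ### Samples -/

section Sample

variable {B : Type} [MeasurableSpace B]

instance isProbabilityMeasure_sampleLaw (ζ : ℝ) (μ : Measure ℝ) (ν : Measure B)
    [IsProbabilityMeasure μ] [IsProbabilityMeasure ν] :
    IsProbabilityMeasure (sampleLaw ζ μ ν) := by
  unfold sampleLaw; infer_instance

/-- Overwriting one coordinate of an i.i.d. sequence by a fresh copy does not change its law, since
preimages of boxes are boxes. An extra bond can thus be written into slot `k` of a sample that uses
only the slots below `k`. -/
theorem measurePreserving_update {X : Type*} [MeasurableSpace X] (μ : Measure X)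
    [IsProbabilityMeasure μ] (k : ℕ) :
    MeasurePreserving (fun p : (ℕ → X) × X => Function.update p.1 k p.2)
      ((Measure.infinitePi fun _ : ℕ => μ).prod μ) (Measure.infinitePi fun _ : ℕ => μ) := by
  have hm : Measurable (fun p : (ℕ → X) × X => Function.update p.1 k p.2) := by
    refine measurable_pi_lambda _ fun i => ?_
    by_cases h : i = k
    · subst h; simpa using measurable_snd
    · simp only [Function.update_of_ne h]; fun_prop
  refine ⟨hm, Measure.eq_infinitePi _ fun s t ht => ?_⟩
  rw [Measure.map_apply hm (MeasurableSet.pi s.countable_toSet fun i _ => ht i)]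
  have hpre : (fun p : (ℕ → X) × X => Function.update p.1 k p.2) ⁻¹' (Set.pi s t) =
      (Set.pi (s.erase k : Finset ℕ) t) ×ˢ (if k ∈ s then t k else Set.univ) := by
    ext ⟨x, y⟩
    simp only [Set.mem_preimage, Set.mem_pi, Finset.mem_coe, Set.mem_prod, Finset.mem_erase]
    constructor
    · intro h
      refine ⟨fun i hi => by simpa [Function.update_of_ne hi.1] using h i hi.2, ?_⟩
      split_ifs with hk
      · simpa using h k hk
      · trivial
    · rintro ⟨h1, h2⟩ i hi
      by_cases hik : i = k
      · subst hik; simpa [hi] using h2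
      · simpa [Function.update_of_ne hik] using h1 i ⟨hik, hi⟩
  rw [hpre, Measure.prod_prod, Measure.infinitePi_pi _ fun i _ => ht i]
  split_ifs with hk
  · rw [mul_comm, Finset.mul_prod_erase s (fun i => μ (t i)) hk]
  · rw [Finset.erase_eq_of_notMem hk]; simp

/-- Append a bond to a sample. -/
def addBond (D : Sample B) (y : ℝ × B) : Sample B := (D.1 + 1, Function.update D.2 D.1 y)

theorem measurable_addBond : Measurable fun p : Sample B × (ℝ × B) => addBond p.1 p.2 := by
  have : Measurable fun q : ℕ × ((ℕ → ℝ × B) × (ℝ × B)) => addBond (q.1, q.2.1) q.2.2 := by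
    refine measurable_from_prod_countable_right fun n => ?_
    refine Measurable.prodMk (f := fun _ => n + 1) measurable_const
      (measurable_pi_lambda _ fun i => ?_)
    by_cases h : i = n
    · subst h; simpa using measurable_snd
    · simp only [Function.update_of_ne h]; fun_prop
  exact this.comp (f := fun p : Sample B × (ℝ × B) => (p.1.1, (p.1.2, p.2))) (by fun_prop)

/-- The sum of the absolute values of the couplings of a sample. -/
def absSum (D : Sample B) : ℝ := ∑ ν ∈ Finset.range D.1, |(D.2 ν).1|

theorem absSum_nonneg (D : Sample B) : 0 ≤ absSum D :=
  Finset.sum_nonneg fun _ _ => abs_nonneg _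

theorem measurable_sum_range_sample {f : ℝ × B → ℝ} (hf : Measurable f) :
    Measurable fun D : Sample B => ∑ ν ∈ Finset.range D.1, f (D.2 ν) := by
  refine measurable_from_prod_countable_right fun n => ?_
  exact Finset.measurable_sum (f := fun (i : ℕ) (x : ℕ → ℝ × B) => f (x i)) (Finset.range n)
    fun i _ => hf.comp (measurable_pi_apply i)

theorem measurable_absSum : Measurable (absSum (B := B)) :=
  measurable_sum_range_sample (f := fun y => |y.1|) (by fun_prop)

variable {S : Type}

theorem measurable_energy {b : B → S → ℝ} (hb : ∀ s, Measurable fun p => b p s) (s : S) :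
    Measurable fun D : Sample B => energy b D s :=
  (measurable_sum_range_sample (f := fun y => y.1 * b y.2 s)
    (measurable_fst.mul ((hb s).comp measurable_snd))).neg

theorem energy_addBond (b : B → S → ℝ) (D : Sample B) (y : ℝ × B) (s : S) :
    energy b (addBond D y) s = energy b D s - y.1 * b y.2 s := by
  simp only [energy, addBond, Finset.sum_range_succ, Function.update_self]
  rw [Finset.sum_congr rfl fun i hi => by
    rw [Function.update_of_ne (Finset.mem_range.1 hi).ne]]
  ring

theorem energy_of_fst_eq_zero (b : B → S → ℝ) {D : Sample B} (h : D.1 = 0) (s : S) :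
    energy b D s = 0 := by simp [energy, h]

theorem abs_energy_le {b : B → S → ℝ} (hb : ∀ p s, |b p s| ≤ 1) (D : Sample B) (s : S) :
    |energy b D s| ≤ absSum D := by
  rw [energy, abs_neg]
  refine (Finset.abs_sum_le_sum_abs _ _).trans (Finset.sum_le_sum fun i _ => ?_)
  rw [abs_mul]
  exact mul_le_of_le_one_right (abs_nonneg _) (hb _ _)

variable (μ : Measure ℝ) (ν : Measure B) [IsProbabilityMeasure μ] [IsProbabilityMeasure ν]

theorem ae_sampleLaw_zero : ∀ᵐ D ∂(sampleLaw 0 μ ν), D.1 = 0 := by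
  have h : ∀ᵐ n ∂(poissonMeasure (0 : ℝ).toNNReal), n = 0 := by
    rw [ae_iff, show {n : ℕ | ¬ n = 0} = ⋃ n : ℕ, {n + 1} by
      ext n; cases n <;> simp, measure_iUnion_null_iff]
    intro n
    rw [poissonMeasure_singleton]; simp
  exact Measure.quasiMeasurePreserving_fst.ae h

theorem integrable_eval_abs (hμ : Integrable (fun x : ℝ => x) μ) (i : ℕ) :
    Integrable (fun x : ℕ → ℝ × B => |(x i).1|) (Measure.infinitePi fun _ : ℕ => μ.prod ν) ∧
    ∫ x, |(x i).1| ∂(Measure.infinitePi fun _ : ℕ => μ.prod ν) = ∫ x, |x| ∂μ := by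
  have h1 : MeasurePreserving (fun x : ℕ → ℝ × B => (x i).1)
      (Measure.infinitePi fun _ : ℕ => μ.prod ν) μ :=
    (measurePreserving_fst (μ := μ) (ν := ν)).comp
      (measurePreserving_eval_infinitePi (fun _ : ℕ => μ.prod ν) i)
  exact ⟨(h1.integrable_comp hμ.abs.aestronglyMeasurable).2 hμ.abs,
    integral_comp_of_measurePreserving h1 hμ.abs.aestronglyMeasurable⟩

/-- The term `n = 0` vanishes, and for `n + 1` the factor cancels against the factorial, leaving `ζ`
times the Poisson weight of `n`. -/
theorem hasSum_poisson_mean (ζ : NNReal) :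
    HasSum (fun n : ℕ => Real.exp (-ζ) * ζ ^ n / n.factorial * n) ζ := by
  rw [← hasSum_nat_add_iff' 1]
  have := (hasSum_one_poissonMeasure ζ).mul_left (ζ : ℝ)
  simp only [mul_one] at this
  simp only [Finset.range_one, Finset.sum_singleton, Nat.cast_zero, mul_zero, sub_zero]
  refine this.congr_fun fun n => ?_
  rw [Nat.factorial_succ]
  push_cast
  field_simp
  ring

/-- Wald's identity: given `k` terms the mean is `k 𝔼|J|`, and the Poisson mean of `k` is `ζ`. This
is the only source of integrability of the energies. -/
theorem integrable_absSum (hμ : Integrable (fun x : ℝ => x) μ) {ζ : ℝ} (hζ : 0 ≤ ζ) :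
    Integrable (absSum (B := B)) (sampleLaw ζ μ ν) ∧
    ∫ D, absSum D ∂(sampleLaw ζ μ ν) = ζ * ∫ x, |x| ∂μ := by
  have hk : ∀ k : ℕ, ∫ x, absSum ((k, x) : Sample B) ∂(Measure.infinitePi fun _ : ℕ => μ.prod ν) =
      k * ∫ x, |x| ∂μ := fun k => by
    simp only [absSum]
    rw [integral_finsetSum _ fun i _ => (integrable_eval_abs μ ν hμ i).1]
    simp [(integrable_eval_abs μ ν hμ _).2]
  have hs := (hasSum_poisson_mean ζ.toNNReal).mul_right (∫ x, |x| ∂μ)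
  have hi : Integrable (absSum (B := B)) (sampleLaw ζ μ ν) := by
    refine (integrable_prod_iff measurable_absSum.aestronglyMeasurable).2
      ⟨ae_of_all _ fun k => integrable_finsetSum (Finset.range k) fun i _ => (integrable_eval_abs μ ν hμ i).1, ?_⟩
    simp_rw [Real.norm_of_nonneg (absSum_nonneg _), hk]
    rw [integrable_poissonMeasure_iff]
    refine hs.summable.congr fun n => ?_
    rw [Real.norm_of_nonneg (by positivity)]
    ring
  refine ⟨hi, ?_⟩
  rw [sampleLaw, integral_prod _ hi]
  simp_rw [hk]
  rw [integral_poissonMeasure]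
  simp only [smul_eq_mul]
  rw [← Real.coe_toNNReal ζ hζ, ← hs.tsum_eq]
  simp only [Real.toNNReal_coe]
  exact tsum_congr fun n => by ring

end Sample

/-! ### Differentiating Poisson averages -/

/-- The monomial `x ^ k / k!`. -/
def divPow (k : ℕ) (x : ℝ) : ℝ := x ^ k / k.factorial

/-- The derivative of `x ^ k / k!`. -/
def divPowDeriv : ℕ → ℝ → ℝ
  | 0, _ => 0
  | k + 1, x => divPow k x

theorem hasDerivAt_divPow (k : ℕ) (x : ℝ) : HasDerivAt (divPow k) (divPowDeriv k x) x := by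
  cases k with
  | zero =>
    have : divPow 0 = fun _ => (1 : ℝ) := by ext; simp [divPow]
    rw [this]; exact hasDerivAt_const _ _
  | succ k =>
    have h := (hasDerivAt_pow (k + 1) x).div_const ((k + 1).factorial : ℝ)
    have e : divPowDeriv (k + 1) x = ((k + 1 : ℕ) : ℝ) * x ^ (k + 1 - 1) / (k + 1).factorial := by
      rw [Nat.factorial_succ, divPowDeriv, divPow, Nat.add_sub_cancel]
      push_cast
      field_simp
    rw [e]; exact h

theorem abs_divPow_le {x y : ℝ} (h : |x| ≤ y) (k : ℕ) : |divPow k x| ≤ divPow k y := by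
  rw [divPow, divPow, abs_div, abs_pow, Nat.abs_cast]
  gcongr

theorem abs_divPowDeriv_le {x y : ℝ} (h : |x| ≤ y) (k : ℕ) :
    |divPowDeriv k x| ≤ divPowDeriv k y := by
  cases k with
  | zero => simp [divPowDeriv]
  | succ k => exact abs_divPow_le h k

theorem divPow_nonneg {x : ℝ} (h : 0 ≤ x) (k : ℕ) : 0 ≤ divPow k x := by
  unfold divPow; positivity

theorem divPowDeriv_nonneg {x : ℝ} (h : 0 ≤ x) (k : ℕ) : 0 ≤ divPowDeriv k x := by
  cases k with
  | zero => simp [divPowDeriv]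
  | succ k => exact divPow_nonneg h k

theorem summable_divPow (x : ℝ) : Summable fun k => divPow k x :=
  Real.summable_pow_div_factorial x

theorem summable_divPowDeriv (x : ℝ) : Summable fun k => divPowDeriv k x :=
  (summable_nat_add_iff 1).1 (summable_divPow x)

theorem divPow_mul_two_pow (k : ℕ) (x : ℝ) : divPow k x * 2 ^ k = divPow k (x * 2) := by
  rw [divPow, divPow, mul_pow]; ring

theorem divPowDeriv_mul_two_pow (k : ℕ) (x : ℝ) :
    divPowDeriv k x * 2 ^ k = 2 * divPowDeriv k (x * 2) := by
  cases k with
  | zero => simp [divPowDeriv]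
  | succ k => rw [divPowDeriv, divPowDeriv, ← divPow_mul_two_pow]; ring

theorem summable_mul_mul {f₁ f₂ f₃ : ℕ → ℝ} (h₁ : Summable f₁) (h₂ : Summable f₂)
    (h₃ : Summable f₃) (p₁ : 0 ≤ f₁) (p₂ : 0 ≤ f₂) (p₃ : 0 ≤ f₃) :
    Summable fun k : ℕ × ℕ × ℕ => f₁ k.1 * (f₂ k.2.1 * f₃ k.2.2) :=
  h₁.mul_of_nonneg (h₂.mul_of_nonneg h₃ p₂ p₃) p₁ fun k => mul_nonneg (p₂ k.1) (p₃ k.2)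

/-- A function on `ℕ³` of at most exponential growth. -/
def ExpBounded (g : ℕ × ℕ × ℕ → ℝ) : Prop :=
  ∃ C, 0 ≤ C ∧ ∀ k, |g k| ≤ C * (2 ^ k.1 * (2 ^ k.2.1 * 2 ^ k.2.2))

/-- The growth `2 ^ k` is absorbed by the weights, because `x ^ k / k! * 2 ^ k = (2x) ^ k / k!` is
again summable. -/
theorem ExpBounded.bound_mul {g : ℕ × ℕ × ℕ → ℝ} {C : ℝ}
    (hg : ∀ k, |g k| ≤ C * (2 ^ k.1 * (2 ^ k.2.1 * 2 ^ k.2.2)))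
    {f₁ f₂ f₃ F₁ F₂ F₃ : ℕ → ℝ} (h₁ : ∀ k, |f₁ k| * 2 ^ k ≤ F₁ k) (h₂ : ∀ k, |f₂ k| * 2 ^ k ≤ F₂ k)
    (h₃ : ∀ k, |f₃ k| * 2 ^ k ≤ F₃ k) (hC : 0 ≤ C) (k : ℕ × ℕ × ℕ) :
    |f₁ k.1 * (f₂ k.2.1 * f₃ k.2.2) * g k| ≤ C * (F₁ k.1 * (F₂ k.2.1 * F₃ k.2.2)) := by
  have n₁ : 0 ≤ |f₁ k.1| * 2 ^ k.1 := by positivity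
  have n₂ : 0 ≤ |f₂ k.2.1| * 2 ^ k.2.1 := by positivity
  have n₃ : 0 ≤ |f₃ k.2.2| * 2 ^ k.2.2 := by positivity
  rw [abs_mul, abs_mul, abs_mul]
  calc |f₁ k.1| * (|f₂ k.2.1| * |f₃ k.2.2|) * |g k|
      ≤ |f₁ k.1| * (|f₂ k.2.1| * |f₃ k.2.2|) * (C * (2 ^ k.1 * (2 ^ k.2.1 * 2 ^ k.2.2))) := by
        gcongr; exact hg k
    _ = C * ((|f₁ k.1| * 2 ^ k.1) * ((|f₂ k.2.1| * 2 ^ k.2.1) * (|f₃ k.2.2| * 2 ^ k.2.2))) := by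
        ring
    _ ≤ _ := by
        have := h₁ k.1
        have := h₂ k.2.1
        have := h₃ k.2.2
        have : 0 ≤ F₁ k.1 := by linarith
        have : 0 ≤ F₂ k.2.1 := by linarith
        gcongr

theorem abs_divPow_mul_le {x y : ℝ} (h : |x| ≤ y) (k : ℕ) :
    |divPow k x| * 2 ^ k ≤ divPow k (y * 2) := by
  rw [← divPow_mul_two_pow]
  have := abs_divPow_le h k
  gcongr

theorem abs_divPowDeriv_mul_le {x y : ℝ} (h : |x| ≤ y) (k : ℕ) :
    |divPowDeriv k x| * 2 ^ k ≤ 2 * divPowDeriv k (y * 2) := by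
  rw [← divPowDeriv_mul_two_pow]
  have := abs_divPowDeriv_le h k
  gcongr

theorem summable_divPow_mul {g : ℕ × ℕ × ℕ → ℝ} (hg : ExpBounded g) (x y z : ℝ) :
    Summable fun k => divPow k.1 x * (divPow k.2.1 y * divPow k.2.2 z) * g k := by
  obtain ⟨C, hC, hg⟩ := hg
  refine Summable.of_norm_bounded ((summable_mul_mul (summable_divPow (|x| * 2))
    (summable_divPow (|y| * 2)) (summable_divPow (|z| * 2)) ?_ ?_ ?_).mul_left C)
    (ExpBounded.bound_mul hg (abs_divPow_mul_le le_rfl) (abs_divPow_mul_le le_rfl)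
      (abs_divPow_mul_le le_rfl) hC) <;>
  exact fun k => divPow_nonneg (by positivity) k

theorem ExpBounded.comp_shift {g : ℕ × ℕ × ℕ → ℝ} (hg : ExpBounded g) :
    ExpBounded (fun k => g (k.1 + 1, k.2)) ∧ ExpBounded (fun k => g (k.1, k.2.1 + 1, k.2.2)) ∧
      ExpBounded (fun k => g (k.1, k.2.1, k.2.2 + 1)) := by
  obtain ⟨C, hC, hg⟩ := hg
  refine ⟨⟨C * 2, by positivity, fun k => (hg _).trans (le_of_eq ?_)⟩,
    ⟨C * 2, by positivity, fun k => (hg _).trans (le_of_eq ?_)⟩,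
    ⟨C * 2, by positivity, fun k => (hg _).trans (le_of_eq ?_)⟩⟩ <;> simp only [pow_succ] <;> ring

/-- The derivative of `x ^ k / k!` is zero at `k = 0` and the preceding monomial otherwise.
Reindexing by the successor moves the derivative onto `g` as a shift by one bond. -/
theorem tsum_divPowDeriv_mul (g : ℕ × ℕ × ℕ → ℝ) (x y z : ℝ) :
    (∑' k : ℕ × ℕ × ℕ, divPowDeriv k.1 x * (divPow k.2.1 y * divPow k.2.2 z) * g k =
      ∑' k : ℕ × ℕ × ℕ, divPow k.1 x * (divPow k.2.1 y * divPow k.2.2 z) * g (k.1 + 1, k.2)) ∧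
    (∑' k : ℕ × ℕ × ℕ, divPow k.1 x * (divPowDeriv k.2.1 y * divPow k.2.2 z) * g k =
      ∑' k : ℕ × ℕ × ℕ, divPow k.1 x * (divPow k.2.1 y * divPow k.2.2 z) *
        g (k.1, k.2.1 + 1, k.2.2)) ∧
    (∑' k : ℕ × ℕ × ℕ, divPow k.1 x * (divPow k.2.1 y * divPowDeriv k.2.2 z) * g k =
      ∑' k : ℕ × ℕ × ℕ, divPow k.1 x * (divPow k.2.1 y * divPow k.2.2 z) *
        g (k.1, k.2.1, k.2.2 + 1)) := by
  refine ⟨?_, ?_, ?_⟩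
  · rw [← Function.Injective.tsum_eq (g := fun k : ℕ × ℕ × ℕ => (k.1 + 1, k.2))]
    · rfl
    · rintro ⟨a, b⟩ ⟨c, d⟩ h; simpa using h
    · rintro ⟨a, b, c⟩ h
      cases a with
      | zero => simp [divPowDeriv] at h
      | succ a => exact ⟨(a, b, c), rfl⟩
  · rw [← Function.Injective.tsum_eq (g := fun k : ℕ × ℕ × ℕ => (k.1, k.2.1 + 1, k.2.2))]
    · rfl
    · rintro ⟨a, b, c⟩ ⟨d, e, f⟩ h; simpa using h
    · rintro ⟨a, b, c⟩ h
      cases b with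
      | zero => simp [divPowDeriv] at h
      | succ b => exact ⟨(a, b, c), rfl⟩
  · rw [← Function.Injective.tsum_eq (g := fun k : ℕ × ℕ × ℕ => (k.1, k.2.1, k.2.2 + 1))]
    · rfl
    · rintro ⟨a, b, c⟩ ⟨d, e, f⟩ h; simpa using h
    · rintro ⟨a, b, c⟩ h
      cases c with
      | zero => simp [divPowDeriv] at h
      | succ c => exact ⟨(a, b, c), rfl⟩

/-- Termwise differentiation on the open interval `(-1, 2)`, a neighbourhood of `[0, 1]`, so the
series has a two-sided derivative even at the end points. -/
theorem hasDerivAt_tsum_divPow {g : ℕ × ℕ × ℕ → ℝ} (hg : ExpBounded g) {a₁ a₂ a₃ : ℝ}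
    (h₁ : 0 ≤ a₁) (h₂ : 0 ≤ a₂) (h₃ : 0 ≤ a₃) {t : ℝ} (ht : t ∈ Set.Icc (0 : ℝ) 1) :
    HasDerivAt
      (fun t => ∑' k : ℕ × ℕ × ℕ, divPow k.1 (t * a₁) * (divPow k.2.1 (t * a₂) * divPow k.2.2 ((1 - t) * a₃)) *
        g k)
      (∑' k : ℕ × ℕ × ℕ, divPow k.1 (t * a₁) * (divPow k.2.1 (t * a₂) * divPow k.2.2 ((1 - t) * a₃)) *
        (a₁ * g (k.1 + 1, k.2) + a₂ * g (k.1, k.2.1 + 1, k.2.2) -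
          a₃ * g (k.1, k.2.1, k.2.2 + 1))) t := by
  obtain ⟨C, hC, hgC⟩ := id hg
  -- On this interval both `|y|` and `|1 - y|` are at most 2. In the majorants `divPow k (2 * a *
  -- 2)` the first 2 is this bound and the second is the base of the exponential growth of `g`.
  have hb : ∀ {a y : ℝ}, 0 ≤ a → y ∈ Set.Ioo (-1 : ℝ) 2 → |y * a| ≤ 2 * a := by
    intro a y ha hy
    rw [abs_mul, abs_of_nonneg ha]
    exact mul_le_mul_of_nonneg_right (abs_le.2 ⟨by linarith [hy.1], hy.2.le⟩) ha
  have hb' : ∀ {a y : ℝ}, 0 ≤ a → y ∈ Set.Ioo (-1 : ℝ) 2 → |(1 - y) * a| ≤ 2 * a := by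
    intro a y ha hy
    rw [abs_mul, abs_of_nonneg ha]
    exact mul_le_mul_of_nonneg_right
      (abs_le.2 ⟨by linarith [hy.2], by linarith [hy.1]⟩) ha
  have np : ∀ {a : ℝ}, 0 ≤ a → (0 : ℕ → ℝ) ≤ fun k => divPow k (2 * a * 2) :=
    fun ha k => divPow_nonneg (by positivity) k
  have np' : ∀ {a : ℝ}, 0 ≤ a → (0 : ℕ → ℝ) ≤ fun k => 2 * divPowDeriv k (2 * a * 2) :=
    fun ha k => mul_nonneg zero_le_two (divPowDeriv_nonneg (by positivity) k)
  have sp : ∀ a : ℝ, Summable fun k => divPow k (2 * a * 2) := fun a => summable_divPow _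
  have sp' : ∀ a : ℝ, Summable fun k => 2 * divPowDeriv k (2 * a * 2) :=
    fun a => (summable_divPowDeriv _).mul_left 2
  have s₁ := ((summable_mul_mul (sp' a₁) (sp a₂) (sp a₃) (np' h₁) (np h₂) (np h₃)).mul_left C)
  have s₂ := ((summable_mul_mul (sp a₁) (sp' a₂) (sp a₃) (np h₁) (np' h₂) (np h₃)).mul_left C)
  have s₃ := ((summable_mul_mul (sp a₁) (sp a₂) (sp' a₃) (np h₁) (np h₂) (np' h₃)).mul_left C)
  have b₁ := fun (y : ℝ) (hy : y ∈ Set.Ioo (-1 : ℝ) 2) => ExpBounded.bound_mul hgC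
    (abs_divPowDeriv_mul_le (hb h₁ hy)) (abs_divPow_mul_le (hb h₂ hy))
    (abs_divPow_mul_le (hb' h₃ hy)) hC
  have b₂ := fun (y : ℝ) (hy : y ∈ Set.Ioo (-1 : ℝ) 2) => ExpBounded.bound_mul hgC
    (abs_divPow_mul_le (hb h₁ hy)) (abs_divPowDeriv_mul_le (hb h₂ hy))
    (abs_divPow_mul_le (hb' h₃ hy)) hC
  have b₃ := fun (y : ℝ) (hy : y ∈ Set.Ioo (-1 : ℝ) 2) => ExpBounded.bound_mul hgC
    (abs_divPow_mul_le (hb h₁ hy)) (abs_divPow_mul_le (hb h₂ hy))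
    (abs_divPowDeriv_mul_le (hb' h₃ hy)) hC
  have ht' : t ∈ Set.Ioo (-1 : ℝ) 2 := ⟨by linarith [ht.1], by linarith [ht.2]⟩
  have key := hasDerivAt_tsum_of_isPreconnected
    (g := fun (k : ℕ × ℕ × ℕ) t =>
      divPow k.1 (t * a₁) * (divPow k.2.1 (t * a₂) * divPow k.2.2 ((1 - t) * a₃)) * g k)
    (g' := fun (k : ℕ × ℕ × ℕ) t =>
      a₁ * (divPowDeriv k.1 (t * a₁) * (divPow k.2.1 (t * a₂) * divPow k.2.2 ((1 - t) * a₃)) * g k)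
      + a₂ * (divPow k.1 (t * a₁) * (divPowDeriv k.2.1 (t * a₂) * divPow k.2.2 ((1 - t) * a₃)) *
        g k)
      - a₃ * (divPow k.1 (t * a₁) * (divPow k.2.1 (t * a₂) * divPowDeriv k.2.2 ((1 - t) * a₃)) *
        g k))
    (((s₁.mul_left a₁).add (s₂.mul_left a₂)).add (s₃.mul_left a₃)) isOpen_Ioo
    isPreconnected_Ioo ?_ ?_ ht' (summable_divPow_mul hg _ _ _) ht'
  · refine key.congr_deriv ?_
    have f₁ := (Summable.of_norm_bounded s₁ (b₁ t ht')).mul_left a₁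
    have f₂ := (Summable.of_norm_bounded s₂ (b₂ t ht')).mul_left a₂
    have f₃ := (Summable.of_norm_bounded s₃ (b₃ t ht')).mul_left a₃
    have e₁ := summable_divPow_mul hg.comp_shift.1 (t * a₁) (t * a₂) ((1 - t) * a₃)
    have e₂ := summable_divPow_mul hg.comp_shift.2.1 (t * a₁) (t * a₂) ((1 - t) * a₃)
    have e₃ := summable_divPow_mul hg.comp_shift.2.2 (t * a₁) (t * a₂) ((1 - t) * a₃)
    obtain ⟨q₁, q₂, q₃⟩ := tsum_divPowDeriv_mul g (t * a₁) (t * a₂) ((1 - t) * a₃)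
    rw [(f₁.add f₂).tsum_sub f₃, f₁.tsum_add f₂, tsum_mul_left, tsum_mul_left, tsum_mul_left,
      q₁, q₂, q₃, ← tsum_mul_left, ← tsum_mul_left, ← tsum_mul_left,
      ← (e₁.mul_left a₁).tsum_add (e₂.mul_left a₂),
      ← ((e₁.mul_left a₁).add (e₂.mul_left a₂)).tsum_sub (e₃.mul_left a₃)]
    refine tsum_congr fun k => ?_
    ring
  · intro k y _
    have d₁ : HasDerivAt (fun t => divPow k.1 (t * a₁)) (divPowDeriv k.1 (y * a₁) * a₁) y := 
      HasDerivAt.comp (h₂ := divPow k.1) (h := fun t => t * a₁) y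
        (hasDerivAt_divPow k.1 (y * a₁)) (hasDerivAt_mul_const a₁)
    have d₂ : HasDerivAt (fun t => divPow k.2.1 (t * a₂)) (divPowDeriv k.2.1 (y * a₂) * a₂) y := 
      HasDerivAt.comp (h₂ := divPow k.2.1) (h := fun t => t * a₂) y
        (hasDerivAt_divPow k.2.1 (y * a₂)) (hasDerivAt_mul_const a₂)
    have d₃ : HasDerivAt (fun t => divPow k.2.2 ((1 - t) * a₃))
        (divPowDeriv k.2.2 ((1 - y) * a₃) * -a₃) y := 
      HasDerivAt.comp (h₂ := divPow k.2.2) (h := fun t => (1 - t) * a₃) y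
        (hasDerivAt_divPow k.2.2 ((1 - y) * a₃))
        ((((hasDerivAt_id y).const_sub 1).mul_const a₃).congr_deriv (neg_one_mul a₃))
    exact ((d₁.mul (d₂.mul d₃)).mul_const (g k)).congr_deriv (by simp; ring)
  · intro k y hy
    refine (norm_sub_le _ _).trans (add_le_add ((norm_add_le _ _).trans (add_le_add ?_ ?_)) ?_)
    · rw [norm_mul, Real.norm_of_nonneg h₁]; exact mul_le_mul_of_nonneg_left (b₁ y hy k) h₁
    · rw [norm_mul, Real.norm_of_nonneg h₂]; exact mul_le_mul_of_nonneg_left (b₂ y hy k) h₂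
    · rw [norm_mul, Real.norm_of_nonneg h₃]; exact mul_le_mul_of_nonneg_left (b₃ y hy k) h₃

/-! ### Expectations over three independent samples -/

section Triple

variable {Ω B₁ B₂ B₃ : Type} [MeasurableSpace Ω] [MeasurableSpace B₁] [MeasurableSpace B₂]
  [MeasurableSpace B₃]

/-- The law of an independent family of a variable of law `ρ` and three samples. -/
def tripleLaw (ρ : Measure Ω) (μ : Measure ℝ) (ν₁ : Measure B₁) (ν₂ : Measure B₂)
    (ν₃ : Measure B₃) (ζ₁ ζ₂ ζ₃ : ℝ) : Measure (Ω × Sample B₁ × Sample B₂ × Sample B₃) :=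
  ρ.prod ((sampleLaw ζ₁ μ ν₁).prod ((sampleLaw ζ₂ μ ν₂).prod (sampleLaw ζ₃ μ ν₃)))

/-- The law of the couplings and marks of three samples, without the numbers of terms. -/
def seqLaw (ρ : Measure Ω) (μ : Measure ℝ) (ν₁ : Measure B₁) (ν₂ : Measure B₂)
    (ν₃ : Measure B₃) : Measure (Ω × (ℕ → ℝ × B₁) × (ℕ → ℝ × B₂) × (ℕ → ℝ × B₃)) :=
  ρ.prod ((Measure.infinitePi fun _ : ℕ => μ.prod ν₁).prod
    ((Measure.infinitePi fun _ : ℕ => μ.prod ν₂).prod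
      (Measure.infinitePi fun _ : ℕ => μ.prod ν₃)))

/-- Prescribe the numbers of terms of the three samples. -/
def withCounts (k : ℕ × ℕ × ℕ) (z : Ω × (ℕ → ℝ × B₁) × (ℕ → ℝ × B₂) × (ℕ → ℝ × B₃)) :
    Ω × Sample B₁ × Sample B₂ × Sample B₃ :=
  (z.1, (k.1, z.2.1), (k.2.1, z.2.2.1), (k.2.2, z.2.2.2))

/-- A measurable function of three samples whose growth is at most linear in the couplings. -/
def LinearGrowth (ρ : Measure Ω) (X : Ω × Sample B₁ × Sample B₂ × Sample B₃ → ℝ) : Prop :=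
  Measurable X ∧ ∃ (H : Ω → ℝ) (C : ℝ), Integrable H ρ ∧ 0 ≤ C ∧ ∀ᵐ ω ∂ρ, 0 ≤ H ω ∧
    ∀ D₁ D₂ D₃, |X (ω, D₁, D₂, D₃)| ≤ H ω + C * (absSum D₁ + (absSum D₂ + absSum D₃))

variable (ρ : Measure Ω) (μ : Measure ℝ) (ν₁ : Measure B₁) (ν₂ : Measure B₂) (ν₃ : Measure B₃)
  [IsProbabilityMeasure ρ] [IsProbabilityMeasure μ] [IsProbabilityMeasure ν₁]
  [IsProbabilityMeasure ν₂] [IsProbabilityMeasure ν₃]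

instance : IsProbabilityMeasure (seqLaw ρ μ ν₁ ν₂ ν₃) := by unfold seqLaw; infer_instance

instance (ζ₁ ζ₂ ζ₃ : ℝ) : IsProbabilityMeasure (tripleLaw ρ μ ν₁ ν₂ ν₃ ζ₁ ζ₂ ζ₃) := by
  unfold tripleLaw; infer_instance

/-- The expectation of `X` given the numbers of terms. -/
def countMean (X : Ω × Sample B₁ × Sample B₂ × Sample B₃ → ℝ) (k : ℕ × ℕ × ℕ) : ℝ :=
  ∫ z, X (withCounts k z) ∂(seqLaw ρ μ ν₁ ν₂ ν₃)

theorem measurable_withCounts (k : ℕ × ℕ × ℕ) :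
    Measurable (withCounts k : Ω × (ℕ → ℝ × B₁) × (ℕ → ℝ × B₂) × (ℕ → ℝ × B₃) → _) := by
  unfold withCounts; fun_prop

/-- Separating the numbers of terms from the couplings and marks confines the dependence on the
intensities to three Poisson laws. -/
theorem measurePreserving_counts (ζ₁ ζ₂ ζ₃ : ℝ) :
    MeasurePreserving
      (fun z : Ω × Sample B₁ × Sample B₂ × Sample B₃ =>
        ((z.2.1.1, z.2.2.1.1, z.2.2.2.1), (z.1, z.2.1.2, z.2.2.1.2, z.2.2.2.2)))
      (tripleLaw ρ μ ν₁ ν₂ ν₃ ζ₁ ζ₂ ζ₃)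
      (((poissonMeasure ζ₁.toNNReal).prod ((poissonMeasure ζ₂.toNNReal).prod
        (poissonMeasure ζ₃.toNNReal))).prod (seqLaw ρ μ ν₁ ν₂ ν₃)) :=
  (measurePreserving_leftComm ρ _ _).comp ((MeasurePreserving.id ρ).prod
    ((measurePreserving_prodProdComm _ _ _ _).comp
      ((MeasurePreserving.id (sampleLaw ζ₁ μ ν₁)).prod
        (measurePreserving_prodProdComm _ _ _ _))))

variable {ρ μ ν₁ ν₂ ν₃} in
theorem LinearGrowth.integrable {X : Ω × Sample B₁ × Sample B₂ × Sample B₃ → ℝ}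
    (hX : LinearGrowth ρ X) (hμ : Integrable (fun x : ℝ => x) μ) {ζ₁ ζ₂ ζ₃ : ℝ} (h₁ : 0 ≤ ζ₁)
    (h₂ : 0 ≤ ζ₂) (h₃ : 0 ≤ ζ₃) : Integrable X (tripleLaw ρ μ ν₁ ν₂ ν₃ ζ₁ ζ₂ ζ₃) := by
  obtain ⟨hm, H, C, hH, hC, hb⟩ := hX
  have i₁ := (integrable_absSum μ ν₁ hμ h₁).1
  have i₂ := (integrable_absSum μ ν₂ hμ h₂).1
  have i₃ := (integrable_absSum μ ν₃ hμ h₃).1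
  have hi : Integrable (fun z : Ω × Sample B₁ × Sample B₂ × Sample B₃ =>
      H z.1 + C * (absSum z.2.1 + (absSum z.2.2.1 + absSum z.2.2.2)))
      (tripleLaw ρ μ ν₁ ν₂ ν₃ ζ₁ ζ₂ ζ₃) :=
    (hH.comp_fst _).add (((i₁.comp_fst _).add
      (((i₂.comp_fst _).add (i₃.comp_snd _)).comp_snd _)).comp_snd _ |>.const_mul C)
  refine hi.mono' hm.aestronglyMeasurable ?_
  filter_upwards [Measure.quasiMeasurePreserving_fst.ae hb] with z hz
  exact hz.2 _ _ _

variable {ρ μ ν₁ ν₂ ν₃} in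
-- Given the numbers of terms, the mean grows at most linearly in them, which is far below the
-- exponential growth allowed.
theorem LinearGrowth.expBounded {X : Ω × Sample B₁ × Sample B₂ × Sample B₃ → ℝ}
    (hX : LinearGrowth ρ X) (hμ : Integrable (fun x : ℝ => x) μ) :
    ExpBounded (countMean ρ μ ν₁ ν₂ ν₃ X) := by
  obtain ⟨hm, H, C, hH, hC, hb⟩ := hX
  have i₁ := fun i => integrable_eval_abs μ ν₁ hμ i
  have i₂ := fun i => integrable_eval_abs μ ν₂ hμ i
  have i₃ := fun i => integrable_eval_abs μ ν₃ hμ i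
  set K := ∫ x, |x| ∂μ with hK
  have hK0 : 0 ≤ K := integral_nonneg fun _ => abs_nonneg _
  have hH0 : 0 ≤ ∫ ω, H ω ∂ρ := integral_nonneg_of_ae (hb.mono fun _ h => h.1)
  -- The factor 3 counts the samples: each number of terms is at most the full product of powers of
  -- 2, called `P` below.
  refine ⟨∫ ω, H ω ∂ρ + 3 * (C * K), by positivity, fun k => ?_⟩
  have j₁ : Integrable (fun x : ℕ → ℝ × B₁ => ∑ i ∈ Finset.range k.1, |(x i).1|)
      (Measure.infinitePi fun _ : ℕ => μ.prod ν₁) := integrable_finsetSum _ fun i _ => (i₁ i).1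
  have j₂ : Integrable (fun x : ℕ → ℝ × B₂ => ∑ i ∈ Finset.range k.2.1, |(x i).1|)
      (Measure.infinitePi fun _ : ℕ => μ.prod ν₂) := integrable_finsetSum _ fun i _ => (i₂ i).1
  have j₃ : Integrable (fun x : ℕ → ℝ × B₃ => ∑ i ∈ Finset.range k.2.2, |(x i).1|)
      (Measure.infinitePi fun _ : ℕ => μ.prod ν₃) := integrable_finsetSum _ fun i _ => (i₃ i).1
  have e₁ : ∫ x : ℕ → ℝ × B₁, ∑ i ∈ Finset.range k.1, |(x i).1|
      ∂(Measure.infinitePi fun _ : ℕ => μ.prod ν₁) = k.1 * K := by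
    rw [integral_finsetSum _ fun i _ => (i₁ i).1]; simp [(i₁ _).2]
  have e₂ : ∫ x : ℕ → ℝ × B₂, ∑ i ∈ Finset.range k.2.1, |(x i).1|
      ∂(Measure.infinitePi fun _ : ℕ => μ.prod ν₂) = k.2.1 * K := by
    rw [integral_finsetSum _ fun i _ => (i₂ i).1]; simp [(i₂ _).2]
  have e₃ : ∫ x : ℕ → ℝ × B₃, ∑ i ∈ Finset.range k.2.2, |(x i).1|
      ∂(Measure.infinitePi fun _ : ℕ => μ.prod ν₃) = k.2.2 * K := by
    rw [integral_finsetSum _ fun i _ => (i₃ i).1]; simp [(i₃ _).2]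
  have j₂₃ := ((j₂.comp_fst (Measure.infinitePi fun _ : ℕ => μ.prod ν₃)).add
    (j₃.comp_snd (Measure.infinitePi fun _ : ℕ => μ.prod ν₂)))
  have j := (j₁.comp_fst ((Measure.infinitePi fun _ : ℕ => μ.prod ν₂).prod
    (Measure.infinitePi fun _ : ℕ => μ.prod ν₃))).add
      (j₂₃.comp_snd (Measure.infinitePi fun _ : ℕ => μ.prod ν₁))
  have jH := (hH.comp_fst ((Measure.infinitePi fun _ : ℕ => μ.prod ν₁).prod
    ((Measure.infinitePi fun _ : ℕ => μ.prod ν₂).prod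
      (Measure.infinitePi fun _ : ℕ => μ.prod ν₃))))
  have jC := ((j.const_mul C).comp_snd ρ)
  have hle : |countMean ρ μ ν₁ ν₂ ν₃ X k| ≤ ∫ ω, H ω ∂ρ + C * (k.1 * K + (k.2.1 * K + k.2.2 * K)) := by
    rw [← Real.norm_eq_abs]
    refine (norm_integral_le_of_norm_le (jH.add jC) ?_).trans (le_of_eq ?_)
    · filter_upwards [Measure.quasiMeasurePreserving_fst.ae hb] with z hz
      exact hz.2 _ _ _
    · rw [integral_add' jH jC, integral_fun_fst,
        integral_fun_snd (fun y => C * _), integral_const_mul, integral_add'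
          (j₁.comp_fst _) (j₂₃.comp_snd _), integral_fun_fst (fun x : ℕ → ℝ × B₁ =>
            ∑ i ∈ Finset.range k.1, |(x i).1|), integral_fun_snd, integral_add' (j₂.comp_fst _)
          (j₃.comp_snd _), integral_fun_fst (fun x : ℕ → ℝ × B₂ =>
            ∑ i ∈ Finset.range k.2.1, |(x i).1|), integral_fun_snd (fun x : ℕ → ℝ × B₃ =>
            ∑ i ∈ Finset.range k.2.2, |(x i).1|), e₁, e₂, e₃]
      simp
  refine hle.trans ?_
  have p₁ : (k.1 : ℝ) ≤ 2 ^ k.1 := by exact_mod_cast Nat.lt_two_pow_self.le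
  have p₂ : (k.2.1 : ℝ) ≤ 2 ^ k.2.1 := by exact_mod_cast Nat.lt_two_pow_self.le
  have p₃ : (k.2.2 : ℝ) ≤ 2 ^ k.2.2 := by exact_mod_cast Nat.lt_two_pow_self.le
  have o₁ : (1 : ℝ) ≤ 2 ^ k.1 := one_le_pow₀ one_le_two
  have o₂ : (1 : ℝ) ≤ 2 ^ k.2.1 := one_le_pow₀ one_le_two
  have o₃ : (1 : ℝ) ≤ 2 ^ k.2.2 := one_le_pow₀ one_le_two
  set P : ℝ := 2 ^ k.1 * (2 ^ k.2.1 * 2 ^ k.2.2) with hP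
  have o₂₃ : (1 : ℝ) ≤ 2 ^ k.2.1 * 2 ^ k.2.2 := one_le_mul_of_one_le_of_one_le o₂ o₃
  have q₁ : (k.1 : ℝ) ≤ P := p₁.trans (le_mul_of_one_le_right (by positivity) o₂₃)
  have q₂ : (k.2.1 : ℝ) ≤ P := (p₂.trans (le_mul_of_one_le_right (by positivity) o₃)).trans
    (le_mul_of_one_le_left (by positivity) o₁)
  have q₃ : (k.2.2 : ℝ) ≤ P := (p₃.trans (le_mul_of_one_le_left (by positivity) o₂)).trans
    (le_mul_of_one_le_left (by positivity) o₁)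
  have oP : 1 ≤ P := one_le_mul_of_one_le_of_one_le o₁ o₂₃
  have hCK : 0 ≤ C * K := by positivity
  nlinarith [mul_le_mul_of_nonneg_left q₁ hCK, mul_le_mul_of_nonneg_left q₂ hCK,
    mul_le_mul_of_nonneg_left q₃ hCK, mul_le_mul_of_nonneg_left oP hH0]

variable {ρ μ ν₁ ν₂ ν₃} in
-- Conditioning on the numbers of terms. The three Poisson normalizations are collected in one
-- exponential of the total intensity, which stays constant along the exchange.
theorem LinearGrowth.integral_eq_tsum {X : Ω × Sample B₁ × Sample B₂ × Sample B₃ → ℝ}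
    (hX : LinearGrowth ρ X) (hμ : Integrable (fun x : ℝ => x) μ) {ζ₁ ζ₂ ζ₃ : ℝ} (h₁ : 0 ≤ ζ₁)
    (h₂ : 0 ≤ ζ₂) (h₃ : 0 ≤ ζ₃) :
    ∫ z, X z ∂(tripleLaw ρ μ ν₁ ν₂ ν₃ ζ₁ ζ₂ ζ₃) =
      Real.exp (-(ζ₁ + ζ₂ + ζ₃)) * ∑' k : ℕ × ℕ × ℕ,
        divPow k.1 ζ₁ * (divPow k.2.1 ζ₂ * divPow k.2.2 ζ₃) * countMean ρ μ ν₁ ν₂ ν₃ X k := by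
  have hm := hX.1
  have hmp := measurePreserving_counts ρ μ ν₁ ν₂ ν₃ ζ₁ ζ₂ ζ₃
  have hX' : Measurable fun p : (ℕ × ℕ × ℕ) ×
      (Ω × (ℕ → ℝ × B₁) × (ℕ → ℝ × B₂) × (ℕ → ℝ × B₃)) => X (withCounts p.1 p.2) :=
    measurable_from_prod_countable_right fun k => hm.comp (measurable_withCounts k)
  have hi := (hmp.integrable_comp hX'.aestronglyMeasurable).1
    (hX.integrable hμ h₁ h₂ h₃)
  rw [← tsum_mul_left]
  calc ∫ z, X z ∂(tripleLaw ρ μ ν₁ ν₂ ν₃ ζ₁ ζ₂ ζ₃) = _ :=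
        integral_comp_of_measurePreserving hmp hX'.aestronglyMeasurable
    _ = _ := integral_prod _ hi
    _ = _ := integral_countable hi.integral_prod_left
    _ = _ := by
        refine tsum_congr fun k => ?_
        rw [← Prod.mk.eta (p := k), ← Prod.mk.eta (p := k.2), ← Set.singleton_prod_singleton,
          ← Set.singleton_prod_singleton, measureReal_prod_prod, measureReal_prod_prod,
          poissonMeasure_real_singleton, poissonMeasure_real_singleton,
          poissonMeasure_real_singleton, Real.coe_toNNReal _ h₁, Real.coe_toNNReal _ h₂,
          Real.coe_toNNReal _ h₃, neg_add, neg_add, Real.exp_add, Real.exp_add, smul_eq_mul]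
        simp only [divPow, countMean]
        ring

/-! ### Appending a bond to one of the three samples -/

/-- Append a bond to the first sample. -/
def addFst (X : Ω × Sample B₁ × Sample B₂ × Sample B₃ → ℝ)
    (z : (Ω × (ℝ × B₁)) × Sample B₁ × Sample B₂ × Sample B₃) : ℝ :=
  X (z.1.1, addBond z.2.1 z.1.2, z.2.2.1, z.2.2.2)

/-- Append a bond to the second sample. -/
def addSnd (X : Ω × Sample B₁ × Sample B₂ × Sample B₃ → ℝ)
    (z : (Ω × (ℝ × B₂)) × Sample B₁ × Sample B₂ × Sample B₃) : ℝ :=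
  X (z.1.1, z.2.1, addBond z.2.2.1 z.1.2, z.2.2.2)

/-- Append a bond to the third sample. -/
def addTrd (X : Ω × Sample B₁ × Sample B₂ × Sample B₃ → ℝ)
    (z : (Ω × (ℝ × B₃)) × Sample B₁ × Sample B₂ × Sample B₃) : ℝ :=
  X (z.1.1, z.2.1, z.2.2.1, addBond z.2.2.2 z.1.2)

theorem absSum_addBond {B : Type} (D : Sample B) (y : ℝ × B) :
    absSum (addBond D y) = absSum D + |y.1| := by
  simp only [absSum, addBond, Finset.sum_range_succ, Function.update_self]
  rw [Finset.sum_congr rfl fun i hi => by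
    rw [Function.update_of_ne (Finset.mem_range.1 hi).ne]]

theorem integrable_coupling {B : Type} [MeasurableSpace B] (ν : Measure B)
    [IsProbabilityMeasure ν] (hμ : Integrable (fun x : ℝ => x) μ) {H : Ω → ℝ}
    (hH : Integrable H ρ) (C : ℝ) :
    Integrable (fun p : Ω × (ℝ × B) => H p.1 + C * |p.2.1|) (ρ.prod (μ.prod ν)) :=
  (hH.comp_fst _).add (((hμ.abs.comp_fst ν).const_mul C).comp_snd ρ)

variable {ρ} in
-- The extra bond is stored beside the variable of `Ω`, so the enlarged functional is again of the
-- same kind, with `H` replaced by `H + C|J|`.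
theorem LinearGrowth.add (hμ : Integrable (fun x : ℝ => x) μ)
    {X : Ω × Sample B₁ × Sample B₂ × Sample B₃ → ℝ} (hX : LinearGrowth ρ X) :
    LinearGrowth (ρ.prod (μ.prod ν₁)) (addFst X) ∧ LinearGrowth (ρ.prod (μ.prod ν₂)) (addSnd X) ∧
      LinearGrowth (ρ.prod (μ.prod ν₃)) (addTrd X) := by
  obtain ⟨hm, H, C, hH, hC, hb⟩ := hX
  refine ⟨⟨hm.comp ?_, _, C, integrable_coupling ρ μ ν₁ hμ hH C, hC, ?_⟩,
    ⟨hm.comp ?_, _, C, integrable_coupling ρ μ ν₂ hμ hH C, hC, ?_⟩,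
    ⟨hm.comp ?_, _, C, integrable_coupling ρ μ ν₃ hμ hH C, hC, ?_⟩⟩
  · exact (measurable_fst.comp measurable_fst).prodMk ((measurable_addBond.comp
      (f := fun z : (Ω × (ℝ × B₁)) × Sample B₁ × Sample B₂ × Sample B₃ => (z.2.1, z.1.2))
      (by fun_prop)).prodMk (by fun_prop))
  · filter_upwards [Measure.quasiMeasurePreserving_fst.ae hb] with z hz
    refine ⟨by have := hz.1; positivity, fun D₁ D₂ D₃ => (hz.2 _ _ _).trans (le_of_eq ?_)⟩
    rw [absSum_addBond]; ring
  · exact (measurable_fst.comp measurable_fst).prodMk ((by fun_prop : Measurable _).prodMk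
      ((measurable_addBond.comp
      (f := fun z : (Ω × (ℝ × B₂)) × Sample B₁ × Sample B₂ × Sample B₃ => (z.2.2.1, z.1.2))
      (by fun_prop)).prodMk (by fun_prop)))
  · filter_upwards [Measure.quasiMeasurePreserving_fst.ae hb] with z hz
    refine ⟨by have := hz.1; positivity, fun D₁ D₂ D₃ => (hz.2 _ _ _).trans (le_of_eq ?_)⟩
    rw [absSum_addBond]; ring
  · exact (measurable_fst.comp measurable_fst).prodMk ((by fun_prop : Measurable _).prodMk
      ((by fun_prop : Measurable _).prodMk (measurable_addBond.comp
      (f := fun z : (Ω × (ℝ × B₃)) × Sample B₁ × Sample B₂ × Sample B₃ => (z.2.2.2, z.1.2))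
      (by fun_prop))))
  · filter_upwards [Measure.quasiMeasurePreserving_fst.ae hb] with z hz
    refine ⟨by have := hz.1; positivity, fun D₁ D₂ D₃ => (hz.2 _ _ _).trans (le_of_eq ?_)⟩
    rw [absSum_addBond]; ring

theorem measurePreserving_update_swap {X : Type*} [MeasurableSpace X] (μ : Measure X)
    [IsProbabilityMeasure μ] (k : ℕ) :
    MeasurePreserving (fun p : X × (ℕ → X) => Function.update p.2 k p.1)
      (μ.prod (Measure.infinitePi fun _ : ℕ => μ)) (Measure.infinitePi fun _ : ℕ => μ) :=
  (measurePreserving_update μ k).comp Measure.measurePreserving_swap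

theorem measurePreserving_update_fst {X R : Type*} [MeasurableSpace X] [MeasurableSpace R]
    (μ : Measure X) [IsProbabilityMeasure μ] (r : Measure R) [IsProbabilityMeasure r] (k : ℕ) :
    MeasurePreserving (fun p : X × (ℕ → X) × R => (Function.update p.2.1 k p.1, p.2.2))
      (μ.prod ((Measure.infinitePi fun _ : ℕ => μ).prod r))
      ((Measure.infinitePi fun _ : ℕ => μ).prod r) :=
  ((measurePreserving_update_swap μ k).prod (MeasurePreserving.id r)).comp
    (measurePreserving_prodAssoc_symm_fun μ _ r)

/-- A fresh bond written into slot `k` makes the first `k + 1` slots i.i.d., so an added bond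
amounts to raising the count by one. The maps `m₁`, `m₂`, `m₃` carry the fresh bond next to the
sequence it modifies. -/
theorem countMean_add {X : Ω × Sample B₁ × Sample B₂ × Sample B₃ → ℝ} (hX : Measurable X)
    (k : ℕ × ℕ × ℕ) :
    countMean (ρ.prod (μ.prod ν₁)) μ ν₁ ν₂ ν₃ (addFst X) k =
      countMean ρ μ ν₁ ν₂ ν₃ X (k.1 + 1, k.2) ∧
    countMean (ρ.prod (μ.prod ν₂)) μ ν₁ ν₂ ν₃ (addSnd X) k =
      countMean ρ μ ν₁ ν₂ ν₃ X (k.1, k.2.1 + 1, k.2.2) ∧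
    countMean (ρ.prod (μ.prod ν₃)) μ ν₁ ν₂ ν₃ (addTrd X) k =
      countMean ρ μ ν₁ ν₂ ν₃ X (k.1, k.2.1, k.2.2 + 1) := by
  have aesm : ∀ k, AEStronglyMeasurable (fun z => X (withCounts k z)) (seqLaw ρ μ ν₁ ν₂ ν₃) :=
    fun k => (hX.comp (measurable_withCounts k)).aestronglyMeasurable
  have m₁ := ((MeasurePreserving.id ρ).prod (measurePreserving_update_fst (μ.prod ν₁)
    ((Measure.infinitePi fun _ : ℕ => μ.prod ν₂).prod
      (Measure.infinitePi fun _ : ℕ => μ.prod ν₃)) k.1)).comp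
    (measurePreserving_prodAssoc_fun ρ (μ.prod ν₁) _)
  have m₂ := ((MeasurePreserving.id ρ).prod
    (((MeasurePreserving.id (Measure.infinitePi fun _ : ℕ => μ.prod ν₁)).prod
      (measurePreserving_update_fst (μ.prod ν₂)
        (Measure.infinitePi fun _ : ℕ => μ.prod ν₃) k.2.1)).comp
      (measurePreserving_leftComm (μ.prod ν₂) _ _))).comp
    (measurePreserving_prodAssoc_fun ρ (μ.prod ν₂) _)
  have m₃ := ((MeasurePreserving.id ρ).prod
    (((MeasurePreserving.id (Measure.infinitePi fun _ : ℕ => μ.prod ν₁)).prod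
      (((MeasurePreserving.id (Measure.infinitePi fun _ : ℕ => μ.prod ν₂)).prod
        (measurePreserving_update_swap (μ.prod ν₃) k.2.2)).comp
          (measurePreserving_leftComm (μ.prod ν₃) _ _))).comp
      (measurePreserving_leftComm (μ.prod ν₃) _ _))).comp
    (measurePreserving_prodAssoc_fun ρ (μ.prod ν₃) _)
  exact ⟨integral_comp_of_measurePreserving m₁ (aesm (k.1 + 1, k.2)),
    integral_comp_of_measurePreserving m₂ (aesm (k.1, k.2.1 + 1, k.2.2)),
    integral_comp_of_measurePreserving m₃ (aesm (k.1, k.2.1, k.2.2 + 1))⟩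

/-- The derivative of an expectation along an exchange of the intensities of three Poisson
samples: each intensity contributes the effect of one additional bond. -/
theorem hasDerivWithinAt_integral_tripleLaw (hμ : Integrable (fun x : ℝ => x) μ)
    {X : Ω × Sample B₁ × Sample B₂ × Sample B₃ → ℝ} (hX : LinearGrowth ρ X) {a₁ a₂ : ℝ}
    (h₁ : 0 ≤ a₁) (h₂ : 0 ≤ a₂) {t : ℝ} (ht : t ∈ Set.Icc (0 : ℝ) 1) :
    HasDerivWithinAt
      (fun t => ∫ z, X z ∂(tripleLaw ρ μ ν₁ ν₂ ν₃ (t * a₁) (t * a₂) ((1 - t) * (a₁ + a₂))))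
      (a₁ * ∫ z, addFst X z ∂(tripleLaw (ρ.prod (μ.prod ν₁)) μ ν₁ ν₂ ν₃
          (t * a₁) (t * a₂) ((1 - t) * (a₁ + a₂))) +
        a₂ * ∫ z, addSnd X z ∂(tripleLaw (ρ.prod (μ.prod ν₂)) μ ν₁ ν₂ ν₃
          (t * a₁) (t * a₂) ((1 - t) * (a₁ + a₂))) -
        (a₁ + a₂) * ∫ z, addTrd X z ∂(tripleLaw (ρ.prod (μ.prod ν₃)) μ ν₁ ν₂ ν₃
          (t * a₁) (t * a₂) ((1 - t) * (a₁ + a₂)))) (Set.Icc 0 1) t := by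
  have h₃ : 0 ≤ a₁ + a₂ := by positivity
  obtain ⟨g₁, g₂, g₃⟩ := hX.add μ ν₁ ν₂ ν₃ hμ
  have hE := hX.expBounded (ν₁ := ν₁) (ν₂ := ν₂) (ν₃ := ν₃) hμ
  -- Constancy of the total intensity: the exponential prefactor is not differentiated, so no term
  -- without an extra bond appears.
  have hexp : ∀ t : ℝ, t * a₁ + t * a₂ + (1 - t) * (a₁ + a₂) = a₁ + a₂ := fun t => by ring
  have rep := fun t (ht : t ∈ Set.Icc (0 : ℝ) 1) => hX.integral_eq_tsum (ν₁ := ν₁) (ν₂ := ν₂)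
    (ν₃ := ν₃) hμ (mul_nonneg ht.1 h₁) (mul_nonneg ht.1 h₂)
    (mul_nonneg (sub_nonneg.2 ht.2) h₃)
  have key := ((hasDerivAt_tsum_divPow hE h₁ h₂ h₃ ht).const_mul
    (Real.exp (-(a₁ + a₂)))).hasDerivWithinAt (s := Set.Icc 0 1)
  -- The series represents the expectation only where all intensities are non-negative, because
  -- `sampleLaw` truncates its mean by `toNNReal`. This is why the derivative is taken within `[0,
  -- 1]`.
  refine (key.congr (fun y hy => ?_) ?_).congr_deriv ?_
  · rw [rep y hy, hexp]
  · rw [rep t ht, hexp]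
  · have z₁ := mul_nonneg ht.1 h₁
    have z₂ := mul_nonneg ht.1 h₂
    have z₃ := mul_nonneg (sub_nonneg.2 ht.2) h₃
    rw [g₁.integral_eq_tsum hμ z₁ z₂ z₃, g₂.integral_eq_tsum hμ z₁ z₂ z₃,
      g₃.integral_eq_tsum hμ z₁ z₂ z₃, hexp]
    simp only [fun k => (countMean_add ρ μ ν₁ ν₂ ν₃ hX.1 k).1,
      fun k => (countMean_add ρ μ ν₁ ν₂ ν₃ hX.1 k).2.1,
      fun k => (countMean_add ρ μ ν₁ ν₂ ν₃ hX.1 k).2.2]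
    have e₁ := summable_divPow_mul hE.comp_shift.1 (t * a₁) (t * a₂) ((1 - t) * (a₁ + a₂))
    have e₂ := summable_divPow_mul hE.comp_shift.2.1 (t * a₁) (t * a₂) ((1 - t) * (a₁ + a₂))
    have e₃ := summable_divPow_mul hE.comp_shift.2.2 (t * a₁) (t * a₂) ((1 - t) * (a₁ + a₂))
    have e := ((e₁.hasSum.mul_left a₁).add (e₂.hasSum.mul_left a₂)).sub
      (e₃.hasSum.mul_left (a₁ + a₂))
    rw [(e.congr_fun fun k => by ring : HasSum (fun k : ℕ × ℕ × ℕ =>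
      divPow k.1 (t * a₁) * (divPow k.2.1 (t * a₂) * divPow k.2.2 ((1 - t) * (a₁ + a₂))) *
        (a₁ * countMean ρ μ ν₁ ν₂ ν₃ X (k.1 + 1, k.2) +
          a₂ * countMean ρ μ ν₁ ν₂ ν₃ X (k.1, k.2.1 + 1, k.2.2) -
          (a₁ + a₂) * countMean ρ μ ν₁ ν₂ ν₃ X (k.1, k.2.1, k.2.2 + 1))) _).tsum_eq]
    ring

end Triple

/-! ### Gibbs averages over a countable space -/

section Gibbs

variable {A : Type}

/-- Non-negative weights with a finite and non-zero sum. -/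
structure IsWeight (w : A → ℝ) : Prop where
  nonneg : ∀ a, 0 ≤ w a
  summable : Summable w
  sum_pos : 0 < ∑' a, w a

/-- The average of `f` with respect to the normalized weights. -/
def gibbs (w f : A → ℝ) : ℝ := (∑' a, w a * f a) / ∑' a, w a

/-- The logarithm of the average of `e^{-βE}`. -/
def logAvg (β : ℝ) (w E : A → ℝ) : ℝ := Real.log (gibbs w fun a => Real.exp (-β * E a))

theorem IsWeight.summable_mul {w : A → ℝ} (hw : IsWeight w) {f : A → ℝ} {C : ℝ}
    (hf : ∀ a, |f a| ≤ C) : Summable fun a => w a * f a := by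
  refine Summable.of_norm_bounded (hw.summable.mul_right C) fun a => ?_
  rw [norm_mul, Real.norm_of_nonneg (hw.nonneg a)]
  exact mul_le_mul_of_nonneg_left (hf a) (hw.nonneg a)

theorem IsWeight.abs_tsum_le {w : A → ℝ} (hw : IsWeight w) {f : A → ℝ} {C : ℝ}
    (hf : ∀ a, |f a| ≤ C) : |∑' a, w a * f a| ≤ (∑' a, w a) * C := by
  rw [← tsum_mul_right, ← Real.norm_eq_abs]
  refine tsum_of_norm_bounded (hw.summable.mul_right C).hasSum fun a => ?_
  rw [norm_mul, Real.norm_of_nonneg (hw.nonneg a)]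
  exact mul_le_mul_of_nonneg_left (hf a) (hw.nonneg a)

theorem IsWeight.abs_gibbs_le {w : A → ℝ} (hw : IsWeight w) {f : A → ℝ} {C : ℝ}
    (hf : ∀ a, |f a| ≤ C) : |gibbs w f| ≤ C := by
  rw [gibbs, abs_div, abs_of_pos hw.sum_pos, div_le_iff₀ hw.sum_pos, mul_comm]
  exact hw.abs_tsum_le hf

theorem IsWeight.le_gibbs {w : A → ℝ} (hw : IsWeight w) {f : A → ℝ} {c C : ℝ}
    (hf : ∀ a, |f a| ≤ C) (hc : ∀ a, c ≤ f a) : c ≤ gibbs w f := by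
  rw [gibbs, le_div_iff₀ hw.sum_pos, mul_comm, ← tsum_mul_right]
  exact (hw.summable.mul_right c).tsum_le_tsum
    (fun a => mul_le_mul_of_nonneg_left (hc a) (hw.nonneg a)) (hw.summable_mul hf)

theorem abs_exp_le {β C : ℝ} (hβ : 0 ≤ β) {x : ℝ} (h : |x| ≤ C) :
    |Real.exp (-β * x)| ≤ Real.exp (β * C) := by
  rw [Real.abs_exp]
  refine Real.exp_le_exp.2 ?_
  nlinarith [abs_le.1 h]

theorem le_exp {β C : ℝ} (hβ : 0 ≤ β) {x : ℝ} (h : |x| ≤ C) :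
    Real.exp (-(β * C)) ≤ Real.exp (-β * x) := by
  refine Real.exp_le_exp.2 ?_
  nlinarith [abs_le.1 h]

theorem IsWeight.abs_logAvg_le {w : A → ℝ} (hw : IsWeight w) {β C : ℝ} (hβ : 0 ≤ β) {E : A → ℝ}
    (hE : ∀ a, |E a| ≤ C) : |logAvg β w E| ≤ β * C := by
  have h₁ := hw.le_gibbs (fun a => abs_exp_le hβ (hE a)) (fun a => le_exp hβ (hE a))
  have h₂ := (le_abs_self _).trans (hw.abs_gibbs_le (fun a => abs_exp_le hβ (hE a)))
  have hp := (Real.exp_pos _).trans_le h₁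
  rw [abs_le]
  exact ⟨(Real.le_log_iff_exp_le hp).2 h₁, (Real.log_le_iff_le_exp hp).2 h₂⟩

theorem IsWeight.mul {w : A → ℝ} (hw : IsWeight w) {f : A → ℝ} {c C : ℝ} (hc : 0 < c)
    (hf : ∀ a, |f a| ≤ C) (hcf : ∀ a, c ≤ f a) : IsWeight fun a => w a * f a := by
  refine ⟨fun a => mul_nonneg (hw.nonneg a) (hc.le.trans (hcf a)), hw.summable_mul hf, ?_⟩
  have h := hw.le_gibbs hf hcf
  rw [gibbs, le_div_iff₀ hw.sum_pos] at h
  exact (mul_pos hc hw.sum_pos).trans_le h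

theorem IsWeight.tilt {w : A → ℝ} (hw : IsWeight w) {β C : ℝ} (hβ : 0 ≤ β) {E : A → ℝ}
    (hE : ∀ a, |E a| ≤ C) : IsWeight fun a => w a * Real.exp (-β * E a) :=
  hw.mul (Real.exp_pos _) (fun a => abs_exp_le hβ (hE a)) (fun a => le_exp hβ (hE a))

theorem IsWeight.logAvg_eq_sub {w : A → ℝ} (hw : IsWeight w) {β C : ℝ} (hβ : 0 ≤ β) {E : A → ℝ}
    (hE : ∀ a, |E a| ≤ C) :
    logAvg β w E = Real.log (∑' a, w a * Real.exp (-β * E a)) - Real.log (∑' a, w a) := by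
  rw [logAvg, gibbs, Real.log_div (hw.tilt hβ hE).sum_pos.ne' hw.sum_pos.ne']

/-- The effect on `logAvg` of one additional bond. -/
theorem IsWeight.logAvg_sub_bond {w : A → ℝ} (hw : IsWeight w) {β C : ℝ} (hβ : 0 ≤ β)
    {E : A → ℝ} (hE : ∀ a, |E a| ≤ C) (J : ℝ) {b : A → ℝ} (hb : ∀ a, b a = 1 ∨ b a = -1) :
    logAvg β w (fun a => E a - J * b a) = logAvg β w E +
      Real.log (Real.cosh (β * J) + gibbs (fun a => w a * Real.exp (-β * E a)) b *
        Real.sinh (β * J)) := by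
  have hb1 : ∀ a, |b a| ≤ 1 := fun a => by rcases hb a with h | h <;> simp [h]
  have hE' : ∀ a, |E a - J * b a| ≤ C + |J| := fun a => by
    refine (abs_sub _ _).trans (add_le_add (hE a) ?_)
    rw [abs_mul]; exact mul_le_of_le_one_right (abs_nonneg _) (hb1 a)
  have hW := hw.tilt hβ hE
  -- For a sign `b`, `exp (βJb) = cosh (βJ) + b sinh (βJ)`, which is linear in `b`.
  have key : ∀ a, w a * Real.exp (-β * (E a - J * b a)) =
      w a * Real.exp (-β * E a) * Real.cosh (β * J) +
        w a * Real.exp (-β * E a) * b a * Real.sinh (β * J) := fun a => by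
    rw [show -β * (E a - J * b a) = -β * E a + β * J * b a by ring, Real.exp_add]
    rcases hb a with h | h
    · rw [h, mul_one, ← Real.cosh_add_sinh (β * J)]; ring
    · rw [h, mul_neg_one, ← Real.cosh_sub_sinh (β * J)]; ring
  have hs : ∑' a, w a * Real.exp (-β * (E a - J * b a)) =
      (∑' a, w a * Real.exp (-β * E a)) * (Real.cosh (β * J) +
        gibbs (fun a => w a * Real.exp (-β * E a)) b * Real.sinh (β * J)) := by
    simp_rw [key]
    rw [(hW.summable.mul_right _).tsum_add ((hW.summable_mul hb1).mul_right _), tsum_mul_right,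
      tsum_mul_right, gibbs, mul_add, ← mul_assoc, mul_div_cancel₀ _ hW.sum_pos.ne']
  have hpos := (hw.tilt hβ hE').sum_pos
  rw [hw.logAvg_eq_sub hβ hE', hw.logAvg_eq_sub hβ hE, hs, Real.log_mul hW.sum_pos.ne']
  · ring
  · intro h0
    rw [hs, h0, mul_zero] at hpos
    exact lt_irrefl _ hpos

end Gibbs

/-! ### Averaging over a symmetric coupling -/

section Coupling

theorem cosh_add_mul_sinh (m x : ℝ) : Real.cosh x + m * Real.sinh x =
    (1 + m) / 2 * Real.exp x + (1 - m) / 2 * Real.exp (-x) := by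
  rw [Real.cosh_eq, Real.sinh_eq]; ring

/-- For `|m| ≤ 1` the expression is a convex combination of `e^x` and `e^{-x}`: the mean of `e^{sx}`
for a random sign `s` of mean `m`. -/
theorem cosh_add_mul_sinh_mem {m : ℝ} (hm : |m| ≤ 1) (x : ℝ) :
    Real.exp (-|x|) ≤ Real.cosh x + m * Real.sinh x ∧
      Real.cosh x + m * Real.sinh x ≤ Real.exp |x| := by
  rw [cosh_add_mul_sinh]
  have h := abs_le.1 hm
  have h₁ : 0 ≤ (1 + m) / 2 := by linarith
  have h₂ : 0 ≤ (1 - m) / 2 := by linarith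
  have e₁ := Real.exp_le_exp.2 (le_abs_self x)
  have e₂ := Real.exp_le_exp.2 (neg_le_abs x)
  have e₃ := Real.exp_le_exp.2 (neg_abs_le x)
  have e₄ := Real.exp_le_exp.2 (neg_le_neg (le_abs_self x))
  constructor <;> nlinarith

theorem abs_log_cosh_add_le {m : ℝ} (hm : |m| ≤ 1) (x : ℝ) :
    |Real.log (Real.cosh x + m * Real.sinh x)| ≤ |x| := by
  obtain ⟨h₁, h₂⟩ := cosh_add_mul_sinh_mem hm x
  have hp := (Real.exp_pos _).trans_le h₁
  rw [abs_le]
  exact ⟨(Real.le_log_iff_exp_le hp).2 h₁, (Real.log_le_iff_le_exp hp).2 h₂⟩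

/-- The product of the arguments at `x` and `-x` is `cosh² x (1 - (m tanh x)²)`. The series is then
that of `-log (1 - y) / 2` at `y = (m tanh x)²`, where `|y| < 1` because `|tanh x| < 1`. -/
theorem hasSum_log_cosh {m : ℝ} (hm : |m| ≤ 1) (x : ℝ) :
    HasSum (fun n : ℕ => Real.tanh x ^ (2 * (n + 1)) / (2 * ((n : ℝ) + 1)) * m ^ (2 * (n + 1)))
      (Real.log (Real.cosh x) - (Real.log (Real.cosh x + m * Real.sinh x) +
        Real.log (Real.cosh (-x) + m * Real.sinh (-x))) / 2) := by
  have ht : |Real.tanh x| < 1 := Real.abs_tanh_lt_one x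
  have hc := Real.cosh_pos x
  have hy : |(Real.tanh x * m) ^ 2| < 1 := by
    rw [abs_of_nonneg (sq_nonneg _), sq_lt_one_iff_abs_lt_one, abs_mul]
    exact lt_of_le_of_lt (mul_le_of_le_one_right (abs_nonneg _) hm) ht
  have h := (Real.hasSum_pow_div_log_of_abs_lt_one hy).div_const 2
  have p₁ := (Real.exp_pos _).trans_le (cosh_add_mul_sinh_mem hm x).1
  have p₂ := (Real.exp_pos _).trans_le (cosh_add_mul_sinh_mem hm (-x)).1
  have e : Real.log (Real.cosh x) - (Real.log (Real.cosh x + m * Real.sinh x) +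
        Real.log (Real.cosh (-x) + m * Real.sinh (-x))) / 2 =
      -Real.log (1 - (Real.tanh x * m) ^ 2) / 2 := by
    rw [← Real.log_mul p₁.ne' p₂.ne']
    have : (Real.cosh x + m * Real.sinh x) * (Real.cosh (-x) + m * Real.sinh (-x)) =
        Real.cosh x ^ 2 * (1 - (Real.tanh x * m) ^ 2) := by
      rw [Real.cosh_neg, Real.sinh_neg, Real.tanh_eq_sinh_div_cosh]
      field_simp
      ring
    rw [this, Real.log_mul (by positivity) (by linarith [(abs_lt.1 hy).2]), Real.log_pow]
    push_cast; ring
  rw [e]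
  refine h.congr_fun fun n => ?_
  rw [← pow_mul, mul_pow]
  field_simp

variable (μ : Measure ℝ) [IsProbabilityMeasure μ] (β : ℝ)

/-- The coefficient `𝔼[tanh^{2n+2}(βJ)] / (2n+2)` of the expansion of the logarithm. -/
def tanhCoef (n : ℕ) : ℝ := (∫ J, Real.tanh (β * J) ^ (2 * (n + 1)) ∂μ) / (2 * ((n : ℝ) + 1))

theorem tanhCoef_nonneg (n : ℕ) : 0 ≤ tanhCoef μ β n :=
  div_nonneg (integral_nonneg fun J => (even_two_mul (n + 1)).pow_nonneg _) (by positivity)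

theorem measurable_log_cosh_add {m : ℝ} :
    Measurable fun J : ℝ => Real.log (Real.cosh (β * J) + m * Real.sinh (β * J)) := by
  fun_prop

theorem integrable_log_cosh_add (hμ : Integrable (fun x : ℝ => x) μ) {m : ℝ} (hm : |m| ≤ 1) :
    Integrable (fun J => Real.log (Real.cosh (β * J) + m * Real.sinh (β * J))) μ :=
  ((hμ.const_mul β).abs).mono' (measurable_log_cosh_add β).aestronglyMeasurable
    (ae_of_all _ fun _ => abs_log_cosh_add_le hm _)

variable {μ}

theorem integral_comp_neg_of_map_eq (hsymm : μ.map (fun x => -x) = μ) (f : ℝ → ℝ) :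
    ∫ x, f (-x) ∂μ = ∫ x, f x ∂μ := by
  conv_rhs => rw [← hsymm]
  exact ((MeasurableEquiv.neg ℝ).measurableEmbedding.integral_map f).symm

/-- The expansion in even powers of the average of `log (cosh (βJ) + m sinh (βJ))` over a
symmetric coupling. -/
theorem hasSum_tanhCoef (hsymm : μ.map (fun x => -x) = μ) (hμ : Integrable (fun x : ℝ => x) μ)
    {m : ℝ} (hm : |m| ≤ 1) :
    HasSum (fun n => tanhCoef μ β n * m ^ (2 * (n + 1)))
      (∫ J, Real.log (Real.cosh (β * J)) ∂μ -
        ∫ J, Real.log (Real.cosh (β * J) + m * Real.sinh (β * J)) ∂μ) := by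
  have i₀ : Integrable (fun J => Real.log (Real.cosh (β * J))) μ := by
    simpa using integrable_log_cosh_add μ β hμ (m := 0) (by simp)
  have i₁ := integrable_log_cosh_add μ β hμ hm
  have i₂ : Integrable (fun J => Real.log (Real.cosh (-(β * J)) + m * Real.sinh (-(β * J)))) μ := by
    simpa using integrable_log_cosh_add μ (-β) hμ hm
  -- By symmetry of the law, the logarithm may be replaced by its mean over `J` and `-J`.
  have hint : ∫ J, (Real.log (Real.cosh (β * J)) -
      (Real.log (Real.cosh (β * J) + m * Real.sinh (β * J)) +
        Real.log (Real.cosh (-(β * J)) + m * Real.sinh (-(β * J)))) / 2) ∂μ =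
      ∫ J, Real.log (Real.cosh (β * J)) ∂μ -
        ∫ J, Real.log (Real.cosh (β * J) + m * Real.sinh (β * J)) ∂μ := by
    have i₃ : Integrable (fun J => (Real.log (Real.cosh (β * J) + m * Real.sinh (β * J)) +
        Real.log (Real.cosh (-(β * J)) + m * Real.sinh (-(β * J)))) / 2) μ :=
      (i₁.add i₂).div_const 2
    rw [integral_sub i₀ i₃, integral_div, integral_add i₁ i₂]
    have := integral_comp_neg_of_map_eq hsymm
      (fun J => Real.log (Real.cosh (β * J) + m * Real.sinh (β * J)))
    simp only [mul_neg] at this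
    rw [this]; ring
  -- At `m = 1` the two logarithms are `x` and `-x` and cancel, so the series without `m` sums to
  -- `log cosh x`. This is the integrable majorant for dominated convergence.
  have hone : ∀ x : ℝ, HasSum (fun n : ℕ => Real.tanh x ^ (2 * (n + 1)) / (2 * ((n : ℝ) + 1)))
      (Real.log (Real.cosh x)) := fun x => by
    have := hasSum_log_cosh (m := 1) (by simp) x
    have e : Real.log (Real.cosh x + 1 * Real.sinh x) +
        Real.log (Real.cosh (-x) + 1 * Real.sinh (-x)) = 0 := by
      rw [one_mul, one_mul, Real.cosh_add_sinh, Real.cosh_add_sinh, Real.log_exp, Real.log_exp]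
      ring
    rw [e] at this
    simpa using this
  rw [← hint]
  have key := hasSum_integral_of_dominated_convergence (μ := μ)
    (F := fun (n : ℕ) J => Real.tanh (β * J) ^ (2 * (n + 1)) / (2 * ((n : ℝ) + 1)) *
      m ^ (2 * (n + 1)))
    (fun (n : ℕ) J => Real.tanh (β * J) ^ (2 * (n + 1)) / (2 * ((n : ℝ) + 1)))
    (fun n => ?_) (fun n => ae_of_all _ fun J => ?_)
    (ae_of_all _ fun J => (hone _).summable) ?_ (ae_of_all _ fun J => hasSum_log_cosh hm _)
  · refine key.congr_fun fun n => ?_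
    rw [integral_mul_const, integral_div, tanhCoef]
  · have : Continuous Real.tanh := by
      simp_rw [funext Real.tanh_eq_sinh_div_cosh]
      exact Real.continuous_sinh.div Real.continuous_cosh fun x => (Real.cosh_pos x).ne'
    exact Continuous.aestronglyMeasurable (by fun_prop)
  · have h0 : 0 ≤ Real.tanh (β * J) ^ (2 * (n + 1)) / (2 * ((n : ℝ) + 1)) :=
      div_nonneg ((even_two_mul (n + 1)).pow_nonneg _) (by positivity)
    rw [norm_mul, Real.norm_of_nonneg h0, norm_pow]
    exact mul_le_of_le_one_right h0 (pow_le_one₀ (norm_nonneg _) hm)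
  · refine i₀.congr (ae_of_all _ fun J => ?_)
    exact (hone (β * J)).tsum_eq.symm

theorem summable_tanhCoef (hsymm : μ.map (fun x => -x) = μ)
    (hμ : Integrable (fun x : ℝ => x) μ) : Summable (tanhCoef μ β) := by
  simpa using (hasSum_tanhCoef β hsymm hμ (m := 1) (by simp)).summable

/-- Integrates the expansion over a random magnetization `m` independent of `J`. As `|m| ≤ 1` almost
surely, the summable coefficients themselves dominate. -/
theorem hasSum_tanhCoef_integral (hsymm : μ.map (fun x => -x) = μ)
    (hμ : Integrable (fun x : ℝ => x) μ) {Θ : Type*} [MeasurableSpace Θ] (Λ : Measure Θ)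
    [IsProbabilityMeasure Λ] {m : Θ → ℝ} (hm : Measurable m) (hm1 : ∀ᵐ θ ∂Λ, |m θ| ≤ 1) :
    HasSum (fun n => tanhCoef μ β n * ∫ θ, m θ ^ (2 * (n + 1)) ∂Λ)
      (∫ J, Real.log (Real.cosh (β * J)) ∂μ -
        ∫ z, Real.log (Real.cosh (β * z.2) + m z.1 * Real.sinh (β * z.2)) ∂(Λ.prod μ)) := by
  have hmeas : Measurable fun z : Θ × ℝ =>
      Real.log (Real.cosh (β * z.2) + m z.1 * Real.sinh (β * z.2)) := by fun_prop
  have hi : Integrable (fun z : Θ × ℝ =>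
      Real.log (Real.cosh (β * z.2) + m z.1 * Real.sinh (β * z.2))) (Λ.prod μ) := by
    refine (((hμ.const_mul β).abs).comp_snd Λ).mono' hmeas.aestronglyMeasurable ?_
    filter_upwards [Measure.quasiMeasurePreserving_fst.ae hm1] with z hz
    exact abs_log_cosh_add_le hz _
  rw [integral_prod _ hi]
  have e : ∫ J, Real.log (Real.cosh (β * J)) ∂μ -
        ∫ θ, ∫ J, Real.log (Real.cosh (β * J) + m θ * Real.sinh (β * J)) ∂μ ∂Λ =
      ∫ θ, (∫ J, Real.log (Real.cosh (β * J)) ∂μ -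
        ∫ J, Real.log (Real.cosh (β * J) + m θ * Real.sinh (β * J)) ∂μ) ∂Λ := by
    rw [integral_sub (integrable_const _) hi.integral_prod_left]
    simp
  rw [e]
  have hs := summable_tanhCoef β hsymm hμ
  have key := hasSum_integral_of_dominated_convergence (μ := Λ)
    (F := fun (n : ℕ) θ => tanhCoef μ β n * m θ ^ (2 * (n + 1)))
    (fun (n : ℕ) _ => tanhCoef μ β n) (fun n => ?_) (fun n => ?_)
    (ae_of_all _ fun _ => hs) (integrable_const _)
    (hm1.mono fun θ hθ => hasSum_tanhCoef β hsymm hμ hθ)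
  · exact key.congr_fun fun n => (integral_const_mul _ _).symm
  · exact ((hm.pow_const _).const_mul _).aestronglyMeasurable
  · filter_upwards [hm1] with θ hθ
    rw [norm_mul, Real.norm_of_nonneg (tanhCoef_nonneg μ β n), norm_pow]
    exact mul_le_of_le_one_right (tanhCoef_nonneg μ β n) (pow_le_one₀ (norm_nonneg _) hθ)

end Coupling

/-! ### Replicas of random spin fields -/

/-- A measurable family of fields of signs. -/
structure IsSpinField {A B : Type} [MeasurableSpace B] (b : B → A → ℝ) : Prop where
  measurable : ∀ a, Measurable fun p => b p a
  eq_or : ∀ p a, b p a = 1 ∨ b p a = -1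

section Field

variable {A B : Type} [MeasurableSpace B]

theorem IsSpinField.abs_le {b : B → A → ℝ} (hb : IsSpinField b) (p : B) (a : A) :
    |b p a| ≤ 1 := by rcases hb.eq_or p a with h | h <;> simp [h]

theorem IsSpinField.integrable_prod {b : B → A → ℝ} (hb : IsSpinField b) (ν : Measure B)
    [IsProbabilityMeasure ν] {n : ℕ} (x : Fin n → A) :
    Integrable (fun p => ∏ i, b p (x i)) ν := by
  refine Integrable.of_bound
    (Finset.measurable_prod _ fun i _ => hb.measurable (x i)).aestronglyMeasurable 1
    (ae_of_all _ fun p => ?_)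
  rw [Real.norm_eq_abs, Finset.abs_prod]
  exact Finset.prod_le_one (fun i _ => abs_nonneg _) fun i _ => hb.abs_le p (x i)

/-- Expanding the power over `n`-tuples is what introduces the replicas. -/
theorem IsSpinField.integral_sum_pow {b : B → A → ℝ} (hb : IsSpinField b) (ν : Measure B)
    [IsProbabilityMeasure ν] (W : A → ℝ) (F : Finset A) (n : ℕ) :
    ∫ p, (∑ a ∈ F, W a * b p a) ^ n ∂ν =
      ∑ x ∈ Fintype.piFinset fun _ : Fin n => F, (∏ i, W (x i)) * ∫ p, ∏ i, b p (x i) ∂ν := by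
  simp_rw [Finset.sum_pow', Finset.prod_mul_distrib]
  rw [integral_finsetSum _ fun x _ => (hb.integrable_prod ν x).const_mul _]
  simp_rw [integral_const_mul]

variable [Countable A]

/-- On a countable space the replica expansion is made on finite subsets, with passage to the limit
by bounded convergence under the bound `(∑ W) ^ n`. -/
theorem IsSpinField.tendsto_integral_sum_pow {b : B → A → ℝ} (hb : IsSpinField b)
    (ν : Measure B) [IsProbabilityMeasure ν] {W : A → ℝ} (hW : IsWeight W) (n : ℕ) :
    Tendsto (fun F : Finset A => ∫ p, (∑ a ∈ F, W a * b p a) ^ n ∂ν) atTop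
      (𝓝 (∫ p, (∑' a, W a * b p a) ^ n ∂ν)) := by
  refine tendsto_integral_filter_of_norm_le_const (Eventually.of_forall fun F => ?_)
    ⟨(∑' a, W a) ^ n, Eventually.of_forall fun F => ae_of_all _ fun p => ?_⟩
    (ae_of_all _ fun p => ?_)
  · exact ((Finset.measurable_sum F fun a _ =>
      (hb.measurable a).const_mul (W a)).pow_const n).aestronglyMeasurable
  · rw [norm_pow]
    refine pow_le_pow_left₀ (norm_nonneg _) ?_ n
    refine (norm_sum_le _ _).trans ((Finset.sum_le_sum fun a _ => ?_).trans
      (hW.summable.sum_le_tsum F fun a _ => hW.nonneg a))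
    rw [norm_mul, Real.norm_of_nonneg (hW.nonneg a)]
    exact mul_le_of_le_one_right (hW.nonneg a) (hb.abs_le p a)
  · exact (hW.summable_mul (hb.abs_le p)).hasSum.pow n

variable {B₁ B₂ B₃ : Type} [MeasurableSpace B₁] [MeasurableSpace B₂] [MeasurableSpace B₃]

/-- A linear combination of moments of Gibbs averages of spin fields has a sign as soon as the
corresponding combination of replica moments has it. -/
theorem IsWeight.sum_integral_gibbs_pow_nonneg {W : A → ℝ} (hW : IsWeight W) {b₁ : B₁ → A → ℝ}
    {b₂ : B₂ → A → ℝ} {b₃ : B₃ → A → ℝ} (hb₁ : IsSpinField b₁) (hb₂ : IsSpinField b₂)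
    (hb₃ : IsSpinField b₃) (ν₁ : Measure B₁) (ν₂ : Measure B₂) (ν₃ : Measure B₃)
    [IsProbabilityMeasure ν₁] [IsProbabilityMeasure ν₂] [IsProbabilityMeasure ν₃]
    (c₁ c₂ c₃ : ℝ) {n : ℕ} (h : ∀ x : Fin n → A, 0 ≤ c₁ * ∫ p, ∏ i, b₁ p (x i) ∂ν₁ +
      c₂ * ∫ p, ∏ i, b₂ p (x i) ∂ν₂ + c₃ * ∫ p, ∏ i, b₃ p (x i) ∂ν₃) :
    0 ≤ c₁ * ∫ p, gibbs W (b₁ p) ^ n ∂ν₁ + c₂ * ∫ p, gibbs W (b₂ p) ^ n ∂ν₂ +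
      c₃ * ∫ p, gibbs W (b₃ p) ^ n ∂ν₃ := by
  simp only [gibbs, div_pow]
  rw [integral_div, integral_div, integral_div, mul_div_assoc', mul_div_assoc', mul_div_assoc',
    ← add_div, ← add_div]
  refine div_nonneg ?_ (pow_nonneg hW.sum_pos.le n)
  -- With the common denominator removed, it suffices to treat finite partial sums, where the
  -- expression is a sum over replicas with non-negative weights.
  refine ge_of_tendsto' ((((hb₁.tendsto_integral_sum_pow ν₁ hW n).const_mul c₁).add
    ((hb₂.tendsto_integral_sum_pow ν₂ hW n).const_mul c₂)).add
    ((hb₃.tendsto_integral_sum_pow ν₃ hW n).const_mul c₃)) fun F => ?_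
  rw [hb₁.integral_sum_pow, hb₂.integral_sum_pow, hb₃.integral_sum_pow, Finset.mul_sum,
    Finset.mul_sum, Finset.mul_sum, ← Finset.sum_add_distrib, ← Finset.sum_add_distrib]
  refine Finset.sum_nonneg fun x _ => ?_
  have := mul_nonneg (Finset.prod_nonneg fun i (_ : i ∈ Finset.univ) => hW.nonneg (x i)) (h x)
  linarith

theorem IsSpinField.integral_gibbs_pow [Fintype A] {b : B → A → ℝ} (hb : IsSpinField b)
    (ν : Measure B) [IsProbabilityMeasure ν] (W : A → ℝ) (n : ℕ) :
    ∫ p, gibbs W (b p) ^ n ∂ν = replicaAvg n W fun x => ∫ p, ∏ i, b p (x i) ∂ν := by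
  simp only [gibbs, div_pow, tsum_fintype]
  rw [integral_div, hb.integral_sum_pow, replicaAvg, Fintype.piFinset_univ]

end Field

/-! ### Exchange of the intensities of three diluted Hamiltonians -/

section Exchange

variable {Ω A B₁ B₂ B₃ : Type} [MeasurableSpace Ω] [MeasurableSpace B₁] [MeasurableSpace B₂]
  [MeasurableSpace B₃] [Countable A]

/-- The sum of the energies of three samples. -/
def totalEnergy (b₁ : B₁ → A → ℝ) (b₂ : B₂ → A → ℝ) (b₃ : B₃ → A → ℝ)
    (D : Sample B₁ × Sample B₂ × Sample B₃) (a : A) : ℝ :=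
  energy b₁ D.1 a + energy b₂ D.2.1 a + energy b₃ D.2.2 a

variable (β : ℝ) (w : Ω → A → ℝ) (b₁ : B₁ → A → ℝ) (b₂ : B₂ → A → ℝ) (b₃ : B₃ → A → ℝ)

/-- The logarithm of the average of `e^{-βE}` for the total energy `E`. -/
def tripleLog (z : Ω × Sample B₁ × Sample B₂ × Sample B₃) : ℝ :=
  logAvg β (w z.1) (totalEnergy b₁ b₂ b₃ z.2)

/-- The weights tilted by the total energy. -/
def tripleWeight (z : Ω × Sample B₁ × Sample B₂ × Sample B₃) (a : A) : ℝ :=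
  w z.1 a * Real.exp (-β * totalEnergy b₁ b₂ b₃ z.2 a)

variable {β w b₁ b₂ b₃} {ρ : Measure Ω} {μ : Measure ℝ} {ν₁ : Measure B₁} {ν₂ : Measure B₂}
  {ν₃ : Measure B₃} [IsProbabilityMeasure ρ] [IsProbabilityMeasure μ] [IsProbabilityMeasure ν₁]
  [IsProbabilityMeasure ν₂] [IsProbabilityMeasure ν₃]

theorem measurable_totalEnergy (hb₁ : IsSpinField b₁) (hb₂ : IsSpinField b₂)
    (hb₃ : IsSpinField b₃) (a : A) : Measurable fun D => totalEnergy b₁ b₂ b₃ D a :=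
  (((measurable_energy hb₁.measurable a).comp measurable_fst).add
    ((measurable_energy hb₂.measurable a).comp (measurable_fst.comp measurable_snd))).add
    ((measurable_energy hb₃.measurable a).comp (measurable_snd.comp measurable_snd))

theorem abs_totalEnergy_le (hb₁ : IsSpinField b₁) (hb₂ : IsSpinField b₂) (hb₃ : IsSpinField b₃)
    (D : Sample B₁ × Sample B₂ × Sample B₃) (a : A) :
    |totalEnergy b₁ b₂ b₃ D a| ≤ absSum D.1 + (absSum D.2.1 + absSum D.2.2) := by
  rw [← add_assoc]
  exact (abs_add_le _ _).trans (add_le_add ((abs_add_le _ _).trans (add_le_add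
    (abs_energy_le hb₁.abs_le _ _) (abs_energy_le hb₂.abs_le _ _)))
    (abs_energy_le hb₃.abs_le _ _))

theorem measurable_gibbs {Θ : Type*} [MeasurableSpace Θ] {W f : Θ → A → ℝ}
    (hW : ∀ a, Measurable fun θ => W θ a) (hf : ∀ a, Measurable fun θ => f θ a) :
    Measurable fun θ => gibbs (W θ) (f θ) :=
  (Measurable.tsum fun a => (hW a).mul (hf a)).div (Measurable.tsum hW)

theorem measurable_logAvg {Θ : Type*} [MeasurableSpace Θ] (β : ℝ) {W E : Θ → A → ℝ}
    (hW : ∀ a, Measurable fun θ => W θ a) (hE : ∀ a, Measurable fun θ => E θ a) :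
    Measurable fun θ => logAvg β (W θ) (E θ) :=
  (measurable_gibbs hW fun a => ((hE a).const_mul (-β)).exp).log

theorem measurable_tripleWeight (hw : ∀ a, Measurable fun ω => w ω a) (hb₁ : IsSpinField b₁)
    (hb₂ : IsSpinField b₂) (hb₃ : IsSpinField b₃) (a : A) :
    Measurable fun z => tripleWeight β w b₁ b₂ b₃ z a :=
  ((hw a).comp measurable_fst).mul
    ((((measurable_totalEnergy hb₁ hb₂ hb₃ a).comp measurable_snd).const_mul (-β)).exp)

theorem isWeight_tripleWeight (hβ : 0 ≤ β) (hb₁ : IsSpinField b₁) (hb₂ : IsSpinField b₂)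
    (hb₃ : IsSpinField b₃) {z : Ω × Sample B₁ × Sample B₂ × Sample B₃} (hz : IsWeight (w z.1)) :
    IsWeight (tripleWeight β w b₁ b₂ b₃ z) :=
  hz.tilt hβ (abs_totalEnergy_le hb₁ hb₂ hb₃ z.2)

/-- Only normalized averages enter, so the size of the weights drops out: the constant part of the
bound is 0 and no moment of the weights is required. -/
theorem linearGrowth_tripleLog (hβ : 0 ≤ β) (hw : ∀ a, Measurable fun ω => w ω a)
    (hw' : ∀ᵐ ω ∂ρ, IsWeight (w ω)) (hb₁ : IsSpinField b₁) (hb₂ : IsSpinField b₂)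
    (hb₃ : IsSpinField b₃) : LinearGrowth ρ (tripleLog β w b₁ b₂ b₃) := by
  refine ⟨measurable_logAvg β (fun a => (hw a).comp measurable_fst)
    fun a => (measurable_totalEnergy hb₁ hb₂ hb₃ a).comp measurable_snd,
    fun _ => 0, β, integrable_zero _ _ _, hβ, ?_⟩
  filter_upwards [hw'] with ω hω
  refine ⟨le_rfl, fun D₁ D₂ D₃ => ?_⟩
  rw [zero_add]
  exact hω.abs_logAvg_le hβ (abs_totalEnergy_le hb₁ hb₂ hb₃ (D₁, D₂, D₃))

/-- The functional `Y` stands for the log-average with one more bond of the family `b`. The mean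
increment is `𝔼 log cosh (βJ)` minus the series in the even moments of the Gibbs average of `b`. It
is applied with `b` equal to each of the three families. -/
theorem hasSum_integral_addBond {B : Type} [MeasurableSpace B] {ν : Measure B}
    [IsProbabilityMeasure ν] {b : B → A → ℝ} (hb : IsSpinField b)
    (hsymm : μ.map (fun x => -x) = μ) (hμ : Integrable (fun x : ℝ => x) μ) (hβ : 0 ≤ β)
    (hw : ∀ a, Measurable fun ω => w ω a) (hw' : ∀ᵐ ω ∂ρ, IsWeight (w ω))
    (hb₁ : IsSpinField b₁) (hb₂ : IsSpinField b₂) (hb₃ : IsSpinField b₃) {ζ₁ ζ₂ ζ₃ : ℝ}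
    (h₁ : 0 ≤ ζ₁) (h₂ : 0 ≤ ζ₂) (h₃ : 0 ≤ ζ₃)
    {Y : (Ω × (ℝ × B)) × Sample B₁ × Sample B₂ × Sample B₃ → ℝ}
    (hY : ∀ z, IsWeight (w z.1.1) → Y z = tripleLog β w b₁ b₂ b₃ (z.1.1, z.2) +
      Real.log (Real.cosh (β * z.1.2.1) +
        gibbs (tripleWeight β w b₁ b₂ b₃ (z.1.1, z.2)) (b z.1.2.2) * Real.sinh (β * z.1.2.1))) :
    HasSum (fun n => tanhCoef μ β n * ∫ z, (∫ p, gibbs (tripleWeight β w b₁ b₂ b₃ z) (b p) ^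
        (2 * (n + 1)) ∂ν) ∂(tripleLaw ρ μ ν₁ ν₂ ν₃ ζ₁ ζ₂ ζ₃))
      (∫ J, Real.log (Real.cosh (β * J)) ∂μ -
        (∫ z, Y z ∂(tripleLaw (ρ.prod (μ.prod ν)) μ ν₁ ν₂ ν₃ ζ₁ ζ₂ ζ₃) -
          ∫ z, tripleLog β w b₁ b₂ b₃ z ∂(tripleLaw ρ μ ν₁ ν₂ ν₃ ζ₁ ζ₂ ζ₃))) := by
  set T := tripleLaw ρ μ ν₁ ν₂ ν₃ ζ₁ ζ₂ ζ₃ with hT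
  have hg := linearGrowth_tripleLog hβ hw hw' hb₁ hb₂ hb₃
  have hgi : Integrable (tripleLog β w b₁ b₂ b₃) T := hg.integrable hμ h₁ h₂ h₃
  -- The new coupling is moved to the last place, where it is independent of everything on which the
  -- magnetization `m` depends.
  have hmp : MeasurePreserving
      (fun z : (Ω × (ℝ × B)) × Sample B₁ × Sample B₂ × Sample B₃ =>
        (((z.1.1, z.2), z.1.2.2), z.1.2.1))
      (tripleLaw (ρ.prod (μ.prod ν)) μ ν₁ ν₂ ν₃ ζ₁ ζ₂ ζ₃) ((T.prod ν).prod μ) :=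
    (measurePreserving_prodAssoc_symm_fun T ν μ).comp
      (((MeasurePreserving.id T).prod (Measure.measurePreserving_swap (μ := μ) (ν := ν))).comp
        (measurePreserving_rightComm ρ (μ.prod ν) _))
  set m : (Ω × Sample B₁ × Sample B₂ × Sample B₃) × B → ℝ :=
    fun q => gibbs (tripleWeight β w b₁ b₂ b₃ q.1) (b q.2) with hm
  have hm_meas : Measurable m :=
    measurable_gibbs (fun a => (measurable_tripleWeight hw hb₁ hb₂ hb₃ a).comp measurable_fst)
      fun a => (hb.measurable a).comp measurable_snd
  have hwT : ∀ᵐ z ∂T, IsWeight (w z.1) := Measure.quasiMeasurePreserving_fst.ae hw'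
  have hm1 : ∀ᵐ q ∂(T.prod ν), |m q| ≤ 1 := by
    filter_upwards [Measure.quasiMeasurePreserving_fst.ae hwT] with q hq
    exact (isWeight_tripleWeight hβ hb₁ hb₂ hb₃ hq).abs_gibbs_le (hb.abs_le q.2)
  have hlog_meas : Measurable fun q : ((Ω × Sample B₁ × Sample B₂ × Sample B₃) × B) × ℝ =>
      Real.log (Real.cosh (β * q.2) + m q.1 * Real.sinh (β * q.2)) := by fun_prop
  have hlog : Integrable (fun q : ((Ω × Sample B₁ × Sample B₂ × Sample B₃) × B) × ℝ =>
      Real.log (Real.cosh (β * q.2) + m q.1 * Real.sinh (β * q.2))) ((T.prod ν).prod μ) := by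
    refine (((hμ.const_mul β).abs).comp_snd _).mono' hlog_meas.aestronglyMeasurable ?_
    filter_upwards [Measure.quasiMeasurePreserving_fst.ae hm1] with q hq
    exact abs_log_cosh_add_le hq _
  have hYeq : ∫ z, Y z ∂(tripleLaw (ρ.prod (μ.prod ν)) μ ν₁ ν₂ ν₃ ζ₁ ζ₂ ζ₃) =
      ∫ z, tripleLog β w b₁ b₂ b₃ z ∂T + ∫ q, Real.log (Real.cosh (β * q.2) +
        m q.1 * Real.sinh (β * q.2)) ∂((T.prod ν).prod μ) := by
    have e : ∫ z, Y z ∂(tripleLaw (ρ.prod (μ.prod ν)) μ ν₁ ν₂ ν₃ ζ₁ ζ₂ ζ₃) =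
        ∫ q, (tripleLog β w b₁ b₂ b₃ q.1.1 + Real.log (Real.cosh (β * q.2) +
          m q.1 * Real.sinh (β * q.2))) ∂((T.prod ν).prod μ) := by
      have hmeas : Measurable fun q : ((Ω × Sample B₁ × Sample B₂ × Sample B₃) × B) × ℝ =>
          tripleLog β w b₁ b₂ b₃ q.1.1 + Real.log (Real.cosh (β * q.2) +
            m q.1 * Real.sinh (β * q.2)) :=
        (hg.1.comp (measurable_fst.comp measurable_fst)).add hlog_meas
      rw [← integral_comp_of_measurePreserving hmp hmeas.aestronglyMeasurable]
      refine integral_congr_ae ?_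
      have : ∀ᵐ z ∂(tripleLaw (ρ.prod (μ.prod ν)) μ ν₁ ν₂ ν₃ ζ₁ ζ₂ ζ₃), IsWeight (w z.1.1) :=
        Measure.quasiMeasurePreserving_fst.ae (Measure.quasiMeasurePreserving_fst.ae hw')
      filter_upwards [this] with z hz
      exact hY z hz
    rw [e, integral_add ((hgi.comp_fst ν).comp_fst μ) hlog,
      integral_fun_fst (fun q : (Ω × Sample B₁ × Sample B₂ × Sample B₃) × B =>
        tripleLog β w b₁ b₂ b₃ q.1), integral_fun_fst]
    simp
  rw [hYeq, add_sub_cancel_left]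
  refine (hasSum_tanhCoef_integral β hsymm hμ (T.prod ν) hm_meas hm1).congr_fun fun n => ?_
  rw [integral_prod]
  refine Integrable.of_bound (hm_meas.pow_const _).aestronglyMeasurable 1 ?_
  filter_upwards [hm1] with q hq
  rw [norm_pow]
  exact pow_le_one₀ (norm_nonneg _) hq

variable (β w b₁ b₂ b₃ ρ μ ν₁ ν₂ ν₃) in
/-- The expectation of the balance of the `n`-th moments of the Gibbs averages of the three
families of bonds, at time `t` of the exchange of their intensities. -/
def gapMean (a₁ a₂ t : ℝ) (n : ℕ) : ℝ :=
  ∫ z, (a₁ * ∫ p, gibbs (tripleWeight β w b₁ b₂ b₃ z) (b₁ p) ^ n ∂ν₁ +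
    a₂ * ∫ p, gibbs (tripleWeight β w b₁ b₂ b₃ z) (b₂ p) ^ n ∂ν₂ -
    (a₁ + a₂) * ∫ p, gibbs (tripleWeight β w b₁ b₂ b₃ z) (b₃ p) ^ n ∂ν₃)
    ∂(tripleLaw ρ μ ν₁ ν₂ ν₃ (t * a₁) (t * a₂) ((1 - t) * (a₁ + a₂)))

theorem integrable_integral_gibbs_pow {B : Type} [MeasurableSpace B] {ν : Measure B}
    [IsProbabilityMeasure ν] {b : B → A → ℝ} (hb : IsSpinField b) (hβ : 0 ≤ β)
    (hw : ∀ a, Measurable fun ω => w ω a) (hw' : ∀ᵐ ω ∂ρ, IsWeight (w ω))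
    (hb₁ : IsSpinField b₁) (hb₂ : IsSpinField b₂) (hb₃ : IsSpinField b₃) (ζ₁ ζ₂ ζ₃ : ℝ) (n : ℕ) :
    Integrable (fun z => ∫ p, gibbs (tripleWeight β w b₁ b₂ b₃ z) (b p) ^ n ∂ν)
      (tripleLaw ρ μ ν₁ ν₂ ν₃ ζ₁ ζ₂ ζ₃) := by
  refine Integrable.integral_prod_left (μ := tripleLaw ρ μ ν₁ ν₂ ν₃ ζ₁ ζ₂ ζ₃) (ν := ν)
    (f := fun q => gibbs (tripleWeight β w b₁ b₂ b₃ q.1) (b q.2) ^ n) ?_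
  refine Integrable.of_bound ((measurable_gibbs
    (fun a => (measurable_tripleWeight hw hb₁ hb₂ hb₃ a).comp measurable_fst)
      fun a => (hb.measurable a).comp measurable_snd).pow_const _).aestronglyMeasurable 1 ?_
  filter_upwards [Measure.quasiMeasurePreserving_fst.ae
    (Measure.quasiMeasurePreserving_fst.ae hw')] with q hq
  rw [norm_pow]
  exact pow_le_one₀ (norm_nonneg _)
    ((isWeight_tripleWeight hβ hb₁ hb₂ hb₃ hq).abs_gibbs_le (hb.abs_le q.2))

theorem integral_mul_add_mul_sub_mul {Θ : Type*} [MeasurableSpace Θ] {Λ : Measure Θ}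
    {f g h : Θ → ℝ} (hf : Integrable f Λ) (hg : Integrable g Λ) (hh : Integrable h Λ)
    (a b c : ℝ) : ∫ θ, (a * f θ + b * g θ - c * h θ) ∂Λ =
      a * ∫ θ, f θ ∂Λ + b * ∫ θ, g θ ∂Λ - c * ∫ θ, h θ ∂Λ := by
  have hfg : Integrable (fun θ => a * f θ + b * g θ) Λ := (hf.const_mul a).add (hg.const_mul b)
  rw [integral_sub hfg (hh.const_mul c), integral_add (hf.const_mul a) (hg.const_mul b),
    integral_const_mul, integral_const_mul, integral_const_mul]

/-- The three increments are combined with coefficients of sum zero. Hence the `log cosh` terms and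
the unperturbed log-averages cancel, and only the balance of the even moments remains. -/
theorem hasDerivWithinAt_tripleLog (hsymm : μ.map (fun x => -x) = μ)
    (hμ : Integrable (fun x : ℝ => x) μ) (hβ : 0 ≤ β) (hw : ∀ a, Measurable fun ω => w ω a)
    (hw' : ∀ᵐ ω ∂ρ, IsWeight (w ω)) (hb₁ : IsSpinField b₁) (hb₂ : IsSpinField b₂)
    (hb₃ : IsSpinField b₃) {a₁ a₂ : ℝ} (h₁ : 0 ≤ a₁) (h₂ : 0 ≤ a₂) {t : ℝ}
    (ht : t ∈ Set.Icc (0 : ℝ) 1) :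
    (Summable fun n => tanhCoef μ β n *
      gapMean β w b₁ b₂ b₃ ρ μ ν₁ ν₂ ν₃ a₁ a₂ t (2 * (n + 1))) ∧
    HasDerivWithinAt (fun t => ∫ z, tripleLog β w b₁ b₂ b₃ z
        ∂(tripleLaw ρ μ ν₁ ν₂ ν₃ (t * a₁) (t * a₂) ((1 - t) * (a₁ + a₂))))
      (-∑' n, tanhCoef μ β n * gapMean β w b₁ b₂ b₃ ρ μ ν₁ ν₂ ν₃ a₁ a₂ t (2 * (n + 1)))
      (Set.Icc 0 1) t := by
  have z₁ := mul_nonneg ht.1 h₁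
  have z₂ := mul_nonneg ht.1 h₂
  have z₃ := mul_nonneg (sub_nonneg.2 ht.2) (add_nonneg h₁ h₂)
  have hE : ∀ (z : Ω × Sample B₁ × Sample B₂ × Sample B₃) (a : A), |totalEnergy b₁ b₂ b₃ z.2 a| ≤ _ :=
    fun z a => abs_totalEnergy_le hb₁ hb₂ hb₃ z.2 a
  have s₁ := hasSum_integral_addBond (ν₁ := ν₁) (ν₂ := ν₂) (ν₃ := ν₃) (ν := ν₁) hb₁ hsymm hμ hβ hw
    hw' hb₁ hb₂ hb₃ z₁ z₂ z₃ (Y := addFst (tripleLog β w b₁ b₂ b₃)) fun z hz => by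
      refine Eq.trans ?_ (hz.logAvg_sub_bond hβ (hE (z.1.1, z.2)) z.1.2.1 (hb₁.eq_or z.1.2.2))
      refine congrArg (logAvg β _) (funext fun a => ?_)
      simp only [totalEnergy, energy_addBond]; ring
  have s₂ := hasSum_integral_addBond (ν₁ := ν₁) (ν₂ := ν₂) (ν₃ := ν₃) (ν := ν₂) hb₂ hsymm hμ hβ hw
    hw' hb₁ hb₂ hb₃ z₁ z₂ z₃ (Y := addSnd (tripleLog β w b₁ b₂ b₃)) fun z hz => by
      refine Eq.trans ?_ (hz.logAvg_sub_bond hβ (hE (z.1.1, z.2)) z.1.2.1 (hb₂.eq_or z.1.2.2))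
      refine congrArg (logAvg β _) (funext fun a => ?_)
      simp only [totalEnergy, energy_addBond]; ring
  have s₃ := hasSum_integral_addBond (ν₁ := ν₁) (ν₂ := ν₂) (ν₃ := ν₃) (ν := ν₃) hb₃ hsymm hμ hβ hw
    hw' hb₁ hb₂ hb₃ z₁ z₂ z₃ (Y := addTrd (tripleLog β w b₁ b₂ b₃)) fun z hz => by
      refine Eq.trans ?_ (hz.logAvg_sub_bond hβ (hE (z.1.1, z.2)) z.1.2.1 (hb₃.eq_or z.1.2.2))
      refine congrArg (logAvg β _) (funext fun a => ?_)
      simp only [totalEnergy, energy_addBond]; ring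
  have s := (((s₁.mul_left a₁).add (s₂.mul_left a₂)).sub (s₃.mul_left (a₁ + a₂))).congr_fun
    (g := fun n => tanhCoef μ β n *
      gapMean β w b₁ b₂ b₃ ρ μ ν₁ ν₂ ν₃ a₁ a₂ t (2 * (n + 1))) fun n => by
    have i₁ := integrable_integral_gibbs_pow (μ := μ) (ν₁ := ν₁) (ν₂ := ν₂) (ν₃ := ν₃) (ν := ν₁)
      hb₁ hβ hw hw' hb₁ hb₂ hb₃ (t * a₁) (t * a₂) ((1 - t) * (a₁ + a₂)) (2 * (n + 1))
    have i₂ := integrable_integral_gibbs_pow (μ := μ) (ν₁ := ν₁) (ν₂ := ν₂) (ν₃ := ν₃) (ν := ν₂)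
      hb₂ hβ hw hw' hb₁ hb₂ hb₃ (t * a₁) (t * a₂) ((1 - t) * (a₁ + a₂)) (2 * (n + 1))
    have i₃ := integrable_integral_gibbs_pow (μ := μ) (ν₁ := ν₁) (ν₂ := ν₂) (ν₃ := ν₃) (ν := ν₃)
      hb₃ hβ hw hw' hb₁ hb₂ hb₃ (t * a₁) (t * a₂) ((1 - t) * (a₁ + a₂)) (2 * (n + 1))
    rw [gapMean, integral_mul_add_mul_sub_mul i₁ i₂ i₃]
    ring
  refine ⟨s.summable, ?_⟩
  refine (hasDerivWithinAt_integral_tripleLaw ρ μ ν₁ ν₂ ν₃ hμ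
    (linearGrowth_tripleLog hβ hw hw' hb₁ hb₂ hb₃) h₁ h₂ ht).congr_deriv ?_
  rw [s.tsum_eq]
  ring

end Exchange

/-! ### End points of the exchange and the resulting comparison inequalities -/

section Endpoints

variable {Ω A B₁ B₂ B₃ : Type} [MeasurableSpace Ω] [MeasurableSpace B₁] [MeasurableSpace B₂]
  [MeasurableSpace B₃] [Countable A] {β : ℝ} {w : Ω → A → ℝ} {b₁ : B₁ → A → ℝ} {b₂ : B₂ → A → ℝ}
  {b₃ : B₃ → A → ℝ} {ρ : Measure Ω} {μ : Measure ℝ} {ν₁ : Measure B₁} {ν₂ : Measure B₂}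
  {ν₃ : Measure B₃} [IsProbabilityMeasure ρ] [IsProbabilityMeasure μ] [IsProbabilityMeasure ν₁]
  [IsProbabilityMeasure ν₂] [IsProbabilityMeasure ν₃]

theorem measurable_logAvg_energy (hw : ∀ a, Measurable fun ω => w ω a) (hb₁ : IsSpinField b₁) :
    Measurable fun z : Ω × Sample B₁ => logAvg β (w z.1) (energy b₁ z.2) :=
  measurable_logAvg β (fun a => (hw a).comp measurable_fst)
    fun a => (measurable_energy hb₁.measurable a).comp measurable_snd

theorem measurable_logAvg_energy_add (hw : ∀ a, Measurable fun ω => w ω a)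
    (hb₁ : IsSpinField b₁) (hb₂ : IsSpinField b₂) :
    Measurable fun z : Ω × Sample B₁ × Sample B₂ =>
      logAvg β (w z.1) (fun a => energy b₁ z.2.1 a + energy b₂ z.2.2 a) :=
  measurable_logAvg β (fun a => (hw a).comp measurable_fst)
    fun a => ((measurable_energy hb₁.measurable a).comp (measurable_fst.comp measurable_snd)).add
      ((measurable_energy hb₂.measurable a).comp (measurable_snd.comp measurable_snd))

theorem integrable_logAvg_energy (hμ : Integrable (fun x : ℝ => x) μ) (hβ : 0 ≤ β)
    (hw : ∀ a, Measurable fun ω => w ω a) (hw' : ∀ᵐ ω ∂ρ, IsWeight (w ω))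
    (hb₁ : IsSpinField b₁) {ζ : ℝ} (hζ : 0 ≤ ζ) :
    Integrable (fun z => logAvg β (w z.1) (energy b₁ z.2)) (ρ.prod (sampleLaw ζ μ ν₁)) ∧
      |∫ z, logAvg β (w z.1) (energy b₁ z.2) ∂(ρ.prod (sampleLaw ζ μ ν₁))| ≤
        β * (ζ * ∫ x, |x| ∂μ) := by
  obtain ⟨i, e⟩ := integrable_absSum μ ν₁ hμ hζ
  have hle : ∀ᵐ z ∂(ρ.prod (sampleLaw ζ μ ν₁)), ‖logAvg β (w z.1) (energy b₁ z.2)‖ ≤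
      β * absSum z.2 := by
    filter_upwards [Measure.quasiMeasurePreserving_fst.ae hw'] with z hz
    exact hz.abs_logAvg_le hβ (abs_energy_le hb₁.abs_le z.2)
  refine ⟨((i.comp_snd ρ).const_mul β).mono'
    (measurable_logAvg_energy hw hb₁).aestronglyMeasurable hle, ?_⟩
  refine (norm_integral_le_of_norm_le ((i.comp_snd ρ).const_mul β) hle).trans (le_of_eq ?_)
  rw [integral_const_mul, integral_fun_snd, e]
  simp

/-- A sample of intensity 0 is almost surely empty, so at `t = 0` only the third family is left. -/
theorem integral_tripleLog_zero (hw : ∀ a, Measurable fun ω => w ω a) (hb₃ : IsSpinField b₃)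
    (ζ : ℝ) :
    ∫ z, tripleLog β w b₁ b₂ b₃ z ∂(tripleLaw ρ μ ν₁ ν₂ ν₃ 0 0 ζ) =
      ∫ z, logAvg β (w z.1) (energy b₃ z.2) ∂(ρ.prod (sampleLaw ζ μ ν₃)) := by
  have hmp : MeasurePreserving
      (fun z : Ω × Sample B₁ × Sample B₂ × Sample B₃ => (z.1, z.2.2.2))
      (tripleLaw ρ μ ν₁ ν₂ ν₃ 0 0 ζ) (ρ.prod (sampleLaw ζ μ ν₃)) :=
    (MeasurePreserving.id ρ).prod (measurePreserving_snd.comp measurePreserving_snd)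
  rw [← integral_comp_of_measurePreserving hmp
    (measurable_logAvg_energy hw hb₃).aestronglyMeasurable]
  refine integral_congr_ae ?_
  have h₁ : ∀ᵐ z ∂(tripleLaw ρ μ ν₁ ν₂ ν₃ 0 0 ζ), z.2.1.1 = 0 :=
    Measure.quasiMeasurePreserving_snd.ae
      (Measure.quasiMeasurePreserving_fst.ae (ae_sampleLaw_zero μ ν₁))
  have h₂ : ∀ᵐ z ∂(tripleLaw ρ μ ν₁ ν₂ ν₃ 0 0 ζ), z.2.2.1.1 = 0 :=
    Measure.quasiMeasurePreserving_snd.ae (Measure.quasiMeasurePreserving_snd.ae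
      (Measure.quasiMeasurePreserving_fst.ae (ae_sampleLaw_zero μ ν₂)))
  filter_upwards [h₁, h₂] with z hz₁ hz₂
  refine congrArg (logAvg β _) (funext fun a => ?_)
  rw [totalEnergy, energy_of_fst_eq_zero b₁ hz₁, energy_of_fst_eq_zero b₂ hz₂, zero_add, zero_add]

theorem integral_tripleLog_one (hw : ∀ a, Measurable fun ω => w ω a) (hb₁ : IsSpinField b₁)
    (hb₂ : IsSpinField b₂) (ζ₁ ζ₂ : ℝ) :
    ∫ z, tripleLog β w b₁ b₂ b₃ z ∂(tripleLaw ρ μ ν₁ ν₂ ν₃ ζ₁ ζ₂ 0) =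
      ∫ z, logAvg β (w z.1) (fun a => energy b₁ z.2.1 a + energy b₂ z.2.2 a)
        ∂(ρ.prod ((sampleLaw ζ₁ μ ν₁).prod (sampleLaw ζ₂ μ ν₂))) := by
  have hmp : MeasurePreserving
      (fun z : Ω × Sample B₁ × Sample B₂ × Sample B₃ => (z.1, z.2.1, z.2.2.1))
      (tripleLaw ρ μ ν₁ ν₂ ν₃ ζ₁ ζ₂ 0)
      (ρ.prod ((sampleLaw ζ₁ μ ν₁).prod (sampleLaw ζ₂ μ ν₂))) :=
    (MeasurePreserving.id ρ).prod ((MeasurePreserving.id _).prod measurePreserving_fst)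
  rw [← integral_comp_of_measurePreserving hmp
    (measurable_logAvg_energy_add hw hb₁ hb₂).aestronglyMeasurable]
  refine integral_congr_ae ?_
  have h : ∀ᵐ z ∂(tripleLaw ρ μ ν₁ ν₂ ν₃ ζ₁ ζ₂ 0), z.2.2.2.1 = 0 :=
    Measure.quasiMeasurePreserving_snd.ae (Measure.quasiMeasurePreserving_snd.ae
      (Measure.quasiMeasurePreserving_snd.ae (ae_sampleLaw_zero μ ν₃)))
  filter_upwards [h] with z hz
  refine congrArg (logAvg β _) (funext fun a => ?_)
  rw [totalEnergy, energy_of_fst_eq_zero b₃ hz, add_zero]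

theorem gapMean_nonneg (hβ : 0 ≤ β) (hw' : ∀ᵐ ω ∂ρ, IsWeight (w ω)) (hb₁ : IsSpinField b₁)
    (hb₂ : IsSpinField b₂) (hb₃ : IsSpinField b₃) {a₁ a₂ : ℝ} (t : ℝ) {n : ℕ}
    (h : ∀ x : Fin n → A, 0 ≤ a₁ * ∫ p, ∏ i, b₁ p (x i) ∂ν₁ + a₂ * ∫ p, ∏ i, b₂ p (x i) ∂ν₂ -
      (a₁ + a₂) * ∫ p, ∏ i, b₃ p (x i) ∂ν₃) :
    0 ≤ gapMean β w b₁ b₂ b₃ ρ μ ν₁ ν₂ ν₃ a₁ a₂ t n := by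
  refine integral_nonneg_of_ae ?_
  filter_upwards [Measure.quasiMeasurePreserving_fst.ae hw'] with z hz
  have := (isWeight_tripleWeight hβ hb₁ hb₂ hb₃ hz).sum_integral_gibbs_pow_nonneg hb₁ hb₂ hb₃
    ν₁ ν₂ ν₃ a₁ a₂ (-(a₁ + a₂)) (n := n) fun x => by linarith [h x]
  simp only [Pi.zero_apply]
  linarith

theorem gapMean_nonpos (hβ : 0 ≤ β) (hw' : ∀ᵐ ω ∂ρ, IsWeight (w ω)) (hb₁ : IsSpinField b₁)
    (hb₂ : IsSpinField b₂) (hb₃ : IsSpinField b₃) {a₁ a₂ : ℝ} (t : ℝ) {n : ℕ}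
    (h : ∀ x : Fin n → A, a₁ * ∫ p, ∏ i, b₁ p (x i) ∂ν₁ + a₂ * ∫ p, ∏ i, b₂ p (x i) ∂ν₂ -
      (a₁ + a₂) * ∫ p, ∏ i, b₃ p (x i) ∂ν₃ ≤ 0) :
    gapMean β w b₁ b₂ b₃ ρ μ ν₁ ν₂ ν₃ a₁ a₂ t n ≤ 0 := by
  refine integral_nonpos_of_ae ?_
  filter_upwards [Measure.quasiMeasurePreserving_fst.ae hw'] with z hz
  have := (isWeight_tripleWeight hβ hb₁ hb₂ hb₃ hz).sum_integral_gibbs_pow_nonneg hb₁ hb₂ hb₃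
    ν₁ ν₂ ν₃ (-a₁) (-a₂) (a₁ + a₂) (n := n) fun x => by linarith [h x]
  simp only [Pi.zero_apply]
  linarith

/-- Exchanging two diluted Hamiltonians against a third one decreases the pressure as soon as the
replica moments of the bonds have a non-negative balance. -/
theorem integral_logAvg_exchange_le (hsymm : μ.map (fun x => -x) = μ)
    (hμ : Integrable (fun x : ℝ => x) μ) (hβ : 0 ≤ β) (hw : ∀ a, Measurable fun ω => w ω a)
    (hw' : ∀ᵐ ω ∂ρ, IsWeight (w ω)) (hb₁ : IsSpinField b₁) (hb₂ : IsSpinField b₂)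
    (hb₃ : IsSpinField b₃) {a₁ a₂ : ℝ} (h₁ : 0 ≤ a₁) (h₂ : 0 ≤ a₂)
    (h : ∀ n, ∀ x : Fin (2 * (n + 1)) → A, 0 ≤ a₁ * ∫ p, ∏ i, b₁ p (x i) ∂ν₁ +
      a₂ * ∫ p, ∏ i, b₂ p (x i) ∂ν₂ - (a₁ + a₂) * ∫ p, ∏ i, b₃ p (x i) ∂ν₃) :
    ∫ z, logAvg β (w z.1) (fun a => energy b₁ z.2.1 a + energy b₂ z.2.2 a)
        ∂(ρ.prod ((sampleLaw a₁ μ ν₁).prod (sampleLaw a₂ μ ν₂))) ≤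
      ∫ z, logAvg β (w z.1) (energy b₃ z.2) ∂(ρ.prod (sampleLaw (a₁ + a₂) μ ν₃)) := by
  have hd := fun t ht => (hasDerivWithinAt_tripleLog (ν₁ := ν₁) (ν₂ := ν₂) (ν₃ := ν₃) hsymm hμ hβ
    hw hw' hb₁ hb₂ hb₃ h₁ h₂ (t := t) ht).2
  have hanti := antitoneOn_of_hasDerivWithinAt_nonpos (convex_Icc (0 : ℝ) 1)
    (fun t ht => (hd t ht).continuousWithinAt)
    (fun t ht => (hd t (interior_subset ht)).mono interior_subset) fun t _ => by
      rw [neg_nonpos]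
      exact tsum_nonneg fun n => mul_nonneg (tanhCoef_nonneg μ β n)
        (gapMean_nonneg hβ hw' hb₁ hb₂ hb₃ t (h n))
  have := hanti (Set.left_mem_Icc.2 zero_le_one) (Set.right_mem_Icc.2 zero_le_one) zero_le_one
  simp only [zero_mul, one_mul, sub_self, sub_zero] at this
  rwa [integral_tripleLog_zero hw hb₃, integral_tripleLog_one hw hb₁ hb₂] at this

/-- The same monotonicity argument with the opposite sign. When the balance vanishes identically,
the two inequalities together give equality, which replaces a proof that Poisson samples can be
split or merged. -/
theorem le_integral_logAvg_exchange (hsymm : μ.map (fun x => -x) = μ)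
    (hμ : Integrable (fun x : ℝ => x) μ) (hβ : 0 ≤ β) (hw : ∀ a, Measurable fun ω => w ω a)
    (hw' : ∀ᵐ ω ∂ρ, IsWeight (w ω)) (hb₁ : IsSpinField b₁) (hb₂ : IsSpinField b₂)
    (hb₃ : IsSpinField b₃) {a₁ a₂ : ℝ} (h₁ : 0 ≤ a₁) (h₂ : 0 ≤ a₂)
    (h : ∀ n, ∀ x : Fin (2 * (n + 1)) → A, a₁ * ∫ p, ∏ i, b₁ p (x i) ∂ν₁ +
      a₂ * ∫ p, ∏ i, b₂ p (x i) ∂ν₂ - (a₁ + a₂) * ∫ p, ∏ i, b₃ p (x i) ∂ν₃ ≤ 0) :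
    ∫ z, logAvg β (w z.1) (energy b₃ z.2) ∂(ρ.prod (sampleLaw (a₁ + a₂) μ ν₃)) ≤
      ∫ z, logAvg β (w z.1) (fun a => energy b₁ z.2.1 a + energy b₂ z.2.2 a)
        ∂(ρ.prod ((sampleLaw a₁ μ ν₁).prod (sampleLaw a₂ μ ν₂))) := by
  have hd := fun t ht => (hasDerivWithinAt_tripleLog (ν₁ := ν₁) (ν₂ := ν₂) (ν₃ := ν₃) hsymm hμ hβ
    hw hw' hb₁ hb₂ hb₃ h₁ h₂ (t := t) ht).2
  have hmono := monotoneOn_of_hasDerivWithinAt_nonneg (convex_Icc (0 : ℝ) 1)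
    (fun t ht => (hd t ht).continuousWithinAt)
    (fun t ht => (hd t (interior_subset ht)).mono interior_subset) fun t _ => by
      rw [neg_nonneg]
      exact tsum_nonpos fun n => mul_nonpos_of_nonneg_of_nonpos (tanhCoef_nonneg μ β n)
        (gapMean_nonpos hβ hw' hb₁ hb₂ hb₃ t (h n))
  have := hmono (Set.left_mem_Icc.2 zero_le_one) (Set.right_mem_Icc.2 zero_le_one) zero_le_one
  simp only [zero_mul, one_mul, sub_self, sub_zero] at this
  rwa [integral_tripleLog_zero hw hb₃, integral_tripleLog_one hw hb₁ hb₂] at this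

end Endpoints

/-! ### Product weights -/

section Product

variable {S T : Type}

theorem IsWeight.prod {u : S → ℝ} {v : T → ℝ} (hu : IsWeight u) (hv : IsWeight v) :
    IsWeight (fun x : S × T => u x.1 * v x.2) ∧
      ∑' x : S × T, u x.1 * v x.2 = (∑' s, u s) * ∑' t, v t := by
  have hn : ∑' x : S × T, u x.1 * v x.2 = (∑' s, u s) * ∑' t, v t :=
    (tsum_mul_tsum_of_summable_norm hu.summable.norm hv.summable.norm).symm
  refine ⟨⟨fun x => mul_nonneg (hu.nonneg _) (hv.nonneg _),
    summable_mul_of_summable_norm hu.summable.norm hv.summable.norm, ?_⟩, hn⟩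
  rw [hn]
  exact mul_pos hu.sum_pos hv.sum_pos

theorem IsWeight.logAvg_prod {u : S → ℝ} {v : T → ℝ} (hu : IsWeight u) (hv : IsWeight v) {β : ℝ}
    (hβ : 0 ≤ β) {E : S → ℝ} {F : T → ℝ} {C C' : ℝ} (hE : ∀ s, |E s| ≤ C) (hF : ∀ t, |F t| ≤ C') :
    logAvg β (fun x : S × T => u x.1 * v x.2) (fun x => F x.2 + E x.1) =
      logAvg β v F + logAvg β u E := by
  have hEF : ∀ x : S × T, |F x.2 + E x.1| ≤ C' + C := fun x =>
    (abs_add_le _ _).trans (add_le_add (hF _) (hE _))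
  have hu' := hu.tilt hβ hE
  have hv' := hv.tilt hβ hF
  rw [(hu.prod hv).1.logAvg_eq_sub hβ hEF, hu.logAvg_eq_sub hβ hE, hv.logAvg_eq_sub hβ hF,
    (hu.prod hv).2, Real.log_mul hu.sum_pos.ne' hv.sum_pos.ne']
  have e : ∀ x : S × T, u x.1 * v x.2 * Real.exp (-β * (F x.2 + E x.1)) =
      (u x.1 * Real.exp (-β * E x.1)) * (v x.2 * Real.exp (-β * F x.2)) := fun x => by
    rw [mul_add, Real.exp_add]; ring
  simp_rw [e]
  rw [(hu'.prod hv').2, Real.log_mul hu'.sum_pos.ne' hv'.sum_pos.ne']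
  ring

end Product

/-! ### Uniformly distributed sites -/

section Sites

instance isProbabilityMeasure_uniformOn_fin (K : ℕ) [NeZero K] :
    IsProbabilityMeasure (uniformOn (Set.univ : Set (Fin K))) :=
  isProbabilityMeasure_uniformOn Set.finite_univ Set.univ_nonempty

instance isProbabilityMeasure_sitesLaw (K L : ℕ) [NeZero K] [NeZero L] :
    IsProbabilityMeasure (sitesLaw K L) := by unfold sitesLaw; infer_instance

theorem integral_uniformOn_fin {K : ℕ} [NeZero K] (f : Fin K → ℝ) :
    ∫ i, f i ∂(uniformOn (Set.univ : Set (Fin K))) = (1 / (K : ℝ)) * ∑ i, f i := by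
  rw [integral_fintype Integrable.of_finite, Finset.mul_sum]
  refine Finset.sum_congr rfl fun i _ => ?_
  rw [measureReal_def, uniformOn_univ, Measure.count_singleton]
  simp

theorem measurable_spin : Measurable spin :=
  measurable_from_top.comp ((comap_measurable (Units.val : ℤˣ → ℤ)).mono le_rfl le_top)

theorem spin_eq_or (s : ℤˣ) : spin s = 1 ∨ spin s = -1 := by
  rcases Int.units_eq_one_or s with h | h <;> simp [spin, h]

theorem mul_eq_one_or {x y : ℝ} (hx : x = 1 ∨ x = -1) (hy : y = 1 ∨ y = -1) :
    x * y = 1 ∨ x * y = -1 := by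
  rcases hx with rfl | rfl <;> rcases hy with rfl | rfl <;> simp

theorem integral_prod_spin {K : ℕ} [NeZero K] {n : ℕ} (x : Fin n → Conf K) :
    ∫ i, ∏ a, spin (x a i) ∂(uniformOn (Set.univ : Set (Fin K))) = multiOverlap x :=
  integral_uniformOn_fin _

theorem integral_prod_spin_mul_spin {K L : ℕ} [NeZero K] [NeZero L] {n : ℕ}
    (x : Fin n → Conf K) (y : Fin n → Conf L) :
    ∫ p, ∏ a, spin (x a p.1) * spin (y a p.2) ∂(sitesLaw K L) =
      multiOverlap x * multiOverlap y := by
  simp_rw [Finset.prod_mul_distrib]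
  rw [sitesLaw, integral_prod_mul (fun i => ∏ a, spin (x a i)) fun j => ∏ a, spin (y a j),
    integral_prod_spin, integral_prod_spin]

end Sites

/-! ### Interpolation with a general cavity -/

section Cavity

variable {S K E : Type} {M : ℕ}

/-- The bonds of the Hamiltonian of the system. -/
def pairBond (M : ℕ) (p : Fin M × Fin M) (σ : Conf M) : ℝ := spin (σ p.1) * spin (σ p.2)

/-- The bonds between the cavity and the system. -/
def etaBond (bE : E → S → ℝ) (p : E × Fin M) (x : S × Conf M) : ℝ :=
  bE p.1 x.1 * spin (x.2 p.2)

/-- The weights of the external field. -/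
def extWeight (β h : ℝ) (σ : Conf M) : ℝ := Real.exp (-β * extEnergy h σ)

theorem isWeight_extWeight (β h : ℝ) : IsWeight (extWeight β h : Conf M → ℝ) := by
  refine ⟨fun σ => (Real.exp_pos _).le, Summable.of_finite, ?_⟩
  rw [tsum_fintype]
  exact Finset.sum_pos (fun σ _ => Real.exp_pos _) Finset.univ_nonempty

theorem isSpinField_pairBond (M : ℕ) : IsSpinField (pairBond M) :=
  ⟨fun _ => .of_discrete, fun _ _ => mul_eq_one_or (spin_eq_or _) (spin_eq_or _)⟩

variable [MeasurableSpace K] [MeasurableSpace E]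

theorem IsSpinField.comp_fst {b : K → S → ℝ} (hb : IsSpinField b) (T : Type) :
    IsSpinField fun p (x : S × T) => b p x.1 :=
  ⟨fun x => hb.measurable x.1, fun p x => hb.eq_or p x.1⟩

theorem IsSpinField.comp_snd {b : K → S → ℝ} (hb : IsSpinField b) (T : Type) :
    IsSpinField fun p (x : T × S) => b p x.2 :=
  ⟨fun x => hb.measurable x.2, fun p x => hb.eq_or p x.2⟩

theorem IsSpinField.etaBond {bE : E → S → ℝ} (hb : IsSpinField bE) :
    IsSpinField (etaBond bE : E × Fin M → S × Conf M → ℝ) :=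
  ⟨fun x => ((hb.measurable x.1).comp measurable_fst).mul
    ((Measurable.of_discrete (f := fun j => spin (x.2 j))).comp measurable_snd),
    fun _ _ => mul_eq_one_or (hb.eq_or _ _) (spin_eq_or _)⟩

variable (νE : Measure E) [IsProbabilityMeasure νE] [NeZero M]

theorem integral_prod_etaBond (bE : E → S → ℝ) {n : ℕ} (x : Fin n → S × Conf M) :
    ∫ p, ∏ i, etaBond bE p (x i) ∂(νE.prod (uniformOn (Set.univ : Set (Fin M)))) =
      (∫ p, ∏ i, bE p (x i).1 ∂νE) * multiOverlap fun a => (x a).2 := by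
  simp_rw [VianaBray.etaBond, Finset.prod_mul_distrib]
  rw [integral_prod_mul (fun i => ∏ a, bE i (x a).1) fun j => ∏ a, spin ((x a).2 j)]
  congr 1
  exact integral_prod_spin fun a => (x a).2

/-- The source of positivity: the three families contribute `q̃²`, `q²` and `-2 q q̃`. The
hypothesis `hmom` is the only link required between the bonds of `κ` and those of `η`. -/
theorem interp_balance {bK : K → S → ℝ} {bE : E → S → ℝ} {νK : Measure K} (a : ℝ) {n : ℕ}
    (hmom : ∀ x : Fin n → S, ∫ p, ∏ i, bK p (x i) ∂νK = (∫ p, ∏ i, bE p (x i) ∂νE) ^ 2)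
    (x : Fin n → S × Conf M) :
    a * ∫ p, ∏ i, pairBond M p (x i).2 ∂(sitesLaw M M) + a * ∫ p, ∏ i, bK p (x i).1 ∂νK -
      (a + a) * ∫ p, ∏ i, etaBond bE p (x i) ∂(νE.prod (uniformOn (Set.univ : Set (Fin M)))) =
    a * ((∫ p, ∏ i, bE p (x i).1 ∂νE) - multiOverlap fun a => (x a).2) ^ 2 := by
  rw [integral_prod_etaBond, hmom fun i => (x i).1]
  simp only [pairBond]
  rw [integral_prod_spin_mul_spin (fun i => (x i).2) fun i => (x i).2]
  ring

end Cavity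

attribute [instance] RandomWeights.isProbabilityMeasure
attribute [instance] RaMOSt.Fields.isProbabilityMeasure_kappa
attribute [instance] RaMOSt.Fields.isProbabilityMeasure_eta
attribute [instance] RaMOSt.countable

theorem RandomWeights.ae_isWeight {S : Type} (ξ : RandomWeights S) :
    ∀ᵐ w ∂ξ.law, IsWeight w := by
  filter_upwards [ξ.nonneg, ξ.summable, ξ.sum_pos] with w h₁ h₂ h₃
  exact ⟨h₁, h₂, h₃⟩

/-! ### The trial function of a general cavity -/

section Cavity

variable {S K E : Type} {M : ℕ} [Countable S] [MeasurableSpace K] [MeasurableSpace E]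

/-- Random weights on the cavity times the weights of the external field. -/
def cavityWeight (β h : ℝ) (w : S → ℝ) (x : S × Conf M) : ℝ := w x.1 * extWeight β h x.2

/-- The partition function of the external field. -/
def extPartition (β h : ℝ) (M : ℕ) : ℝ := ∑ σ : Conf M, extWeight β h σ

/-- The logarithm of the ratio that defines the trial function of a general cavity. -/
def cavityLog (β h : ℝ) (bE : E → S → ℝ) (bK : K → S → ℝ)
    (D : (S → ℝ) × Sample (E × Fin M) × Sample K) : ℝ :=
  Real.log ((∑' γ : S, ∑ σ : Conf M,
      D.1 γ * Real.exp (-β * (energy (etaBond bE) D.2.1 (γ, σ) + extEnergy h σ))) /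
    ∑' γ : S, D.1 γ * Real.exp (-β * energy bK D.2.2 γ))

/-- The expected logarithm of the average of `e^{-βη}`. -/
def etaMean (μ : Measure ℝ) (β h ζ : ℝ) (M : ℕ) (ξ : RandomWeights S) (bE : E → S → ℝ)
    (νE : Measure E) : ℝ :=
  ∫ z, logAvg β (cavityWeight β h z.1) (energy (etaBond bE) z.2)
    ∂(ξ.law.prod (sampleLaw ζ μ (νE.prod (uniformOn (Set.univ : Set (Fin M))))))

/-- The expected logarithm of the average of `e^{-βκ}`. -/
def kappaMean (μ : Measure ℝ) (β ζ : ℝ) (ξ : RandomWeights S) (bK : K → S → ℝ)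
    (νK : Measure K) : ℝ :=
  ∫ z, logAvg β z.1 (energy bK z.2) ∂(ξ.law.prod (sampleLaw ζ μ νK))

/-- The expected logarithm of the average of `e^{-βH}` for the diluted Hamiltonian `H`. -/
def hamMean (μ : Measure ℝ) (β h ζ : ℝ) (M : ℕ) : ℝ :=
  ∫ D, logAvg β (extWeight β h) (energy (pairBond M) D) ∂(sampleLaw ζ μ (sitesLaw M M))

theorem isWeight_cavityWeight (β h : ℝ) {w : S → ℝ} (hw : IsWeight w) :
    IsWeight (cavityWeight β h w : S × Conf M → ℝ) ∧
      ∑' x : S × Conf M, cavityWeight β h w x = (∑' s, w s) * extPartition β h M := by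
  have := hw.prod (isWeight_extWeight (M := M) β h)
  rw [tsum_fintype (extWeight β h)] at this
  exact this

theorem extPartition_pos (β h : ℝ) (M : ℕ) : 0 < extPartition β h M :=
  Finset.sum_pos (fun _ _ => Real.exp_pos _) Finset.univ_nonempty

theorem measurable_cavityWeight (β h : ℝ) (x : S × Conf M) :
    Measurable fun w : S → ℝ => cavityWeight β h w x :=
  (measurable_pi_apply x.1).mul_const _

/-- Numerator and denominator are both divided by the total weight `∑ w`. The quotient then
separates into normalized log-averages, each integrable by itself even if `log ∑ w` is not. -/
theorem IsWeight.log_trial {w : S → ℝ} (hw : IsWeight w) {β : ℝ} (hβ : 0 ≤ β) (h : ℝ)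
    {F : S × Conf M → ℝ} {G : S → ℝ} {C C' : ℝ} (hF : ∀ x, |F x| ≤ C) (hG : ∀ s, |G s| ≤ C') :
    Real.log ((∑' γ : S, ∑ σ : Conf M, w γ * Real.exp (-β * (F (γ, σ) + extEnergy h σ))) /
      ∑' γ : S, w γ * Real.exp (-β * G γ)) =
    logAvg β (cavityWeight β h w) F + Real.log (extPartition β h M) - logAvg β w G := by
  obtain ⟨hc, hs⟩ := isWeight_cavityWeight (M := M) β h hw
  have e : ∑' γ : S, ∑ σ : Conf M, w γ * Real.exp (-β * (F (γ, σ) + extEnergy h σ)) =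
      ∑' x : S × Conf M, cavityWeight β h w x * Real.exp (-β * F x) := by
    rw [(hc.tilt hβ hF).summable.tsum_prod]
    refine tsum_congr fun γ => ?_
    rw [tsum_fintype]
    refine Finset.sum_congr rfl fun σ _ => ?_
    rw [mul_add, Real.exp_add, cavityWeight, extWeight]; ring
  rw [e, Real.log_div (hc.tilt hβ hF).sum_pos.ne' (hw.tilt hβ hG).sum_pos.ne',
    hc.logAvg_eq_sub hβ hF, hw.logAvg_eq_sub hβ hG, hs,
    Real.log_mul hw.sum_pos.ne' (extPartition_pos β h M).ne']
  ring

variable {μ : Measure ℝ} [IsProbabilityMeasure μ] {β : ℝ} {bE : E → S → ℝ} {bK : K → S → ℝ}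
  {νE : Measure E} {νK : Measure K} [IsProbabilityMeasure νE] [IsProbabilityMeasure νK] [NeZero M]

theorem ae_isWeight_cavityWeight (β h : ℝ) (ξ : RandomWeights S) :
    ∀ᵐ w ∂ξ.law, IsWeight (cavityWeight β h w : S × Conf M → ℝ) :=
  ξ.ae_isWeight.mono fun _ hw => (isWeight_cavityWeight β h hw).1

theorem integral_cavityLog (hμ : Integrable (fun x : ℝ => x) μ) (hβ : 0 ≤ β) (h : ℝ)
    (ξ : RandomWeights S) (hE : IsSpinField bE) (hK : IsSpinField bK) {ζ₁ ζ₂ : ℝ} (h₁ : 0 ≤ ζ₁)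
    (h₂ : 0 ≤ ζ₂) :
    Integrable (cavityLog (M := M) β h bE bK)
      (ξ.law.prod ((sampleLaw ζ₁ μ (νE.prod (uniformOn (Set.univ : Set (Fin M))))).prod
        (sampleLaw ζ₂ μ νK))) ∧
    ∫ D, cavityLog (M := M) β h bE bK D
      ∂(ξ.law.prod ((sampleLaw ζ₁ μ (νE.prod (uniformOn (Set.univ : Set (Fin M))))).prod
        (sampleLaw ζ₂ μ νK))) =
      etaMean μ β h ζ₁ M ξ bE νE + Real.log (extPartition β h M) - kappaMean μ β ζ₂ ξ bK νK := by
  set Lη := sampleLaw ζ₁ μ (νE.prod (uniformOn (Set.univ : Set (Fin M))))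
  set Lκ := sampleLaw ζ₂ μ νK
  have hη := (integrable_logAvg_energy (ν₁ := νE.prod (uniformOn (Set.univ : Set (Fin M)))) hμ hβ
    (measurable_cavityWeight β h) (ae_isWeight_cavityWeight (M := M) β h ξ) hE.etaBond h₁).1
  have hκ := (integrable_logAvg_energy (ν₁ := νK) hμ hβ
    (fun s : S => measurable_pi_apply s) ξ.ae_isWeight hK h₂).1
  have m₁ : MeasurePreserving (fun z : (S → ℝ) × Sample (E × Fin M) × Sample K => (z.1, z.2.1))
      (ξ.law.prod (Lη.prod Lκ)) (ξ.law.prod Lη) :=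
    (MeasurePreserving.id _).prod measurePreserving_fst
  have m₂ : MeasurePreserving (fun z : (S → ℝ) × Sample (E × Fin M) × Sample K => (z.1, z.2.2))
      (ξ.law.prod (Lη.prod Lκ)) (ξ.law.prod Lκ) :=
    (MeasurePreserving.id _).prod measurePreserving_snd
  have iη := (m₁.integrable_comp hη.aestronglyMeasurable).2 hη
  have iκ := (m₂.integrable_comp hκ.aestronglyMeasurable).2 hκ
  have hae : cavityLog (M := M) β h bE bK =ᵐ[ξ.law.prod (Lη.prod Lκ)] fun z =>
      logAvg β (cavityWeight β h z.1) (energy (etaBond bE) z.2.1) +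
        Real.log (extPartition β h M) - logAvg β z.1 (energy bK z.2.2) := by
    filter_upwards [Measure.quasiMeasurePreserving_fst.ae ξ.ae_isWeight] with z hz
    exact hz.log_trial hβ h (abs_energy_le hE.etaBond.abs_le z.2.1) (abs_energy_le hK.abs_le z.2.2)
  have iηc := iη.add (integrable_const (Real.log (extPartition β h M)))
  refine ⟨(iηc.sub iκ).congr hae.symm, ?_⟩
  rw [integral_congr_ae hae]
  refine (integral_sub iηc iκ).trans ?_
  refine congrArg₂ (· - ·) ((integral_add iη (integrable_const _)).trans ?_) ?_
  · rw [integral_const]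
    simp only [probReal_univ, one_smul]
    exact congrArg (· + _) (integral_comp_of_measurePreserving m₁ hη.aestronglyMeasurable)
  · exact integral_comp_of_measurePreserving m₂ hκ.aestronglyMeasurable

theorem integrable_logAvg_pair (hμ : Integrable (fun x : ℝ => x) μ) (hβ : 0 ≤ β) (h : ℝ) {ζ : ℝ}
    (hζ : 0 ≤ ζ) :
    Integrable (fun D => logAvg β (extWeight β h) (energy (pairBond M) D))
      (sampleLaw ζ μ (sitesLaw M M)) := by
  obtain ⟨i, -⟩ := integrable_absSum μ (sitesLaw M M) hμ hζ
  have hb := isSpinField_pairBond M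
  refine (i.const_mul β).mono' (measurable_logAvg (W := fun _ => extWeight β h) β
    (fun _ => measurable_const) fun a => measurable_energy hb.measurable a).aestronglyMeasurable
    (ae_of_all _ fun D => ?_)
  exact (isWeight_extWeight β h).abs_logAvg_le hβ (abs_energy_le hb.abs_le D)

theorem integral_log_partitionFunction (hμ : Integrable (fun x : ℝ => x) μ) (hβ : 0 ≤ β) (h : ℝ)
    {α : ℝ} (hα : 0 ≤ α) :
    Integrable (fun D => Real.log (partitionFunction β h D)) (hamLaw μ α M) ∧
    ∫ D, Real.log (partitionFunction β h D) ∂(hamLaw μ α M) =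
      hamMean μ β h (α * M) M + Real.log (extPartition β h M) := by
  have hext := isWeight_extWeight (M := M) β h
  have hb := isSpinField_pairBond M
  have hint : Integrable (fun D => logAvg β (extWeight β h) (energy (pairBond M) D))
      (hamLaw μ α M) := integrable_logAvg_pair hμ hβ h (mul_nonneg hα (Nat.cast_nonneg M))
  have e : (fun D => Real.log (partitionFunction β h D)) = fun D =>
      logAvg β (extWeight β h) (energy (pairBond M) D) + Real.log (extPartition β h M) := by
    ext D
    rw [hext.logAvg_eq_sub hβ (abs_energy_le hb.abs_le D), tsum_fintype, tsum_fintype,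
      extPartition, sub_add_cancel, partitionFunction]
    refine congrArg Real.log (Finset.sum_congr rfl fun σ _ => ?_)
    rw [mul_add, Real.exp_add, mul_comm]
    rfl
  have hp : IsProbabilityMeasure (hamLaw μ α M) := isProbabilityMeasure_sampleLaw _ _ _
  rw [e]
  refine ⟨hint.add (integrable_const _), (integral_add hint (integrable_const _)).trans ?_⟩
  rw [integral_const]
  simp only [probReal_univ, one_smul]
  rfl

/-- Without `η` nothing couples the cavity to the system, so the average over the product space
factorizes. -/
theorem integral_logAvg_pair_kappa (hμ : Integrable (fun x : ℝ => x) μ) (hβ : 0 ≤ β) (h : ℝ)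
    (ξ : RandomWeights S) (hK : IsSpinField bK) {ζ₁ ζ₂ : ℝ} (h₁ : 0 ≤ ζ₁) (h₂ : 0 ≤ ζ₂) :
    ∫ z, logAvg β (cavityWeight β h z.1) (fun x : S × Conf M =>
        energy (fun p (x : S × Conf M) => pairBond M p x.2) z.2.1 x +
          energy (fun p (x : S × Conf M) => bK p x.1) z.2.2 x)
      ∂(ξ.law.prod ((sampleLaw ζ₁ μ (sitesLaw M M)).prod (sampleLaw ζ₂ μ νK))) =
      hamMean μ β h ζ₁ M + kappaMean μ β ζ₂ ξ bK νK := by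
  have hext := isWeight_extWeight (M := M) β h
  have hb := isSpinField_pairBond M
  have hH := integrable_logAvg_pair (μ := μ) (M := M) hμ hβ h h₁
  have hκ := (integrable_logAvg_energy (ν₁ := νK) hμ hβ
    (fun s : S => measurable_pi_apply s) ξ.ae_isWeight hK h₂).1
  have m₁ : MeasurePreserving
      (fun z : (S → ℝ) × Sample (Fin M × Fin M) × Sample K => z.2.1)
      (ξ.law.prod ((sampleLaw ζ₁ μ (sitesLaw M M)).prod (sampleLaw ζ₂ μ νK)))
      (sampleLaw ζ₁ μ (sitesLaw M M)) :=
    measurePreserving_fst.comp measurePreserving_snd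
  have m₂ : MeasurePreserving
      (fun z : (S → ℝ) × Sample (Fin M × Fin M) × Sample K => (z.1, z.2.2))
      (ξ.law.prod ((sampleLaw ζ₁ μ (sitesLaw M M)).prod (sampleLaw ζ₂ μ νK)))
      (ξ.law.prod (sampleLaw ζ₂ μ νK)) :=
    (MeasurePreserving.id _).prod measurePreserving_snd
  have iH := (m₁.integrable_comp hH.aestronglyMeasurable).2 hH
  have iκ := (m₂.integrable_comp hκ.aestronglyMeasurable).2 hκ
  refine (integral_congr_ae ?_).trans ((integral_add iH iκ).trans (congrArg₂ (· + ·)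
    (integral_comp_of_measurePreserving m₁ hH.aestronglyMeasurable)
    (integral_comp_of_measurePreserving m₂ hκ.aestronglyMeasurable)))
  filter_upwards [Measure.quasiMeasurePreserving_fst.ae ξ.ae_isWeight] with z hz
  exact hz.logAvg_prod hext hβ (abs_energy_le hK.abs_le z.2.2) (abs_energy_le hb.abs_le z.2.1)

/-- The bound behind all trial functions: the diluted Hamiltonian of the system together with
`κ` lies below `η`. -/
theorem hamMean_add_kappaMean_le (hsymm : μ.map (fun x => -x) = μ)
    (hμ : Integrable (fun x : ℝ => x) μ) (hβ : 0 ≤ β) (h : ℝ) (ξ : RandomWeights S)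
    (hE : IsSpinField bE) (hK : IsSpinField bK) {a : ℝ} (ha : 0 ≤ a)
    (hmom : ∀ n, ∀ x : Fin (2 * (n + 1)) → S,
      ∫ p, ∏ i, bK p (x i) ∂νK = (∫ p, ∏ i, bE p (x i) ∂νE) ^ 2) :
    hamMean μ β h a M + kappaMean μ β a ξ bK νK ≤ etaMean μ β h (a + a) M ξ bE νE := by
  rw [← integral_logAvg_pair_kappa hμ hβ h ξ hK ha ha]
  exact integral_logAvg_exchange_le hsymm hμ hβ (measurable_cavityWeight β h)
    (ae_isWeight_cavityWeight β h ξ) ((isSpinField_pairBond M).comp_snd S)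
    (hK.comp_fst (Conf M)) hE.etaBond ha ha fun n x => by
      rw [interp_balance νE a (hmom n) x]
      positivity

end Cavity

/-! ### Random Multi-Overlap Structures -/

theorem isSpinField_spin_apply (S : Type) : IsSpinField fun (X : S → ℤˣ) (s : S) => spin (X s) :=
  ⟨fun s => measurable_spin.comp (measurable_pi_apply s), fun _ _ => spin_eq_or _⟩

/-- The compatibility conditions give exactly the moment relation of the exchange: the even moments
of `X` are squares of those of `Y`. -/
theorem integrable_ramostLog_and_negBetaF_le {μ : Measure ℝ} [IsProbabilityMeasure μ]
    (hsymm : μ.map (fun x => -x) = μ) (hμ : Integrable (fun x : ℝ => x) μ) {α β : ℝ} (h : ℝ)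
    (hα : 0 ≤ α) (hβ : 0 ≤ β) {M : ℕ} [NeZero M] (R : RaMOSt) (F : R.Fields) :
    Integrable (ramostLog β h) (ramostLaw μ α M R F) ∧
      negBetaF μ α β h M ≤ ramostG μ α β h M R F := by
  have hb := isSpinField_spin_apply R.Space
  have hM : 0 ≤ α * M := by positivity
  obtain ⟨i, e⟩ := integral_cavityLog (M := M) (νE := F.etaLaw) (νK := F.kappaLaw) hμ hβ h
    R.weights hb hb (show 0 ≤ 2 * α * M by positivity) hM
  refine ⟨i, ?_⟩
  have key := hamMean_add_kappaMean_le (M := M) (νE := F.etaLaw) (νK := F.kappaLaw) hsymm hμ hβ h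
    R.weights hb hb hM fun n x => by
      rw [F.kappa_moment (n + 1) (by omega), F.eta_moment (n + 1) (by omega)]
  rw [show α * M + α * M = 2 * α * M by ring] at key
  have e' : ramostG μ α β h M R F = (1 / (M : ℝ)) *
      (etaMean μ β h (2 * α * M) M R.weights (fun X s => spin (X s)) F.etaLaw +
        Real.log (extPartition β h M) -
        kappaMean μ β (α * M) R.weights (fun X s => spin (X s)) F.kappaLaw) :=
    congrArg _ e
  rw [e', negBetaF, (integral_log_partitionFunction hμ hβ h hα).2]
  refine mul_le_mul_of_nonneg_left ?_ (by positivity)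
  linarith

/-- Deterministic weights equal to 1. A bound from below on a real infimum requires a non-empty
family. -/
theorem nonempty_randomWeights (S : Type) [Finite S] [Nonempty S] :
    Nonempty (RandomWeights S) := by
  have : Fintype S := Fintype.ofFinite S
  have hm : ∀ p : (S → ℝ) → Prop, MeasurableSet {x | p x} → p (fun _ => 1) →
      ∀ᵐ x ∂(Measure.dirac fun _ : S => (1 : ℝ)), p x := fun p hp h1 => (ae_dirac_iff hp).2 h1
  refine ⟨⟨Measure.dirac fun _ => 1, inferInstance, ?_, ae_of_all _ fun _ => Summable.of_finite,
    ?_⟩⟩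
  · rw [ae_all_iff]
    exact fun s => hm (fun ξ => 0 ≤ ξ s)
      (measurableSet_le measurable_const (measurable_pi_apply s)) zero_le_one
  · refine hm (fun ξ => 0 < ∑' s, ξ s) (measurableSet_lt measurable_const
      (Measurable.tsum fun s => measurable_pi_apply s)) ?_
    rw [tsum_fintype]
    exact Finset.sum_pos (fun _ _ => one_pos) Finset.univ_nonempty

/-- The one-point structure with all overlaps equal to 1 and both fields constantly `+1`. -/
theorem nonempty_ramost : Nonempty ((R : RaMOSt) × R.Fields) := by
  obtain ⟨ξ⟩ := nonempty_randomWeights Unit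
  let R : RaMOSt :=
    { Space := Unit
      countable := inferInstance
      q := fun _ _ => 1
      abs_q_le_one := by simp
      posDef := fun k _ m x c => by
        simp only [mul_one, ← Finset.mul_sum, ← Finset.sum_mul]
        exact mul_self_nonneg _
      q_diag := by simp
      eq_of_q_eq_one := fun _ _ _ => rfl
      weights := ξ }
  have hd : ∀ n (γ : Fin n → Unit), ∫ X : Unit → ℤˣ, ∏ a, spin (X (γ a))
      ∂(Measure.dirac fun _ : Unit => (1 : ℤˣ)) = 1 := fun n γ => by
    have hm : Measurable fun X : Unit → ℤˣ => ∏ a, spin (X (γ a)) :=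
      Finset.measurable_prod _ fun a _ => measurable_spin.comp (measurable_pi_apply (γ a))
    rw [integral_dirac' _ _ hm.stronglyMeasurable]
    simp [spin]
  exact ⟨⟨R, Measure.dirac fun _ => 1, Measure.dirac fun _ => 1, inferInstance, inferInstance,
    fun k _ γ => by rw [hd]; simp [R], fun k _ γ => by rw [hd]⟩⟩

/-! ### The cavity lattice -/

section Lattice

/-- The marginal of a configuration at a site, as a family of fields. -/
def siteBond (N : ℕ) (i : Fin N) (τ : Conf N) : ℝ := spin (τ i)

theorem isSpinField_siteBond (N : ℕ) : IsSpinField (siteBond N) :=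
  ⟨fun _ => .of_discrete, fun _ _ => spin_eq_or _⟩

variable {μ : Measure ℝ} [IsProbabilityMeasure μ] {α β : ℝ} {N M : ℕ} [NeZero N] [NeZero M]

/-- The two end points of a `κ` bond are independent, so its moment is the square of the one-site
moment. -/
theorem lattice_moment {n : ℕ} (x : Fin n → Conf N) :
    ∫ p, ∏ i, pairBond N p (x i) ∂(sitesLaw N N) =
      (∫ p, ∏ i, siteBond N p (x i) ∂(uniformOn (Set.univ : Set (Fin N)))) ^ 2 := by
  simp only [pairBond, siteBond]
  rw [integral_prod_spin_mul_spin, integral_prod_spin, sq]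

theorem integral_trialLog (hμ : Integrable (fun x : ℝ => x) μ) (hα : 0 ≤ α) (hβ : 0 ≤ β) (h : ℝ)
    (ξ : RandomWeights (Conf N)) :
    Integrable (trialLog (M := M) β h) (trialLaw μ α N M ξ) ∧
    ∫ D, trialLog (M := M) β h D ∂(trialLaw μ α N M ξ) =
      etaMean μ β h (2 * α * M) M ξ (siteBond N) (uniformOn Set.univ) +
        Real.log (extPartition β h M) - kappaMean μ β (α * M) ξ (pairBond N) (sitesLaw N N) := by
  have e : trialLog (N := N) (M := M) β h = cavityLog β h (siteBond N) (pairBond N) := by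
    ext D
    rw [cavityLog, tsum_fintype, tsum_fintype]
    rfl
  rw [e]
  exact integral_cavityLog hμ hβ h ξ (isSpinField_siteBond N) (isSpinField_pairBond N)
    (by positivity) (by positivity)

theorem negBetaF_le_trialG (hsymm : μ.map (fun x => -x) = μ)
    (hμ : Integrable (fun x : ℝ => x) μ) (hα : 0 ≤ α) (hβ : 0 ≤ β) (h : ℝ)
    (ξ : RandomWeights (Conf N)) : negBetaF μ α β h M ≤ trialG μ α β h N M ξ := by
  have key := hamMean_add_kappaMean_le (M := M) hsymm hμ hβ h ξ (isSpinField_siteBond N)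
    (isSpinField_pairBond N) (νE := uniformOn Set.univ) (νK := sitesLaw N N)
    (show 0 ≤ α * M by positivity) fun n x => lattice_moment x
  rw [show α * M + α * M = 2 * α * M by ring] at key
  rw [trialG, (integral_trialLog hμ hα hβ h ξ).2, negBetaF,
    (integral_log_partitionFunction hμ hβ h hα).2]
  refine mul_le_mul_of_nonneg_left ?_ (by positivity)
  linarith

/-- The logarithm of the average of `e^{-βH(t)}` in the interpolation. -/
abbrev latticeLog (β h : ℝ) (N M : ℕ) :
    (Conf N → ℝ) × Sample (Fin M × Fin M) × Sample (Fin N × Fin N) × Sample (Fin N × Fin M) → ℝ :=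
  tripleLog β (cavityWeight β h) (fun p (x : Conf N × Conf M) => pairBond M p x.2)
    (fun p (x : Conf N × Conf M) => pairBond N p x.1) (etaBond (siteBond N))

/-- The law of the disorder in the numerator of the interpolation. -/
abbrev latticeLaw (μ : Measure ℝ) (α : ℝ) (N M : ℕ) (ξ : RandomWeights (Conf N)) (t : ℝ) :=
  tripleLaw ξ.law μ (sitesLaw M M) (sitesLaw N N)
    ((uniformOn (Set.univ : Set (Fin N))).prod (uniformOn (Set.univ : Set (Fin M))))
    (t * (α * M)) (t * (α * M)) ((1 - t) * (α * M + α * M))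

/-- The interpolation is the exchange with `a₁ = a₂ = αM`; the doubled mean of `η` is the required
`a₁ + a₂`. The denominator forms an independent factor whose law does not depend on `t`. -/
theorem disorderLaw_eq (ξ : RandomWeights (Conf N)) (t : ℝ) :
    disorderLaw μ α N M ξ t =
      (latticeLaw μ α N M ξ t).prod (sampleLaw (α * M) μ (sitesLaw N N)) := by
  rw [disorderLaw, latticeLaw, tripleLaw, hamLaw, mul_assoc t α,
    show 2 * ((1 - t) * α) * (M : ℝ) = (1 - t) * (α * M + α * M) by ring]
  rfl

theorem integral_interpLog (hμ : Integrable (fun x : ℝ => x) μ) (hα : 0 ≤ α) (hβ : 0 ≤ β) (h : ℝ)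
    (ξ : RandomWeights (Conf N)) {t : ℝ} (ht : t ∈ Set.Icc (0 : ℝ) 1) :
    Integrable (interpLog (M := M) β h) (disorderLaw μ α N M ξ t) ∧
    ∫ D, interpLog (M := M) β h D ∂(disorderLaw μ α N M ξ t) =
      ∫ z, latticeLog β h N M z ∂(latticeLaw μ α N M ξ t) +
        Real.log (extPartition β h M) - kappaMean μ β (α * M) ξ (pairBond N) (sitesLaw N N) := by
  rw [disorderLaw_eq]
  have h0 : 0 ≤ α * M := by positivity
  have hb₁ := (isSpinField_pairBond M).comp_snd (Conf N)
  have hb₂ := (isSpinField_pairBond N).comp_fst (Conf M)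
  have hb₃ := (isSpinField_siteBond N).etaBond (M := M)
  have hη : Integrable (latticeLog β h N M) (latticeLaw μ α N M ξ t) :=
    (linearGrowth_tripleLog hβ (measurable_cavityWeight β h) (ae_isWeight_cavityWeight β h ξ)
      hb₁ hb₂ hb₃).integrable hμ (mul_nonneg ht.1 h0) (mul_nonneg ht.1 h0)
      (mul_nonneg (sub_nonneg.2 ht.2) (add_nonneg h0 h0))
  have hκ := (integrable_logAvg_energy (ν₁ := sitesLaw N N) hμ hβ
    (fun s : Conf N => measurable_pi_apply s) ξ.ae_isWeight (isSpinField_pairBond N) h0).1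
  set Lκ := sampleLaw (α * M) μ (sitesLaw N N)
  have m₂ : MeasurePreserving (fun z : Disorder N M => (z.1.1, z.2))
      ((latticeLaw μ α N M ξ t).prod Lκ) (ξ.law.prod Lκ) :=
    measurePreserving_fst.prod (MeasurePreserving.id _)
  have iη := hη.comp_fst Lκ
  have iκ := (m₂.integrable_comp hκ.aestronglyMeasurable).2 hκ
  have hae : interpLog (M := M) β h =ᵐ[(latticeLaw μ α N M ξ t).prod Lκ] fun z =>
      latticeLog β h N M z.1 + Real.log (extPartition β h M) -
        logAvg β z.1.1 (energy (pairBond N) z.2) := by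
    filter_upwards [Measure.quasiMeasurePreserving_fst.ae
      (Measure.quasiMeasurePreserving_fst.ae ξ.ae_isWeight)] with z hz
    have := hz.log_trial hβ h (abs_totalEnergy_le hb₁ hb₂ hb₃ z.1.2)
      (abs_energy_le (isSpinField_pairBond N).abs_le z.2)
    refine Eq.trans ?_ this
    rw [tsum_fintype, tsum_fintype, interpLog, Fintype.sum_prod_type]
    rfl
  have iηc := iη.add (integrable_const (Real.log (extPartition β h M)))
  refine ⟨(iηc.sub iκ).congr hae.symm, ?_⟩
  rw [integral_congr_ae hae]
  refine (integral_sub iηc iκ).trans ?_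
  refine congrArg₂ (· - ·) ((integral_add iη (integrable_const _)).trans ?_) ?_
  · rw [integral_const, integral_fun_fst]
    simp only [probReal_univ, one_smul]
  · exact integral_comp_of_measurePreserving m₂ hκ.aestronglyMeasurable

theorem interpR_zero (hμ : Integrable (fun x : ℝ => x) μ) (hα : 0 ≤ α) (hβ : 0 ≤ β) (h : ℝ)
    (ξ : RandomWeights (Conf N)) : interpR μ α β h N M ξ 0 = trialG μ α β h N M ξ := by
  rw [interpR, trialG, (integral_trialLog hμ hα hβ h ξ).2,
    (integral_interpLog hμ hα hβ h ξ (Set.left_mem_Icc.2 zero_le_one)).2, latticeLaw, zero_mul,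
    sub_zero, one_mul, integral_tripleLog_zero (measurable_cavityWeight β h)
      (isSpinField_siteBond N).etaBond, etaMean, show α * M + α * M = 2 * α * M by ring]

theorem interpR_one (hμ : Integrable (fun x : ℝ => x) μ) (hα : 0 ≤ α) (hβ : 0 ≤ β) (h : ℝ)
    (ξ : RandomWeights (Conf N)) : interpR μ α β h N M ξ 1 = negBetaF μ α β h M := by
  have h0 : 0 ≤ α * M := by positivity
  rw [interpR, negBetaF, (integral_log_partitionFunction hμ hβ h hα).2,
    (integral_interpLog hμ hα hβ h ξ (Set.right_mem_Icc.2 zero_le_one)).2, latticeLaw, one_mul,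
    sub_self, zero_mul, integral_tripleLog_one (measurable_cavityWeight β h)
      ((isSpinField_pairBond M).comp_snd _) ((isSpinField_pairBond N).comp_fst _),
    integral_logAvg_pair_kappa hμ hβ h ξ (isSpinField_pairBond N) h0 h0]
  ring

theorem replicaAvg_linear {A : Type} [Fintype A] (n : ℕ) (w : A → ℝ) (a b c : ℝ)
    (f g k : (Fin n → A) → ℝ) :
    replicaAvg n w (fun x => a * f x + b * g x - c * k x) =
      a * replicaAvg n w f + b * replicaAvg n w g - c * replicaAvg n w k := by
  simp only [replicaAvg, mul_div_assoc', ← add_div, ← sub_div, Finset.mul_sum]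
  rw [← Finset.sum_add_distrib, ← Finset.sum_sub_distrib]
  exact congrArg (· / _) (Finset.sum_congr rfl fun x _ => by ring)

/-- On a finite cavity the moments of Gibbs averages are exact replica averages, and the balance
inside them is the squared overlap difference. -/
theorem gapMean_lattice (h : ℝ) (ξ : RandomWeights (Conf N)) (t : ℝ) (n : ℕ) :
    gapMean β (cavityWeight β h) (fun p (x : Conf N × Conf M) => pairBond M p x.2)
      (fun p (x : Conf N × Conf M) => pairBond N p x.1) (etaBond (siteBond N)) ξ.law μ
      (sitesLaw M M) (sitesLaw N N)
      ((uniformOn (Set.univ : Set (Fin N))).prod (uniformOn (Set.univ : Set (Fin M))))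
      (α * M) (α * M) t n = α * M * overlapGap μ α β h N M ξ t n := by
  have hb₁ := (isSpinField_pairBond M).comp_snd (Conf N)
  have hb₂ := (isSpinField_pairBond N).comp_fst (Conf M)
  have hb₃ := (isSpinField_siteBond N).etaBond (M := M)
  rw [gapMean, overlapGap, disorderLaw_eq, ← integral_const_mul]
  have hw : ∀ D : Disorder N M, interpWeight β h D = tripleWeight β (cavityWeight β h)
      (fun p (x : Conf N × Conf M) => pairBond M p x.2)
      (fun p (x : Conf N × Conf M) => pairBond N p x.1) (etaBond (siteBond N)) D.1 := fun D => by
    ext x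
    rw [interpWeight, tripleWeight, cavityWeight, extWeight, mul_add, Real.exp_add, mul_comm
      (Real.exp _), ← mul_assoc]
    rfl
  simp_rw [hw]
  rw [integral_fun_fst (fun z => α * M * replicaAvg n (tripleWeight β (cavityWeight β h)
      (fun p (x : Conf N × Conf M) => pairBond M p x.2)
      (fun p (x : Conf N × Conf M) => pairBond N p x.1) (etaBond (siteBond N)) z) _)]
  simp only [probReal_univ, one_smul]
  refine integral_congr_ae (ae_of_all _ fun z => ?_)
  simp only []
  rw [hb₁.integral_gibbs_pow, hb₂.integral_gibbs_pow, hb₃.integral_gibbs_pow, ← replicaAvg_linear]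
  have e : ∀ x : Fin n → Conf N × Conf M, _ = _ := fun x =>
    interp_balance (uniformOn Set.univ) (α * M) (bE := siteBond N) (fun x => lattice_moment x) x
  simp_rw [e]
  simp only [replicaAvg, mul_div_assoc', Finset.mul_sum]
  refine congrArg (· / _) (Finset.sum_congr rfl fun x _ => ?_)
  rw [show ∫ p, ∏ i, siteBond N p (x i).1 ∂(uniformOn Set.univ) =
    multiOverlap fun a => (x a).1 from integral_prod_spin fun a => (x a).1]
  ring

theorem abs_replicaAvg_le {A : Type} [Fintype A] (n : ℕ) {w : A → ℝ} (hw : ∀ a, 0 ≤ w a) {C : ℝ}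
    (hC : 0 ≤ C) {f : (Fin n → A) → ℝ} (hf : ∀ x, |f x| ≤ C) : |replicaAvg n w f| ≤ C := by
  have hs : 0 ≤ (∑ a, w a) ^ n := pow_nonneg (Finset.sum_nonneg fun a _ => hw a) n
  rw [replicaAvg, abs_div, abs_of_nonneg hs]
  refine div_le_of_le_mul₀ hs hC ?_
  rw [Fintype.sum_pow, Finset.mul_sum]
  refine (Finset.abs_sum_le_sum_abs _ _).trans (Finset.sum_le_sum fun x _ => ?_)
  have hp := Finset.prod_nonneg fun a (_ : a ∈ Finset.univ) => hw (x a)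
  rw [abs_mul, abs_of_nonneg hp, mul_comm]
  exact mul_le_mul_of_nonneg_right (hf x) hp

theorem abs_multiOverlap_le {K n : ℕ} [NeZero K] (s : Fin n → Conf K) : |multiOverlap s| ≤ 1 := by
  have hK : (0 : ℝ) < K := Nat.cast_pos.2 (NeZero.pos K)
  have h1 : ∀ u, |spin u| = 1 := fun u => by rcases spin_eq_or u with h | h <;> simp [h]
  rw [multiOverlap, abs_mul, abs_of_pos (by positivity), one_div, inv_mul_le_iff₀ hK, mul_one]
  refine (Finset.abs_sum_le_sum_abs _ _).trans (le_of_eq ?_)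
  simp [Finset.abs_prod, h1]

/-- Both overlaps lie in `[-1, 1]`, so their squared difference is at most `(1 + 1)² = 4`. -/
theorem abs_overlapGap_le (h : ℝ) (ξ : RandomWeights (Conf N)) (t : ℝ) (n : ℕ) :
    |overlapGap μ α β h N M ξ t n| ≤ 4 := by
  have hP : IsProbabilityMeasure (disorderLaw μ α N M ξ t) := by
    rw [disorderLaw_eq, latticeLaw, tripleLaw]
    infer_instance
  rw [overlapGap, ← Real.norm_eq_abs, ← mul_one (4 : ℝ),
    ← probReal_univ (μ := disorderLaw μ α N M ξ t)]
  refine norm_integral_le_of_norm_le_const ?_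
  rw [disorderLaw_eq]
  filter_upwards [Measure.quasiMeasurePreserving_fst.ae
    (Measure.quasiMeasurePreserving_fst.ae ξ.ae_isWeight)] with D hD
  refine abs_replicaAvg_le n (fun x => mul_nonneg (hD.nonneg _) (Real.exp_pos _).le) (by norm_num)
    fun x => ?_
  rw [abs_pow, show (4 : ℝ) = 2 ^ 2 by norm_num]
  refine pow_le_pow_left₀ (abs_nonneg _) ((abs_sub _ _).trans ?_) 2
  linarith [abs_multiOverlap_le fun a => (x a).1, abs_multiOverlap_le fun a => (x a).2]

theorem overlapGap_nonneg (h : ℝ) (ξ : RandomWeights (Conf N)) (t : ℝ)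
    (n : ℕ) : 0 ≤ overlapGap μ α β h N M ξ t n := by
  refine integral_nonneg_of_ae ?_
  rw [disorderLaw_eq]
  filter_upwards [Measure.quasiMeasurePreserving_fst.ae
    (Measure.quasiMeasurePreserving_fst.ae ξ.ae_isWeight)] with D hD
  have hw : ∀ x, 0 ≤ interpWeight β h D x := fun x =>
    mul_nonneg (hD.nonneg _) (Real.exp_pos _).le
  exact div_nonneg (Finset.sum_nonneg fun x _ => mul_nonneg
    (Finset.prod_nonneg fun a _ => hw _) (sq_nonneg _))
    (pow_nonneg (Finset.sum_nonneg fun x _ => hw x) n)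

theorem hasDerivWithinAt_interpR (hsymm : μ.map (fun x => -x) = μ)
    (hμ : Integrable (fun x : ℝ => x) μ) (hα : 0 ≤ α) (hβ : 0 ≤ β) (h : ℝ)
    (ξ : RandomWeights (Conf N)) {t : ℝ} (ht : t ∈ Set.Icc (0 : ℝ) 1) :
    Summable (fun n : ℕ => gapTerm μ α β h N M ξ t (n + 1)) ∧
    HasDerivWithinAt (interpR μ α β h N M ξ)
      (-α * ∑' n : ℕ, gapTerm μ α β h N M ξ t (n + 1)) (Set.Icc 0 1) t ∧
    -α * ∑' n : ℕ, gapTerm μ α β h N M ξ t (n + 1) ≤ 0 := by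
  have h0 : 0 ≤ α * M := by positivity
  have hb₁ := (isSpinField_pairBond M).comp_snd (Conf N)
  have hb₂ := (isSpinField_pairBond N).comp_fst (Conf M)
  have hb₃ := (isSpinField_siteBond N).etaBond (M := M)
  have hM : (M : ℝ) ≠ 0 := Nat.cast_ne_zero.2 (NeZero.ne M)
  obtain ⟨-, hd⟩ := hasDerivWithinAt_tripleLog (ν₁ := sitesLaw M M) (ν₂ := sitesLaw N N)
    (ν₃ := (uniformOn (Set.univ : Set (Fin N))).prod (uniformOn (Set.univ : Set (Fin M))))
    hsymm hμ hβ (measurable_cavityWeight β h) (ae_isWeight_cavityWeight β h ξ) hb₁ hb₂ hb₃ h0 h0 ht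
  have hg : ∀ n, gapTerm μ α β h N M ξ t (n + 1) =
      tanhCoef μ β n * overlapGap μ α β h N M ξ t (2 * (n + 1)) := fun n => by
    rw [gapTerm, tanhCoef]
    push_cast
    ring
  have hgap0 : ∀ n, 0 ≤ gapTerm μ α β h N M ξ t (n + 1) := fun n => by
    rw [hg]
    exact mul_nonneg (tanhCoef_nonneg μ β n) (overlapGap_nonneg h ξ t _)
  refine ⟨?_, ?_, ?_⟩
  · simp_rw [hg]
    -- Summability is taken from the coefficients, not from the derivative formula: the terms there
    -- carry the factor `αM`, which vanishes for `α = 0` and cannot be divided out.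
    refine Summable.of_norm_bounded (summable_tanhCoef β hsymm hμ |>.mul_right 4) fun n => ?_
    rw [norm_mul, Real.norm_of_nonneg (tanhCoef_nonneg μ β n)]
    exact mul_le_mul_of_nonneg_left (abs_overlapGap_le h ξ t _) (tanhCoef_nonneg μ β n)
  · have hd' := (((hd.add_const (Real.log (extPartition β h M))).sub_const
      (kappaMean μ β (α * M) ξ (pairBond N) (sitesLaw N N))).const_mul (1 / (M : ℝ)))
    refine (hd'.congr (fun y hy => ?_) ?_).congr_deriv ?_
    · rw [interpR, (integral_interpLog hμ hα hβ h ξ hy).2]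
    · rw [interpR, (integral_interpLog hμ hα hβ h ξ ht).2]
    · rw [tsum_congr fun n => (?_ : _ = α * M * gapTerm μ α β h N M ξ t (n + 1)), tsum_mul_left]
      · field_simp
      · rw [gapMean_lattice, hg]
        ring
  · exact mul_nonpos_of_nonpos_of_nonneg (neg_nonpos.2 hα) (tsum_nonneg hgap0)

end Lattice

/-! ### Systems that split into two parts -/

section Split

variable {M₁ M₂ : ℕ}

/-- The restriction of a configuration to the first `M₁` sites. -/
def leftConf (M₁ M₂ : ℕ) (σ : Conf (M₁ + M₂)) : Conf M₁ := fun i => σ (Fin.castAdd M₂ i)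

/-- The restriction of a configuration to the last `M₂` sites. -/
def rightConf (M₁ M₂ : ℕ) (σ : Conf (M₁ + M₂)) : Conf M₂ := fun i => σ (Fin.natAdd M₁ i)

theorem logAvg_comp_equiv {A B : Type} (e : A ≃ B) (β : ℝ) (w E : B → ℝ) :
    logAvg β (fun a => w (e a)) (fun a => E (e a)) = logAvg β w E := by
  rw [logAvg, gibbs, e.tsum_eq w, e.tsum_eq fun b => w b * Real.exp (-β * E b)]
  rfl

theorem extWeight_split (β h : ℝ) (σ : Conf (M₁ + M₂)) :
    extWeight β h σ = extWeight β h (leftConf M₁ M₂ σ) * extWeight β h (rightConf M₁ M₂ σ) := by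
  rw [extWeight, extWeight, extWeight, ← Real.exp_add, extEnergy, extEnergy, extEnergy,
    Fin.sum_univ_add]
  simp only [leftConf, rightConf]
  ring_nf

theorem logAvg_split {β : ℝ} (hβ : 0 ≤ β) (h : ℝ) {E : Conf M₁ → ℝ} {F : Conf M₂ → ℝ} {C C' : ℝ}
    (hE : ∀ s, |E s| ≤ C) (hF : ∀ t, |F t| ≤ C') :
    logAvg β (extWeight β h) (fun σ => E (leftConf M₁ M₂ σ) + F (rightConf M₁ M₂ σ)) =
      logAvg β (extWeight β h) E + logAvg β (extWeight β h) F := by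
  rw [← logAvg_comp_equiv (Fin.appendEquiv M₁ M₂)]
  have hl : ∀ x : Conf M₁ × Conf M₂, leftConf M₁ M₂ (Fin.appendEquiv M₁ M₂ x) = x.1 := fun x => by
    ext i; simp [leftConf, Fin.appendEquiv]
  have hr : ∀ x : Conf M₁ × Conf M₂, rightConf M₁ M₂ (Fin.appendEquiv M₁ M₂ x) = x.2 := fun x => by
    ext i; simp [rightConf, Fin.appendEquiv]
  simp_rw [extWeight_split β h, hl, hr, add_comm (E _)]
  rw [(isWeight_extWeight β h).logAvg_prod (isWeight_extWeight β h) hβ hE hF, add_comm]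

/-- The overlap of the whole is the mean of the block overlaps weighted by size. This linearity
underlies both splittings, of the pressure and of the trial function. -/
theorem multiOverlap_split [NeZero M₁] [NeZero M₂] {n : ℕ} (x : Fin n → Conf (M₁ + M₂)) :
    ((M₁ : ℝ) + M₂) * multiOverlap x = M₁ * multiOverlap (fun i => leftConf M₁ M₂ (x i)) +
      M₂ * multiOverlap fun i => rightConf M₁ M₂ (x i) := by
  have h₁ : (M₁ : ℝ) ≠ 0 := Nat.cast_ne_zero.2 (NeZero.ne M₁)
  have h₂ : (M₂ : ℝ) ≠ 0 := Nat.cast_ne_zero.2 (NeZero.ne M₂)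
  have h : (M₁ : ℝ) + M₂ ≠ 0 := by positivity
  rw [multiOverlap, multiOverlap, multiOverlap, Fin.sum_univ_add, Nat.cast_add,
    one_div, one_div, one_div, mul_inv_cancel_left₀ h, mul_inv_cancel_left₀ h₁,
    mul_inv_cancel_left₀ h₂]
  rfl

variable {μ : Measure ℝ} [IsProbabilityMeasure μ] {α β : ℝ} [NeZero M₁] [NeZero M₂]

/-- Bonds inside the two blocks are exchanged against bonds of the joint system. The balance is
non-negative because the square of a mean is at most the mean of the squares. -/
theorem hamMean_superadditive (hsymm : μ.map (fun x => -x) = μ)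
    (hμ : Integrable (fun x : ℝ => x) μ) (hα : 0 ≤ α) (hβ : 0 ≤ β) (h : ℝ) :
    hamMean μ β h (α * M₁) M₁ + hamMean μ β h (α * M₂) M₂ ≤
      hamMean μ β h (α * (M₁ + M₂ : ℕ)) (M₁ + M₂) := by
  have : NeZero (M₁ + M₂) := ⟨by have := NeZero.ne M₁; omega⟩
  have h₁ : 0 ≤ α * M₁ := by positivity
  have h₂ : 0 ≤ α * M₂ := by positivity
  have hb₁ := isSpinField_pairBond M₁
  have hb₂ := isSpinField_pairBond M₂
  -- No random weights are present, so the auxiliary probability space is a point.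
  have key := integral_logAvg_exchange_le (ρ := Measure.dirac ()) (w := fun _ => extWeight β h)
    (b₁ := fun p σ => pairBond M₁ p (leftConf M₁ M₂ σ))
    (b₂ := fun p σ => pairBond M₂ p (rightConf M₁ M₂ σ)) (b₃ := pairBond (M₁ + M₂))
    (ν₁ := sitesLaw M₁ M₁) (ν₂ := sitesLaw M₂ M₂) (ν₃ := sitesLaw (M₁ + M₂) (M₁ + M₂)) hsymm hμ hβ
    (fun _ => measurable_const) (ae_of_all _ fun _ => isWeight_extWeight β h)
    ⟨fun s => hb₁.measurable _, fun p s => hb₁.eq_or _ _⟩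
    ⟨fun s => hb₂.measurable _, fun p s => hb₂.eq_or _ _⟩ (isSpinField_pairBond _) h₁ h₂
    fun n x => by
      simp only [pairBond]
      rw [integral_prod_spin_mul_spin x x,
        integral_prod_spin_mul_spin (fun i => leftConf M₁ M₂ (x i)) fun i => leftConf M₁ M₂ (x i),
        integral_prod_spin_mul_spin (fun i => rightConf M₁ M₂ (x i)) fun i => rightConf M₁ M₂ (x i)]
      have hs := multiOverlap_split x
      have hM₁ : (0 : ℝ) < M₁ := Nat.cast_pos.2 (NeZero.pos M₁)
      have hM₂ : (0 : ℝ) < M₂ := Nat.cast_pos.2 (NeZero.pos M₂)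
      set q := multiOverlap x
      set q₁ := multiOverlap fun i => leftConf M₁ M₂ (x i)
      set q₂ := multiOverlap fun i => rightConf M₁ M₂ (x i)
      -- The variance of a variable with values `q₁`, `q₂` and probabilities proportional to `M₁`,
      -- `M₂`, times `α (M₁ + M₂)`.
      have e : α * M₁ * (q₁ * q₁) + α * M₂ * (q₂ * q₂) - (α * M₁ + α * M₂) * (q * q) =
          α * (M₁ * M₂ * (q₁ - q₂) ^ 2) / (M₁ + M₂) := by
        rw [eq_div_iff (by positivity)]
        linear_combination (-α) * (((M₁ : ℝ) + M₂) * q + (M₁ * q₁ + M₂ * q₂)) * hs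
      rw [e]
      positivity
  rw [integral_fun_snd (fun D => logAvg β (extWeight β h) (energy (pairBond (M₁ + M₂)) D)),
    integral_fun_snd (fun z : Sample (Fin M₁ × Fin M₁) × Sample (Fin M₂ × Fin M₂) =>
      logAvg β (extWeight β h) fun a =>
        energy (fun p σ => pairBond M₁ p (leftConf M₁ M₂ σ)) z.1 a +
          energy (fun p σ => pairBond M₂ p (rightConf M₁ M₂ σ)) z.2 a)] at key
  simp only [probReal_univ, one_smul] at key
  rw [← mul_add, ← Nat.cast_add] at key
  refine le_trans (le_of_eq ?_) key
  have i₁ := integrable_logAvg_pair (μ := μ) (M := M₁) hμ hβ h h₁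
  have i₂ := integrable_logAvg_pair (μ := μ) (M := M₂) hμ hβ h h₂
  have hsum := integral_add (i₁.comp_fst (sampleLaw (α * M₂) μ (sitesLaw M₂ M₂)))
    (i₂.comp_snd (sampleLaw (α * M₁) μ (sitesLaw M₁ M₁)))
  rw [integral_fun_fst (fun D => logAvg β (extWeight β h) (energy (pairBond M₁) D)),
    integral_fun_snd (fun D => logAvg β (extWeight β h) (energy (pairBond M₂) D))] at hsum
  simp only [probReal_univ, one_smul] at hsum
  refine hsum.symm.trans (integral_congr_ae (ae_of_all _ fun z => ?_))
  exact (logAvg_split hβ h (abs_energy_le hb₁.abs_le z.1) (abs_energy_le hb₂.abs_le z.2)).symm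

end Split

/-! ### Tilted weights -/

section Tilt

variable {S Δ Δ₁ Δ₂ : Type} [Finite S] [MeasurableSpace Δ] [MeasurableSpace Δ₁] [MeasurableSpace Δ₂]

/-- A random field on `S` with an integrable uniform bound. -/
structure IsTilt (L : Measure Δ) (E : Δ → S → ℝ) : Prop where
  measurable : ∀ s, Measurable fun D => E D s
  bound : ∃ g : Δ → ℝ, Integrable g L ∧ ∀ D s, |E D s| ≤ g D

/-- The expected logarithm of the average of `e^{-E}`. -/
def tiltMean (ξ : RandomWeights S) (L : Measure Δ) (E : Δ → S → ℝ) : ℝ :=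
  ∫ z, logAvg 1 z.1 (E z.2) ∂(ξ.law.prod L)

/-- A chain rule: the logarithm of the ratio of sums telescopes through `∑ w e^{-βE}`. -/
theorem IsWeight.logAvg_add {w : S → ℝ} (hw : IsWeight w) {β : ℝ} (hβ : 0 ≤ β) {E F : S → ℝ}
    {C C' : ℝ} (hE : ∀ s, |E s| ≤ C) (hF : ∀ s, |F s| ≤ C') :
    logAvg β w (fun s => E s + F s) =
      logAvg β w E + logAvg β (fun s => w s * Real.exp (-β * E s)) F := by
  rw [hw.logAvg_eq_sub hβ fun s => (abs_add_le _ _).trans (add_le_add (hE s) (hF s)),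
    hw.logAvg_eq_sub hβ hE, (hw.tilt hβ hE).logAvg_eq_sub hβ hF]
  simp_rw [mul_add, Real.exp_add, mul_assoc]
  ring

variable {L : Measure Δ} {L₁ : Measure Δ₁} {L₂ : Measure Δ₂} [IsProbabilityMeasure L]
  [IsProbabilityMeasure L₁] [IsProbabilityMeasure L₂] {E : Δ → S → ℝ} {E₁ : Δ₁ → S → ℝ}
  {E₂ : Δ₂ → S → ℝ}

theorem measurable_tiltIntegrand (hE : IsTilt L E) :
    Measurable fun z : (S → ℝ) × Δ => logAvg 1 z.1 (E z.2) :=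
  measurable_logAvg 1 (fun s => (measurable_pi_apply s).comp measurable_fst)
    fun s => (hE.measurable s).comp measurable_snd

theorem IsTilt.integrable (hE : IsTilt L E) (ξ : RandomWeights S) :
    Integrable (fun z => logAvg 1 z.1 (E z.2)) (ξ.law.prod L) := by
  obtain ⟨g, hg, hle⟩ := hE.bound
  refine ((hg.comp_snd ξ.law).const_mul 1).mono' (measurable_tiltIntegrand hE).aestronglyMeasurable
    ?_
  filter_upwards [Measure.quasiMeasurePreserving_fst.ae ξ.ae_isWeight] with z hz
  exact hz.abs_logAvg_le zero_le_one (hle z.2)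

theorem measurable_tilt (hE : IsTilt L E) :
    Measurable fun (z : (S → ℝ) × Δ) (s : S) => z.1 s * Real.exp (-1 * E z.2 s) :=
  measurable_pi_lambda _ fun s => ((measurable_pi_apply s).comp measurable_fst).mul
    (((hE.measurable s).comp measurable_snd).const_mul (-1)).exp

/-- The law of the weights multiplied by `e^{-E}`. -/
def RandomWeights.tilt (ξ : RandomWeights S) (hE : IsTilt L E) : RandomWeights S where
  law := (ξ.law.prod L).map fun z s => z.1 s * Real.exp (-1 * E z.2 s)
  isProbabilityMeasure := Measure.isProbabilityMeasure_map (measurable_tilt hE).aemeasurable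
  nonneg := by
    rw [ae_all_iff]
    intro s
    rw [ae_map_iff (measurable_tilt hE).aemeasurable
      (measurableSet_le measurable_const (measurable_pi_apply s))]
    filter_upwards [Measure.quasiMeasurePreserving_fst.ae ξ.nonneg] with z hz
    exact mul_nonneg (hz s) (Real.exp_pos _).le
  summable := ae_of_all _ fun _ => Summable.of_finite
  sum_pos := by
    have := Fintype.ofFinite S
    rw [ae_map_iff (measurable_tilt hE).aemeasurable
      (measurableSet_lt measurable_const (Measurable.tsum fun s => measurable_pi_apply s))]
    obtain ⟨g, -, hle⟩ := hE.bound
    filter_upwards [Measure.quasiMeasurePreserving_fst.ae ξ.ae_isWeight] with z hz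
    exact (hz.tilt zero_le_one (hle z.2)).sum_pos

theorem IsTilt.add (h₁ : IsTilt L₁ E₁) (h₂ : IsTilt L₂ E₂) :
    IsTilt (L₁.prod L₂) fun z s => E₁ z.1 s + E₂ z.2 s := by
  obtain ⟨g₁, i₁, hle₁⟩ := h₁.bound
  obtain ⟨g₂, i₂, hle₂⟩ := h₂.bound
  exact ⟨fun s => ((h₁.measurable s).comp measurable_fst).add
    ((h₂.measurable s).comp measurable_snd), _, (i₁.comp_fst L₂).add (i₂.comp_snd L₁),
    fun D s => (abs_add_le _ _).trans (add_le_add (hle₁ _ _) (hle₂ _ _))⟩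

/-- The chain rule in expectation. The disorder of the first field becomes part of the randomness of
the tilted weights, which stay independent of the second field. -/
theorem tiltMean_add (ξ : RandomWeights S) (h₁ : IsTilt L₁ E₁) (h₂ : IsTilt L₂ E₂) :
    tiltMean ξ (L₁.prod L₂) (fun z s => E₁ z.1 s + E₂ z.2 s) =
      tiltMean ξ L₁ E₁ + tiltMean (ξ.tilt h₁) L₂ E₂ := by
  have m₁ : MeasurePreserving (fun z : (S → ℝ) × Δ₁ × Δ₂ => (z.1, z.2.1))
      (ξ.law.prod (L₁.prod L₂)) (ξ.law.prod L₁) :=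
    (MeasurePreserving.id _).prod measurePreserving_fst
  have mt : MeasurePreserving (fun (z : (S → ℝ) × Δ₁) (s : S) => z.1 s * Real.exp (-1 * E₁ z.2 s))
      (ξ.law.prod L₁) (ξ.tilt h₁).law := ⟨measurable_tilt h₁, rfl⟩
  have m₂ := (mt.prod (MeasurePreserving.id L₂)).comp
    (measurePreserving_prodAssoc_symm_fun ξ.law L₁ L₂)
  have i₁ := h₁.integrable ξ
  have i₂ := h₂.integrable (ξ.tilt h₁)
  have j₁ := (m₁.integrable_comp i₁.aestronglyMeasurable).2 i₁
  have j₂ := (m₂.integrable_comp i₂.aestronglyMeasurable).2 i₂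
  obtain ⟨g₁, -, hle₁⟩ := h₁.bound
  obtain ⟨g₂, -, hle₂⟩ := h₂.bound
  refine (integral_congr_ae ?_).trans ((integral_add j₁ j₂).trans (congrArg₂ (· + ·)
    (integral_comp_of_measurePreserving m₁ i₁.aestronglyMeasurable)
    (integral_comp_of_measurePreserving m₂ i₂.aestronglyMeasurable)))
  filter_upwards [Measure.quasiMeasurePreserving_fst.ae ξ.ae_isWeight] with z hz
  exact hz.logAvg_add zero_le_one (hle₁ z.2.1) (hle₂ z.2.2)

theorem tiltMean_comm (ξ : RandomWeights S) (h₁ : IsTilt L₁ E₁) (h₂ : IsTilt L₂ E₂) :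
    tiltMean ξ L₁ E₁ + tiltMean (ξ.tilt h₁) L₂ E₂ =
      tiltMean ξ L₂ E₂ + tiltMean (ξ.tilt h₂) L₁ E₁ := by
  rw [← tiltMean_add ξ h₁ h₂, ← tiltMean_add ξ h₂ h₁]
  have m : MeasurePreserving (fun z : (S → ℝ) × Δ₁ × Δ₂ => (z.1, z.2.swap))
      (ξ.law.prod (L₁.prod L₂)) (ξ.law.prod (L₂.prod L₁)) :=
    (MeasurePreserving.id _).prod Measure.measurePreserving_swap
  rw [tiltMean, tiltMean, ← integral_comp_of_measurePreserving m
    (measurable_tiltIntegrand (h₂.add h₁)).aestronglyMeasurable]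
  simp only [Prod.fst_swap, Prod.snd_swap, add_comm (E₁ _ _)]

/-- Splitting the fields `E₁ + E₂` against `F₁ + F₂` into two trial functions with tilted
weights. -/
theorem tiltMean_sub_split {Δ₃ Δ₄ : Type} [MeasurableSpace Δ₃] [MeasurableSpace Δ₄]
    {L₃ : Measure Δ₃} {L₄ : Measure Δ₄} [IsProbabilityMeasure L₃] [IsProbabilityMeasure L₄]
    {F₁ : Δ₃ → S → ℝ} {F₂ : Δ₄ → S → ℝ} (ξ : RandomWeights S) (h₁ : IsTilt L₁ E₁)
    (h₂ : IsTilt L₂ E₂) (h₃ : IsTilt L₃ F₁) (h₄ : IsTilt L₄ F₂) :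
    (tiltMean (ξ.tilt h₄) L₁ E₁ - tiltMean (ξ.tilt h₄) L₃ F₁) +
      (tiltMean (ξ.tilt h₁) L₂ E₂ - tiltMean (ξ.tilt h₁) L₄ F₂) =
    tiltMean ξ (L₁.prod L₂) (fun z s => E₁ z.1 s + E₂ z.2 s) -
      tiltMean ξ (L₃.prod L₄) (fun z s => F₁ z.1 s + F₂ z.2 s) := by
  rw [tiltMean_add ξ h₁ h₂, tiltMean_add ξ h₃ h₄]
  -- Interchanging `E₁` with `F₂`, and `F₁` with `F₂`, rewrites both tilts by `F₂` on the left; the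
  -- term of `F₂` under `ξ` itself cancels.
  linarith [tiltMean_comm ξ h₁ h₄, tiltMean_comm ξ h₃ h₄]

end Tilt

/-! ### Superadditivity of the trial functions -/

section Trial

variable {S K E : Type} {M : ℕ} [Finite S] [MeasurableSpace K] [MeasurableSpace E]

/-- The free energy of the added spins in the field of the cavity. -/
def etaField (β h : ℝ) (bE : E → S → ℝ) (D : Sample (E × Fin M)) (s : S) : ℝ :=
  -logAvg β (extWeight β h) fun σ => energy (etaBond bE) D (s, σ)

/-- Summing first over the added spins turns `η` into an effective field on the cavity alone, hence
into a tilt of the weights. The field already contains `β`, so the outer temperature parameter is 1.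
-/
theorem IsWeight.logAvg_cavityWeight {w : S → ℝ} (hw : IsWeight w) {β : ℝ} (hβ : 0 ≤ β) (h : ℝ)
    {F : S × Conf M → ℝ} {C : ℝ} (hF : ∀ x, |F x| ≤ C) :
    logAvg β (cavityWeight β h w) F =
      logAvg 1 w fun s => -logAvg β (extWeight β h) fun σ => F (s, σ) := by
  have hext := isWeight_extWeight (M := M) β h
  obtain ⟨hc, hs⟩ := isWeight_cavityWeight (M := M) β h hw
  rw [logAvg, logAvg]
  refine congrArg Real.log ?_
  rw [gibbs, gibbs, hs, (hc.tilt hβ hF).summable.tsum_prod, mul_comm (∑' s, w s), ← div_div,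
    ← tsum_div_const]
  refine congrArg (· / _) (tsum_congr fun s => ?_)
  have hg : 0 < gibbs (extWeight β h) fun σ => Real.exp (-β * F (s, σ)) :=
    (Real.exp_pos _).trans_le (hext.le_gibbs (fun σ => abs_exp_le hβ (hF (s, σ)))
      fun σ => le_exp hβ (hF (s, σ)))
  rw [neg_mul, one_mul, neg_neg, logAvg, Real.exp_log hg, gibbs, tsum_fintype (extWeight β h),
    mul_div_assoc', ← tsum_mul_left]
  simp only [cavityWeight, mul_assoc]
  rfl

variable {μ : Measure ℝ} [IsProbabilityMeasure μ] {β : ℝ} {bE : E → S → ℝ} {bK : K → S → ℝ}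
  {νE : Measure E} {νK : Measure K} [IsProbabilityMeasure νE] [IsProbabilityMeasure νK]

theorem isTilt_etaField [NeZero M] (hμ : Integrable (fun x : ℝ => x) μ) (hβ : 0 ≤ β) (h : ℝ)
    (hE : IsSpinField bE) {ζ : ℝ} (hζ : 0 ≤ ζ) :
    IsTilt (sampleLaw ζ μ (νE.prod (uniformOn (Set.univ : Set (Fin M))))) (etaField β h bE) := by
  have hb := hE.etaBond (M := M)
  refine ⟨fun s => (measurable_logAvg (W := fun _ => extWeight β h) β (fun _ => measurable_const)
    fun σ => measurable_energy hb.measurable (s, σ)).neg, _,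
    ((integrable_absSum μ (νE.prod (uniformOn Set.univ)) hμ hζ).1).const_mul β, fun D s => ?_⟩
  rw [etaField, abs_neg]
  exact (isWeight_extWeight β h).abs_logAvg_le hβ fun σ => abs_energy_le hb.abs_le D (s, σ)

theorem isTilt_energy (hμ : Integrable (fun x : ℝ => x) μ) (hβ : 0 ≤ β) (hK : IsSpinField bK)
    {ζ : ℝ} (hζ : 0 ≤ ζ) : IsTilt (sampleLaw ζ μ νK) fun D s => β * energy bK D s := by
  refine ⟨fun s => (measurable_energy hK.measurable s).const_mul β, _,
    ((integrable_absSum μ νK hμ hζ).1).const_mul β, fun D s => ?_⟩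
  rw [abs_mul, abs_of_nonneg hβ]
  exact mul_le_mul_of_nonneg_left (abs_energy_le hK.abs_le D s) hβ

theorem logAvg_one_mul (β : ℝ) (w F : S → ℝ) : logAvg 1 w (fun s => β * F s) = logAvg β w F := by
  simp only [logAvg, neg_mul, one_mul]

theorem kappaMean_eq_tiltMean (ζ : ℝ) (ξ : RandomWeights S) :
    kappaMean μ β ζ ξ bK νK = tiltMean ξ (sampleLaw ζ μ νK) fun D s => β * energy bK D s := by
  simp only [tiltMean, logAvg_one_mul]
  rfl

theorem etaMean_eq_tiltMean (hβ : 0 ≤ β) (h ζ : ℝ) (ξ : RandomWeights S) (hE : IsSpinField bE) :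
    etaMean μ β h ζ M ξ bE νE =
      tiltMean ξ (sampleLaw ζ μ (νE.prod (uniformOn (Set.univ : Set (Fin M)))))
        (etaField β h bE) := by
  refine integral_congr_ae ?_
  filter_upwards [Measure.quasiMeasurePreserving_fst.ae ξ.ae_isWeight] with z hz
  exact hz.logAvg_cavityWeight hβ h (abs_energy_le hE.etaBond.abs_le z.2)

/-- Two independent samples act like one of the summed intensity: with three equal bond families the
balance is zero, and both exchange inequalities apply. -/
theorem kappaMean_add_eq_tiltMean (hsymm : μ.map (fun x => -x) = μ)
    (hμ : Integrable (fun x : ℝ => x) μ) (hβ : 0 ≤ β) (ξ : RandomWeights S) (hK : IsSpinField bK)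
    {ζ₁ ζ₂ : ℝ} (h₁ : 0 ≤ ζ₁) (h₂ : 0 ≤ ζ₂) :
    kappaMean μ β (ζ₁ + ζ₂) ξ bK νK = tiltMean ξ ((sampleLaw ζ₁ μ νK).prod (sampleLaw ζ₂ μ νK))
      fun z s => β * energy bK z.1 s + β * energy bK z.2 s := by
  simp only [tiltMean, ← mul_add, logAvg_one_mul]
  have hw : ∀ s : S, Measurable fun w : S → ℝ => w s := fun s => measurable_pi_apply s
  refine le_antisymm
    (le_integral_logAvg_exchange hsymm hμ hβ hw ξ.ae_isWeight hK hK hK h₁ h₂ fun n x => ?_)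
    (integral_logAvg_exchange_le hsymm hμ hβ hw ξ.ae_isWeight hK hK hK h₁ h₂ fun n x => ?_)
  · exact (show _ = (0 : ℝ) by ring).le
  · exact (show _ = (0 : ℝ) by ring).ge

variable {M₁ M₂ : ℕ} [NeZero M₁] [NeZero M₂]

/-- A uniform site of the joint system falls into a block with probability proportional to its size,
so the balance vanishes by `multiOverlap_split`. At a fixed cavity configuration the two blocks are
then decoupled and their effective fields add. -/
theorem etaMean_add_eq_tiltMean (hsymm : μ.map (fun x => -x) = μ)
    (hμ : Integrable (fun x : ℝ => x) μ) (hβ : 0 ≤ β) (h : ℝ) (ξ : RandomWeights S)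
    (hE : IsSpinField bE) {a : ℝ} (ha : 0 ≤ a) :
    etaMean μ β h (a * M₁ + a * M₂) (M₁ + M₂) ξ bE νE =
      tiltMean ξ ((sampleLaw (a * M₁) μ (νE.prod (uniformOn (Set.univ : Set (Fin M₁))))).prod
        (sampleLaw (a * M₂) μ (νE.prod (uniformOn (Set.univ : Set (Fin M₂))))))
        fun z s => etaField β h bE z.1 s + etaField β h bE z.2 s := by
  have : NeZero (M₁ + M₂) := ⟨by have := NeZero.ne M₁; omega⟩
  have hb₁ := hE.etaBond (M := M₁)
  have hb₂ := hE.etaBond (M := M₂)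
  have hs₁ : IsSpinField fun p (x : S × Conf (M₁ + M₂)) =>
      etaBond bE p (x.1, leftConf M₁ M₂ x.2) := ⟨fun s => hb₁.measurable _, fun p s => hb₁.eq_or _ _⟩
  have hs₂ : IsSpinField fun p (x : S × Conf (M₁ + M₂)) =>
      etaBond bE p (x.1, rightConf M₁ M₂ x.2) := ⟨fun s => hb₂.measurable _, fun p s => hb₂.eq_or _ _⟩
  have hgap : ∀ n, ∀ x : Fin n → S × Conf (M₁ + M₂),
      a * M₁ * ∫ p, ∏ i, etaBond bE p ((x i).1, leftConf M₁ M₂ (x i).2)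
        ∂(νE.prod (uniformOn (Set.univ : Set (Fin M₁)))) +
      a * M₂ * ∫ p, ∏ i, etaBond bE p ((x i).1, rightConf M₁ M₂ (x i).2)
        ∂(νE.prod (uniformOn (Set.univ : Set (Fin M₂)))) -
      (a * M₁ + a * M₂) * ∫ p, ∏ i, etaBond bE p (x i)
        ∂(νE.prod (uniformOn (Set.univ : Set (Fin (M₁ + M₂))))) = 0 := fun n x => by
    rw [integral_prod_etaBond νE bE x,
      integral_prod_etaBond νE bE fun i => ((x i).1, leftConf M₁ M₂ (x i).2),
      integral_prod_etaBond νE bE fun i => ((x i).1, rightConf M₁ M₂ (x i).2)]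
    linear_combination (-a * ∫ p, ∏ i, bE p (x i).1 ∂νE) * multiOverlap_split fun i => (x i).2
  have h₁ : 0 ≤ a * M₁ := by positivity
  have h₂ : 0 ≤ a * M₂ := by positivity
  refine (le_antisymm
    (le_integral_logAvg_exchange hsymm hμ hβ (measurable_cavityWeight β h)
      (ae_isWeight_cavityWeight β h ξ) hs₁ hs₂ hE.etaBond h₁ h₂ fun n x => (hgap _ x).le)
    (integral_logAvg_exchange_le hsymm hμ hβ (measurable_cavityWeight β h)
      (ae_isWeight_cavityWeight β h ξ) hs₁ hs₂ hE.etaBond h₁ h₂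
      fun n x => (hgap _ x).ge)).trans (integral_congr_ae ?_)
  filter_upwards [Measure.quasiMeasurePreserving_fst.ae ξ.ae_isWeight] with z hz
  refine (hz.logAvg_cavityWeight hβ h fun x => (abs_add_le _ _).trans
    (add_le_add (abs_energy_le hs₁.abs_le z.2.1 x) (abs_energy_le hs₂.abs_le z.2.2 x))).trans ?_
  refine congrArg (logAvg 1 z.1) (funext fun s => ?_)
  rw [etaField, etaField, ← neg_add, ← logAvg_split hβ h
    (fun σ => abs_energy_le hb₁.abs_le z.2.1 (s, σ)) fun σ => abs_energy_le hb₂.abs_le z.2.2 (s, σ)]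
  rfl

/-- `M` times the trial function, without the contribution of the free spins. -/
def trialMean (μ : Measure ℝ) (α β h : ℝ) (M : ℕ) (ξ : RandomWeights S) (bE : E → S → ℝ)
    (νE : Measure E) (bK : K → S → ℝ) (νK : Measure K) : ℝ :=
  etaMean μ β h (2 * α * M) M ξ bE νE - kappaMean μ β (α * M) ξ bK νK

/-- The first block is tested against weights tilted by the `κ` of the second block, and the second
against weights tilted by the `η` of the first. With these choices the decomposition is exact and
stays on the same cavity. -/
theorem exists_trialMean_add (hsymm : μ.map (fun x => -x) = μ)
    (hμ : Integrable (fun x : ℝ => x) μ) {α : ℝ} (hα : 0 ≤ α) (hβ : 0 ≤ β) (h : ℝ)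
    (ξ : RandomWeights S) (hE : IsSpinField bE) (hK : IsSpinField bK) :
    ∃ ξ₁ ξ₂ : RandomWeights S, trialMean μ α β h M₁ ξ₁ bE νE bK νK +
      trialMean μ α β h M₂ ξ₂ bE νE bK νK =
        trialMean μ α β h (M₁ + M₂) ξ bE νE bK νK := by
  have h₁ : 0 ≤ α * M₁ := by positivity
  have h₂ : 0 ≤ α * M₂ := by positivity
  have hη₁ := isTilt_etaField (M := M₁) (νE := νE) hμ hβ h hE
    (show 0 ≤ 2 * α * M₁ by positivity)
  have hη₂ := isTilt_etaField (M := M₂) (νE := νE) hμ hβ h hE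
    (show 0 ≤ 2 * α * M₂ by positivity)
  have hκ₁ := isTilt_energy (νK := νK) hμ hβ hK h₁
  have hκ₂ := isTilt_energy (νK := νK) hμ hβ hK h₂
  refine ⟨ξ.tilt hκ₂, ξ.tilt hη₁, ?_⟩
  simp only [trialMean]
  rw [Nat.cast_add, mul_add, mul_add, kappaMean_add_eq_tiltMean hsymm hμ hβ ξ hK h₁ h₂,
    etaMean_add_eq_tiltMean hsymm hμ hβ h ξ hE (by positivity), etaMean_eq_tiltMean hβ h _ _ hE,
    etaMean_eq_tiltMean hβ h _ _ hE, kappaMean_eq_tiltMean, kappaMean_eq_tiltMean]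
  exact tiltMean_sub_split ξ hη₁ hη₂ hκ₁ hκ₂

/-- The factor 3 is 2 from the mean `2αM` of `η` plus 1 from the mean `αM` of `κ`. Uniformity in the
weights and in the cavity keeps the infima finite. -/
theorem abs_trialMean_le [NeZero M] (hμ : Integrable (fun x : ℝ => x) μ) {α : ℝ} (hα : 0 ≤ α)
    (hβ : 0 ≤ β) (h : ℝ) (ξ : RandomWeights S) (hE : IsSpinField bE) (hK : IsSpinField bK) :
    |trialMean μ α β h M ξ bE νE bK νK| ≤ 3 * (α * β * ∫ x, |x| ∂μ) * M := by
  have e₁ := (integrable_logAvg_energy (ν₁ := νE.prod (uniformOn (Set.univ : Set (Fin M)))) hμ hβ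
    (measurable_cavityWeight β h) (ae_isWeight_cavityWeight (M := M) β h ξ) hE.etaBond
    (show 0 ≤ 2 * α * M by positivity)).2
  have e₂ := (integrable_logAvg_energy (ν₁ := νK) hμ hβ
    (fun s : S => measurable_pi_apply s) ξ.ae_isWeight hK (show 0 ≤ α * M by positivity)).2
  refine (abs_sub _ _).trans ((add_le_add e₁ e₂).trans (le_of_eq ?_))
  ring

theorem abs_hamMean_le [NeZero M] (hμ : Integrable (fun x : ℝ => x) μ) {α : ℝ} (hα : 0 ≤ α)
    (hβ : 0 ≤ β) (h : ℝ) : |hamMean μ β h (α * M) M| ≤ α * β * (∫ x, |x| ∂μ) * M := by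
  obtain ⟨i, e⟩ := integrable_absSum μ (sitesLaw M M) hμ (show 0 ≤ α * M by positivity)
  rw [hamMean, ← Real.norm_eq_abs]
  refine (norm_integral_le_of_norm_le (i.const_mul β) (ae_of_all _ fun D =>
    (isWeight_extWeight β h).abs_logAvg_le hβ
      (abs_energy_le (isSpinField_pairBond M).abs_le D))).trans (le_of_eq ?_)
  rw [integral_const_mul, e]
  ring

end Trial

/-! ### The thermodynamic limit -/

/-- Fekete's lemma for `-n f(n)`; the factor `n` makes the value of `f` at 0 irrelevant. -/
theorem exists_tendsto_of_superadditive {f : ℕ → ℝ} {C : ℝ} (hC : ∀ n, 0 < n → |f n| ≤ C)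
    (hs : ∀ m n, 0 < m → 0 < n → m * f m + n * f n ≤ (m + n : ℕ) * f (m + n)) :
    ∃ L, Tendsto f atTop (𝓝 L) := by
  have hsub : Subadditive fun n : ℕ => -(n * f n) := fun m n => by
    rcases Nat.eq_zero_or_pos m with rfl | hm
    · simp
    rcases Nat.eq_zero_or_pos n with rfl | hn
    · simp
    linarith [hs m n hm hn]
  have hdiv : ∀ n : ℕ, 0 < n → -(n * f n) / n = -f n := fun n hn => by
    have : (n : ℝ) ≠ 0 := Nat.cast_ne_zero.2 hn.ne'
    field_simp
  have hbdd : BddBelow (Set.range fun n : ℕ => -(n * f n) / n) := by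
    -- The absolute value covers `n = 0`, where the quotient is 0 by convention and the sign of `C`
    -- is not known.
    refine ⟨-|C|, ?_⟩
    rintro _ ⟨n, rfl⟩
    rcases Nat.eq_zero_or_pos n with rfl | hn
    · simp
    simp only []
    rw [hdiv n hn]
    linarith [(le_abs_self _).trans (hC n hn), le_abs_self C]
  refine ⟨-hsub.lim, (hsub.tendsto_lim hbdd).neg.congr' ?_⟩
  filter_upwards [eventually_gt_atTop 0] with n hn
  rw [hdiv n hn, neg_neg]

/-- The pressure of a free spin in the external field. -/
def freePressure (β h : ℝ) : ℝ := Real.log (∑ s : ℤˣ, Real.exp (β * h * spin s))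

theorem log_extPartition (β h : ℝ) (M : ℕ) :
    Real.log (extPartition β h M) = M * freePressure β h := by
  rw [freePressure, ← Real.log_pow, Fintype.sum_pow]
  refine congrArg Real.log (Finset.sum_congr rfl fun σ _ => ?_)
  rw [extWeight, extEnergy, ← Real.exp_sum, ← Finset.mul_sum]
  ring_nf

section Limit

variable {μ : Measure ℝ} [IsProbabilityMeasure μ] {α β : ℝ} {M : ℕ} [NeZero M]

theorem mul_negBetaF (hμ : Integrable (fun x : ℝ => x) μ) (hα : 0 ≤ α) (hβ : 0 ≤ β) (h : ℝ) :
    M * negBetaF μ α β h M = hamMean μ β h (α * M) M + M * freePressure β h := by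
  rw [negBetaF, one_div, mul_inv_cancel_left₀ (Nat.cast_ne_zero.2 (NeZero.ne M)),
    (integral_log_partitionFunction hμ hβ h hα).2, log_extPartition]

theorem mul_trialG (hμ : Integrable (fun x : ℝ => x) μ) (hα : 0 ≤ α) (hβ : 0 ≤ β) (h : ℝ)
    {N : ℕ} [NeZero N] (ξ : RandomWeights (Conf N)) :
    M * trialG μ α β h N M ξ = trialMean μ α β h M ξ (siteBond N) (uniformOn Set.univ) (pairBond N)
      (sitesLaw N N) + M * freePressure β h := by
  rw [trialG, one_div, mul_inv_cancel_left₀ (Nat.cast_ne_zero.2 (NeZero.ne M)),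
    (integral_trialLog hμ hα hβ h ξ).2, log_extPartition, trialMean]
  ring

theorem abs_le_add_of_mul_eq {x y c C : ℝ} (hx : M * x = y + M * c) (hy : |y| ≤ C * M) :
    |x| ≤ C + |c| := by
  have hM : (0 : ℝ) < M := Nat.cast_pos.2 (NeZero.pos M)
  have e : x = y / M + c := by field_simp; linarith
  rw [e]
  refine (abs_add_le _ _).trans (add_le_add_left ?_ _)
  rwa [abs_div, abs_of_pos hM, div_le_iff₀ hM]

theorem abs_negBetaF_le (hμ : Integrable (fun x : ℝ => x) μ) (hα : 0 ≤ α) (hβ : 0 ≤ β) (h : ℝ) :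
    |negBetaF μ α β h M| ≤ α * β * (∫ x, |x| ∂μ) + |freePressure β h| :=
  abs_le_add_of_mul_eq (mul_negBetaF (M := M) hμ hα hβ h) (abs_hamMean_le hμ hα hβ h)

theorem abs_trialG_le (hμ : Integrable (fun x : ℝ => x) μ) (hα : 0 ≤ α) (hβ : 0 ≤ β) (h : ℝ)
    {N : ℕ} [NeZero N] (ξ : RandomWeights (Conf N)) :
    |trialG μ α β h N M ξ| ≤ 3 * (α * β * ∫ x, |x| ∂μ) + |freePressure β h| :=
  abs_le_add_of_mul_eq (mul_trialG (M := M) hμ hα hβ h ξ)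
    (abs_trialMean_le hμ hα hβ h ξ (isSpinField_siteBond N) (isSpinField_pairBond N))

theorem exists_tendsto_negBetaF (hsymm : μ.map (fun x => -x) = μ)
    (hμ : Integrable (fun x : ℝ => x) μ) (hα : 0 ≤ α) (hβ : 0 ≤ β) (h : ℝ) :
    ∃ F, Tendsto (negBetaF μ α β h) atTop (𝓝 F) := by
  refine exists_tendsto_of_superadditive (C := α * β * (∫ x, |x| ∂μ) + |freePressure β h|)
    (fun M hM => ?_) fun M₁ M₂ h₁ h₂ => ?_
  · have : NeZero M := ⟨hM.ne'⟩
    exact abs_negBetaF_le hμ hα hβ h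
  · have : NeZero M₁ := ⟨h₁.ne'⟩
    have : NeZero M₂ := ⟨h₂.ne'⟩
    have : NeZero (M₁ + M₂) := ⟨by omega⟩
    rw [mul_negBetaF hμ hα hβ, mul_negBetaF hμ hα hβ, mul_negBetaF hμ hα hβ]
    have := hamMean_superadditive (M₁ := M₁) (M₂ := M₂) hsymm hμ hα hβ h
    have e : ((M₁ + M₂ : ℕ) : ℝ) = M₁ + M₂ := Nat.cast_add _ _
    rw [e, add_mul, ← e]
    linarith

/-- The infimum of the trial function over all cavities and all weights. -/
def trialInf (μ : Measure ℝ) (α β h : ℝ) (M : ℕ) : ℝ :=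
  ⨅ p : (N : ℕ+) × RandomWeights (Conf N), trialG μ α β h p.1 M p.2

instance nonempty_sigma_randomWeights : Nonempty ((N : ℕ+) × RandomWeights (Conf N)) :=
  ⟨⟨1, (nonempty_randomWeights _).some⟩⟩

instance neZero_pnat (N : ℕ+) : NeZero (N : ℕ) := ⟨N.ne_zero⟩

theorem bddBelow_trialG (hμ : Integrable (fun x : ℝ => x) μ) (hα : 0 ≤ α) (hβ : 0 ≤ β) (h : ℝ) :
    BddBelow (Set.range fun p : (N : ℕ+) × RandomWeights (Conf N) =>
      trialG μ α β h p.1 M p.2) := by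
  refine ⟨-(3 * (α * β * ∫ x, |x| ∂μ) + |freePressure β h|), ?_⟩
  rintro _ ⟨p, rfl⟩
  exact (abs_le.1 (abs_trialG_le hμ hα hβ h p.2)).1

theorem abs_trialInf_le (hμ : Integrable (fun x : ℝ => x) μ) (hα : 0 ≤ α) (hβ : 0 ≤ β) (h : ℝ) :
    |trialInf μ α β h M| ≤ 3 * (α * β * ∫ x, |x| ∂μ) + |freePressure β h| := by
  have hb := fun p : (N : ℕ+) × RandomWeights (Conf N) =>
    abs_le.1 (abs_trialG_le (M := M) hμ hα hβ h p.2)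
  obtain ⟨p⟩ := nonempty_sigma_randomWeights
  exact abs_le.2 ⟨le_ciInf fun p => (hb p).1,
    (ciInf_le (bddBelow_trialG hμ hα hβ h) p).trans (hb p).2⟩

/-- Each trial value for `M₁ + M₂` spins splits into trial values for `M₁` and `M₂` spins, both
bounded below by their infima. Hence `M` times the infimum is superadditive. -/
theorem exists_tendsto_trialInf (hsymm : μ.map (fun x => -x) = μ)
    (hμ : Integrable (fun x : ℝ => x) μ) (hα : 0 ≤ α) (hβ : 0 ≤ β) (h : ℝ) :
    ∃ L, Tendsto (trialInf μ α β h) atTop (𝓝 L) := by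
  refine exists_tendsto_of_superadditive
    (C := 3 * (α * β * ∫ x, |x| ∂μ) + |freePressure β h|) (fun M hM => ?_) fun M₁ M₂ h₁ h₂ => ?_
  · have : NeZero M := ⟨hM.ne'⟩
    exact abs_trialInf_le hμ hα hβ h
  · have : NeZero M₁ := ⟨h₁.ne'⟩
    have : NeZero M₂ := ⟨h₂.ne'⟩
    have : NeZero (M₁ + M₂) := ⟨by omega⟩
    have hpos : (0 : ℝ) < (M₁ + M₂ : ℕ) := Nat.cast_pos.2 (by omega)
    rw [mul_comm ((M₁ + M₂ : ℕ) : ℝ), ← div_le_iff₀ hpos]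
    refine le_ciInf fun p => ?_
    obtain ⟨ξ₁, ξ₂, e⟩ := exists_trialMean_add (M₁ := M₁) (M₂ := M₂) (νE := uniformOn Set.univ)
      (νK := sitesLaw p.1 p.1) hsymm hμ hα hβ h p.2 (isSpinField_siteBond p.1)
      (isSpinField_pairBond p.1)
    have i₁ := mul_le_mul_of_nonneg_left (ciInf_le (bddBelow_trialG (M := M₁) hμ hα hβ h)
      ⟨p.1, ξ₁⟩) (Nat.cast_nonneg (α := ℝ) M₁)
    have i₂ := mul_le_mul_of_nonneg_left (ciInf_le (bddBelow_trialG (M := M₂) hμ hα hβ h)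
      ⟨p.1, ξ₂⟩) (Nat.cast_nonneg (α := ℝ) M₂)
    have e₁ := mul_trialG (M := M₁) hμ hα hβ h ξ₁
    have e₂ := mul_trialG (M := M₂) hμ hα hβ h ξ₂
    have e₃ := mul_trialG (M := M₁ + M₂) hμ hα hβ h p.2
    have hc : ((M₁ + M₂ : ℕ) : ℝ) * freePressure β h =
        M₁ * freePressure β h + M₂ * freePressure β h := by rw [Nat.cast_add, add_mul]
    rw [div_le_iff₀ hpos, mul_comm (trialG _ _ _ _ _ _ _), e₃, hc, ← e]
    exact (add_le_add i₁ i₂).trans (by linarith)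

theorem negBetaF_le_iInf_trialG (hsymm : μ.map (fun x => -x) = μ)
    (hμ : Integrable (fun x : ℝ => x) μ) (hα : 0 ≤ α) (hβ : 0 ≤ β) (h : ℝ) (N : ℕ) [NeZero N] :
    negBetaF μ α β h M ≤ ⨅ ξ : RandomWeights (Conf N), trialG μ α β h N M ξ := by
  have := nonempty_randomWeights (Conf N)
  exact le_ciInf fun ξ => negBetaF_le_trialG hsymm hμ hα hβ h ξ

theorem negBetaF_le_trialInf (hsymm : μ.map (fun x => -x) = μ)
    (hμ : Integrable (fun x : ℝ => x) μ) (hα : 0 ≤ α) (hβ : 0 ≤ β) (h : ℝ) :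
    negBetaF μ α β h M ≤ trialInf μ α β h M :=
  le_ciInf fun p => negBetaF_le_trialG hsymm hμ hα hβ h p.2

theorem iInf_trialG_le (hμ : Integrable (fun x : ℝ => x) μ) (hα : 0 ≤ α) (hβ : 0 ≤ β) (h : ℝ)
    (N : ℕ) [NeZero N] : ⨅ ξ : RandomWeights (Conf N), trialG μ α β h N M ξ ≤
      3 * (α * β * ∫ x, |x| ∂μ) + |freePressure β h| := by
  obtain ⟨ξ⟩ := nonempty_randomWeights (Conf N)
  refine (ciInf_le ⟨-(3 * (α * β * ∫ x, |x| ∂μ) + |freePressure β h|), ?_⟩ ξ).trans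
    (abs_le.1 (abs_trialG_le hμ hα hβ h ξ)).2
  rintro _ ⟨ξ', rfl⟩
  exact (abs_le.1 (abs_trialG_le hμ hα hβ h ξ')).1

theorem le_liminf_iInf_trialG (hsymm : μ.map (fun x => -x) = μ)
    (hμ : Integrable (fun x : ℝ => x) μ) (hα : 0 ≤ α) (hβ : 0 ≤ β) (h : ℝ) {F : ℝ}
    (hF : Tendsto (negBetaF μ α β h) atTop (𝓝 F)) {N : ℕ → ℕ} (hN : ∀ M, 0 < N M) :
    F ≤ liminf (fun M : ℕ =>
      ⨅ ξ : RandomWeights (Conf (N M)), trialG μ α β h (N M) M ξ) atTop := by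
  have hN' : ∀ M, NeZero (N M) := fun M => ⟨(hN M).ne'⟩
  -- A real `liminf` is meaningful only for a sequence that does not run off to infinity; the
  -- uniform bound on the trial functions excludes this whatever the cavity sizes.
  have hub : IsBoundedUnder (· ≤ ·) atTop fun M : ℕ =>
      ⨅ ξ : RandomWeights (Conf (N M)), trialG μ α β h (N M) M ξ := by
    refine isBoundedUnder_of_eventually_le
      (a := 3 * (α * β * ∫ x, |x| ∂μ) + |freePressure β h|) ?_
    filter_upwards [eventually_gt_atTop 0] with M hM
    have : NeZero M := ⟨hM.ne'⟩
    exact iInf_trialG_le hμ hα hβ h (N M)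
  rw [← hF.liminf_eq]
  refine liminf_le_liminf ?_ hF.isBoundedUnder_ge hub.isCoboundedUnder_ge
  filter_upwards [eventually_gt_atTop 0] with M hM
  have : NeZero M := ⟨hM.ne'⟩
  exact negBetaF_le_iInf_trialG hsymm hμ hα hβ h (N M)

end Limit

end VianaBray

end

/-! ### The generalized bound -/

theorem theorem1 (μ : Measure ℝ) [IsProbabilityMeasure μ]
    (hsymm : μ.map (fun x => -x) = μ) (hint : Integrable (fun x : ℝ => x) μ)
    (α β h : ℝ) (hα : 0 ≤ α) (hβ : 0 ≤ β) (hh : 0 ≤ h) :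
    -- the free energy is the expectation of an integrable variable
    (∀ M : ℕ, 0 < M →
      Integrable (fun D => Real.log (partitionFunction β h D)) (hamLaw μ α M)) ∧
    -- the interpolation, its derivative, and the bound for all cavity sizes and all weights
    (∀ N M : ℕ, 0 < N → 0 < M → ∀ ξ : RandomWeights (Conf N),
      (∀ t ∈ Set.Icc (0 : ℝ) 1, Integrable (interpLog β h) (disorderLaw μ α N M ξ t)) ∧
      Integrable (trialLog β h) (trialLaw μ α N M ξ) ∧
      interpR μ α β h N M ξ 0 = trialG μ α β h N M ξ ∧
      interpR μ α β h N M ξ 1 = negBetaF μ α β h M ∧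
      (∀ t ∈ Set.Icc (0 : ℝ) 1,
        Summable (fun n : ℕ => gapTerm μ α β h N M ξ t (n + 1)) ∧
        HasDerivWithinAt (interpR μ α β h N M ξ)
          (-α * ∑' n : ℕ, gapTerm μ α β h N M ξ t (n + 1)) (Set.Icc 0 1) t ∧
        -α * ∑' n : ℕ, gapTerm μ α β h N M ξ t (n + 1) ≤ 0) ∧
      negBetaF μ α β h M ≤ trialG μ α β h N M ξ) ∧
    -- the infimum over the weights, for a given cavity and over all cavities
    (∀ N M : ℕ, 0 < N → 0 < M →
      negBetaF μ α β h M ≤ ⨅ ξ : RandomWeights (Conf N), trialG μ α β h N M ξ) ∧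
    (∀ M : ℕ, 0 < M →
      negBetaF μ α β h M ≤
        ⨅ p : (N : ℕ+) × RandomWeights (Conf N), trialG μ α β h p.1 M p.2) ∧
    -- the thermodynamic limit
    (∃ F L : ℝ,
      Tendsto (negBetaF μ α β h) atTop (𝓝 F) ∧
      Tendsto (fun M : ℕ =>
        ⨅ p : (N : ℕ+) × RandomWeights (Conf N), trialG μ α β h p.1 M p.2) atTop (𝓝 L) ∧
      F ≤ L ∧
      ∀ N : ℕ → ℕ, (∀ M, 0 < N M) →
        F ≤ liminf (fun M : ℕ =>
          ⨅ ξ : RandomWeights (Conf (N M)), trialG μ α β h (N M) M ξ) atTop) ∧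
    -- the bound for all Random Multi-Overlap Structures
    (∀ M : ℕ, 0 < M →
      (∀ (R : RaMOSt) (A : R.Fields),
        Integrable (ramostLog β h) (ramostLaw μ α M R A) ∧
        negBetaF μ α β h M ≤ ramostG μ α β h M R A) ∧
      negBetaF μ α β h M ≤ ⨅ p : (R : RaMOSt) × R.Fields, ramostG μ α β h M p.1 p.2) := by
  refine ⟨fun M hM => ?_, fun N M hN hM ξ => ?_, fun N M hN hM => ?_, fun M hM => ?_, ?_,
    fun M hM => ?_⟩
  · have : NeZero M := ⟨hM.ne'⟩
    exact (integral_log_partitionFunction hint hβ h hα).1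
  · have : NeZero N := ⟨hN.ne'⟩
    have : NeZero M := ⟨hM.ne'⟩
    exact ⟨fun t ht => (integral_interpLog hint hα hβ h ξ ht).1,
      (integral_trialLog hint hα hβ h ξ).1, interpR_zero hint hα hβ h ξ,
      interpR_one hint hα hβ h ξ, fun t ht => hasDerivWithinAt_interpR hsymm hint hα hβ h ξ ht,
      negBetaF_le_trialG hsymm hint hα hβ h ξ⟩
  · have : NeZero N := ⟨hN.ne'⟩
    have : NeZero M := ⟨hM.ne'⟩
    exact negBetaF_le_iInf_trialG hsymm hint hα hβ h N
  · have : NeZero M := ⟨hM.ne'⟩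
    exact negBetaF_le_trialInf hsymm hint hα hβ h
  · obtain ⟨F, hF⟩ := exists_tendsto_negBetaF hsymm hint hα hβ h
    obtain ⟨L, hL⟩ := exists_tendsto_trialInf hsymm hint hα hβ h
    refine ⟨F, L, hF, hL, le_of_tendsto_of_tendsto hF hL ?_,
      fun N hN => le_liminf_iInf_trialG hsymm hint hα hβ h hF hN⟩
    filter_upwards [eventually_gt_atTop 0] with M hM
    have : NeZero M := ⟨hM.ne'⟩
    exact negBetaF_le_trialInf hsymm hint hα hβ h
  · have : NeZero M := ⟨hM.ne'⟩
    have := nonempty_ramost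
    exact ⟨fun R A => integrable_ramostLog_and_negBetaF_le hsymm hint h hα hβ R A,
      le_ciInf fun p => (integrable_ramostLog_and_negBetaF_le hsymm hint h hα hβ p.1 p.2).2⟩
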